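/- **Setting.** Let $\mathcal S,\mathcal A$ be finite nonempty sets, $S=|\mathcal S|$, $A=|\mathcal A|$, and let $H\ge 1$. An episodic MDP $\mathcal M$ consists, for every step $h\in[H]=\{1,\dots,H\}$ and state $s\in\mathcal S$, of a joint law $P_h(s)$ on $\mathcal S^{\mathcal A}$ of the next states $\boldsymbol s'=(s'(a))_{a\in\mathcal A}$ of all actions, and a joint law $\mathcal R_h(s)$ of the rewards of all actions, supported on $[0,1]^{\mathcal A}$. Samples are independent between different steps, and next states are independent of rewards; samples of different actions may be dependent. With one-step transition lookahead, the agent at $(h,s)$ observes $\boldsymbol s'\sim P_h(s)$ before it chooses $a$; it then collects the reward $R(a)$ of this action and moves to $s'(a)$. A transition lookahead policy is a map $\pi:[H]\times\mathcal S\times\mathcal S^{\mathcal A}\to\Delta_{\mathcal A}$; its value $V^\pi_h(s)$ is the expected sum of the rewards collected from step $h$ to step $H$ when $s_h=s$, and $V^*_h(s)=\sup_\pi V^\pi_h(s)$ over all such policies. In episode $k=1,2,\dots$ the initial state $s^k_1$ is arbitrary (it may depend on the past), the learner plays a policy $\pi^k$ determined from the data of the previous episodes, and $$\mathrm{Reg}(K)=\sum_{k=1}^K\bigl(V^*_1(s^k_1)-V^{\pi^k}_1(s^k_1)\bigr).$$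 **MVP-TL with parameter $\delta\in(0,1)$.** At the start of episode $k$ let $n_h(s)$, $n_h(s,a)$ be the numbers of visits of $s$, of $(s,a)$, at step $h$ in the episodes $1,\dots,k-1$; let $\hat r_h(s,a)$ be the empirical mean reward ($0$ without data), and $\hat P_h(s)$ the empirical joint law of the next-state vectors observed at the visits of $s$ at step $h$. Put $L=\ln\frac{16S^3A^2Hk^2(k+1)}{\delta}$ and $b^r_h(s,a)=\min\bigl\{\sqrt{L/(n_h(s,a)\vee1)},1\bigr\}$. Set $\bar V_{H+1}=0$, and for $h=H,\dots,1$ and $s\in\mathcal S$ let $$\bar V_h(s,\boldsymbol s')=\max_{a}\bigl\{\hat r_h(s,a)+b^r_h(s,a)+\bar V_{h+1}(s'(a))\bigr\},$$ $$b^p_h(s)=\tfrac{20}{3}\sqrt{\frac{\mathrm{Var}_{\boldsymbol s'\sim\hat P_h(s)}(\bar V_h(s,\boldsymbol s'))\,L}{n_h(s)\vee1}}+\tfrac{400}{3}\,\frac{HL}{n_h(s)\vee 1},$$ $$\bar V_h(s)=\min\bigl\{\mathbb E_{\boldsymbol s'\sim\hat P_h(s)}[\bar V_h(s,\boldsymbol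 s')]+b^p_h(s),\,H\bigr\}\ \text{ if } n_h(s)\ge1,\qquad \bar V_h(s)=H\ \text{ if } n_h(s)=0 .$$ In episode $k$ the learner plays $\pi^k_h(s,\boldsymbol s')\in\arg\max_a\{\hat r_h(s,a)+b^r_h(s,a)+\bar V_{h+1}(s'(a))\}$, ties being broken arbitrarily. **Theorem.** There is an absolute constant $C>0$ such that, for every such $\mathcal M$ and every $\delta\in(0,1)$, when MVP-TL is run with parameter $\delta$, with probability at least $1-\delta$ the following holds for all $K\ge1$ simultaneously: $$\mathrm{Reg}(K)\le C\Bigl(\sqrt{H^2SK}\,\bigl(\sqrt H+\sqrt A\bigr)\ln\frac{SAHK}{\delta}+H^3S^4A^3\Bigl(\ln\frac{SAHK}{\delta}\Bigr)^2\Bigr).$$ -/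

import Mathlib

open MeasureTheory ProbabilityTheory

namespace LookaheadRL

/-- A finite-horizon tabular Markov decision process with state space `S`, action space `A` and
horizon `H`; the steps `1, …, H` of an episode are numbered `0, …, H - 1`.
* `trans h s` is the joint law of the next states `(s'(a))_{a ∈ A}` of all the actions, when the
  state at step `h` is `s` (next states of different actions may be dependent);
* `reward h s` is the joint law of the rewards `(R(a))_{a ∈ A}` of all the actions. -/
structure MDP (S A : Type*) (H : ℕ) where
  trans : Fin H → S → PMF (A → S)
  reward : Fin H → S → Measure (A → ℝ)
  reward_prob : ∀ h s, IsProbabilityMeasure (reward h s)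
  reward_mem : ∀ h s, ∀ᵐ R ∂(reward h s), ∀ a, R a ∈ Set.Icc (0 : ℝ) 1

/-- One-step transition lookahead policies: the (random) action at step `h` depends on the current
state and on the observed next states of all the actions. -/
abbrev Policy (S A : Type*) (H : ℕ) := Fin H → S → (A → S) → PMF A

/-- Deterministic one-step transition lookahead policies. -/
abbrev DetPolicy (S A : Type*) (H : ℕ) := Fin H → S → (A → S) → A

/-- A deterministic policy as a policy. -/
noncomputable def DetPolicy.toPolicy {S A : Type*} {H : ℕ} (π : DetPolicy S A H) :
    Policy S A H :=
  fun h s v => PMF.pure (π h s v)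

namespace MDP

variable {S A : Type*} [Fintype S] [Fintype A] [DecidableEq A] {H : ℕ}

/-- The law of the return `R_h + R_{h+1} + ⋯` collected by the policy `π` from step `h` (inclusive)
to the end of the episode, when the state at step `h` is `s`: the next-state vector `v` is drawn
from `trans h s`, the action `a` from `π h s v`, the rewards from `reward h s`, independently of
`v` and `a`; the reward of `a` is collected, and the episode goes on at step `h + 1` from `v a`. -/
noncomputable def returnLaw (M : MDP S A H) (π : Policy S A H) (h : ℕ) (s : S) : Measure ℝ :=
  if hh : h < H then
    ∑ v : A → S, (M.trans ⟨h, hh⟩ s v) • ∑ a : A, (π ⟨h, hh⟩ s v a) •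
      Measure.conv ((M.reward ⟨h, hh⟩ s).map (fun R => R a)) (returnLaw M π (h + 1) (v a))
  else Measure.dirac 0
termination_by H - h

/-- The value of `π` at step `h` and state `s`: the expected return. -/
noncomputable def value (M : MDP S A H) (π : Policy S A H) (h : ℕ) (s : S) : ℝ :=
  ∫ x, x ∂(M.returnLaw π h s)

/-- The optimal value over all transition lookahead policies. -/
noncomputable def optimalValue (M : MDP S A H) (h : ℕ) (s : S) : ℝ :=
  ⨆ π : Policy S A H, M.value π h s

end MDP

/-- What the learner records at one step of one episode: the state, the observed next states of all
the actions, the action played and the reward collected. -/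
structure Record (S A : Type*) where
  state : S
  next : A → S
  action : A
  reward : ℝ

/-- The records of all steps of all episodes. Episodes are numbered `0, 1, 2, …`; what is computed
at the beginning of episode `k` uses the `k` episodes `j < k` only. -/
abbrev Data (S A : Type*) (H : ℕ) := ℕ → Fin H → Record S A

namespace Data

variable {S A : Type*} [Fintype S] [DecidableEq S] [Fintype A] [DecidableEq A] {H : ℕ}

/-- Number of visits of `s` at step `h` during the first `k` episodes. -/
def count (D : Data S A H) (k : ℕ) (h : Fin H) (s : S) : ℕ :=
  ((Finset.range k).filter (fun j => (D j h).state = s)).card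

/-- Number of visits of the pair `(s, a)` at step `h` during the first `k` episodes. -/
def countSA (D : Data S A H) (k : ℕ) (h : Fin H) (s : S) (a : A) : ℕ :=
  ((Finset.range k).filter (fun j => (D j h).state = s ∧ (D j h).action = a)).card

/-- Empirical mean reward of `(s, a)` at step `h` (zero before the first visit). -/
noncomputable def empReward (D : Data S A H) (k : ℕ) (h : Fin H) (s : S) (a : A) : ℝ :=
  (∑ j ∈ (Finset.range k).filter (fun j => (D j h).state = s ∧ (D j h).action = a),
    (D j h).reward) / (D.countSA k h s a : ℝ)

/-- Expectation of `f` under the empirical joint law of the next states of all the actions at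
`(h, s)` (zero before the first visit). -/
noncomputable def empMean (D : Data S A H) (k : ℕ) (h : Fin H) (s : S) (f : (A → S) → ℝ) : ℝ :=
  (∑ j ∈ (Finset.range k).filter (fun j => (D j h).state = s), f (D j h).next) /
    (D.count k h s : ℝ)

/-- Variance of `f` under the same empirical law. -/
noncomputable def empVar (D : Data S A H) (k : ℕ) (h : Fin H) (s : S) (f : (A → S) → ℝ) : ℝ :=
  D.empMean k h s (fun v => f v ^ 2) - (D.empMean k h s f) ^ 2

/-- The logarithmic factor `ln (16 S³ A² H κ² (κ + 1) / δ)`, where `κ = k + 1` is the ordinal of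
episode `k`. -/
noncomputable def logFactor (S A : Type*) [Fintype S] [Fintype A] (H : ℕ) (δ : ℝ) (k : ℕ) : ℝ :=
  Real.log (16 * (Fintype.card S : ℝ) ^ 3 * (Fintype.card A : ℝ) ^ 2 * (H : ℝ) *
    ((k : ℝ) + 1) ^ 2 * ((k : ℝ) + 2) / δ)

/-- Reward bonus. -/
noncomputable def rewardBonus (D : Data S A H) (δ : ℝ) (k : ℕ) (h : Fin H) (s : S) (a : A) : ℝ :=
  min (Real.sqrt (logFactor S A H δ k / max (D.countSA k h s a : ℝ) 1)) 1

/-- Optimistic value of playing `a` in state `s` at step `h` and moving to `s'`, given optimistic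
values `V` for the next step. -/
noncomputable def score (D : Data S A H) (δ : ℝ) (k : ℕ) (h : Fin H) (V : S → ℝ)
    (s s' : S) (a : A) : ℝ :=
  D.empReward k h s a + D.rewardBonus δ k h s a + V s'

/-- Optimistic value of state `s` at step `h` when the next states `v` are observed. -/
noncomputable def lookaheadValue [Nonempty A] (D : Data S A H) (δ : ℝ) (k : ℕ) (h : Fin H)
    (V : S → ℝ) (s : S) (v : A → S) : ℝ :=
  Finset.univ.sup' Finset.univ_nonempty (fun a : A => D.score δ k h V s (v a) a)

/-- Variance-based transition bonus, for the optimistic lookahead values `W`. -/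
noncomputable def transBonus (D : Data S A H) (δ : ℝ) (k : ℕ) (h : Fin H) (s : S)
    (W : (A → S) → ℝ) : ℝ :=
  20 / 3 * Real.sqrt (D.empVar k h s W * logFactor S A H δ k / max (D.count k h s : ℝ) 1) +
    400 / 3 * ((H : ℝ) * logFactor S A H δ k / max (D.count k h s : ℝ) 1)

/-- The truncated optimistic values computed by MVP-TL at the beginning of episode `k`, by backward
induction over the steps. -/
noncomputable def optimisticValue [Nonempty A] (D : Data S A H) (δ : ℝ) (k : ℕ) (h : ℕ) (s : S) :
    ℝ :=
  if hh : h < H then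
    if D.count k ⟨h, hh⟩ s = 0 then (H : ℝ)
    else
      min (D.empMean k ⟨h, hh⟩ s
            (D.lookaheadValue δ k ⟨h, hh⟩ (fun s' => optimisticValue D δ k (h + 1) s') s) +
          D.transBonus δ k ⟨h, hh⟩ s
            (D.lookaheadValue δ k ⟨h, hh⟩ (fun s' => optimisticValue D δ k (h + 1) s') s))
        (H : ℝ)
  else 0
termination_by H - h

/-- `π` is a policy that MVP-TL may use in episode `k`: it plays an action of maximal optimistic
value, ties being broken arbitrarily. -/
def IsGreedy [Nonempty A] (D : Data S A H) (δ : ℝ) (k : ℕ) (π : DetPolicy S A H) : Prop :=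
  ∀ (h : Fin H) (s : S) (v : A → S) (a : A),
    D.score δ k h (D.optimisticValue δ k (h + 1)) s (v a) a ≤
      D.score δ k h (D.optimisticValue δ k (h + 1)) s (v (π h s v)) (π h s v)

end Data

/-- The random variables of an episodic interaction. For episode `k` and step `h`:
`state k h` is the state (`h = H` is the state after the last step), `next k h` the vector of next
states of all the actions, `rew k h` the vector of rewards of all the actions; `pol k` is the policy
played in episode `k`. -/
structure Interaction (S A : Type*) (H : ℕ) (Ω : Type*) where
  state : ℕ → Fin (H + 1) → Ω → S
  next : ℕ → Fin H → Ω → A → S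
  rew : ℕ → Fin H → Ω → A → ℝ
  pol : ℕ → Ω → DetPolicy S A H

namespace Interaction

variable {S A : Type*} {H : ℕ} {Ω : Type*}

/-- The action played at step `h` of episode `k`. -/
def action (I : Interaction S A H Ω) (k : ℕ) (h : Fin H) (ω : Ω) : A :=
  I.pol k ω h (I.state k h.castSucc ω) (I.next k h ω)

/-- The reward collected at step `h` of episode `k`. -/
def reward (I : Interaction S A H Ω) (k : ℕ) (h : Fin H) (ω : Ω) : ℝ :=
  I.rew k h ω (I.action k h ω)

/-- The data seen by the learner. -/
def data (I : Interaction S A H Ω) (ω : Ω) : Data S A H :=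
  fun k h => ⟨I.state k h.castSucc ω, I.next k h ω, I.action k h ω, I.reward k h ω⟩

/-- The interaction takes place in the environment `M`. The `σ`-algebra `ℱ (k * H + h)` contains
all that happened before step `h` of episode `k`, including the state at that step; at `h = 0` it
also contains the policy of episode `k`. Apart from this measurability, initial states and policies
are arbitrary, so that both may be chosen depending on the past. -/
structure InEnvironment [MeasurableSpace Ω] (I : Interaction S A H Ω) (M : MDP S A H)
    (μ : Measure Ω) (ℱ : Filtration ℕ ‹MeasurableSpace Ω›) : Prop where
  init_measurable : ∀ k, Measurable[ℱ (k * H), ⊤] (I.state k 0)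
  pol_measurable : ∀ k, Measurable[ℱ (k * H), ⊤] (I.pol k)
  next_measurable : ∀ (k : ℕ) (h : Fin H), Measurable[ℱ (k * H + h + 1), ⊤] (I.next k h)
  rew_measurable : ∀ (k : ℕ) (h : Fin H), Measurable (I.rew k h)
  reward_measurable : ∀ (k : ℕ) (h : Fin H), Measurable[ℱ (k * H + h + 1)] (I.reward k h)
  /-- The next state is the observed one of the action played. -/
  step : ∀ (k : ℕ) (h : Fin H) (ω : Ω),
    I.state k h.succ ω = I.next k h ω (I.action k h ω)
  /-- Given the past, the next states and the rewards of all the actions are independent, with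
  the laws prescribed by `M` at the current state. -/
  cond_law : ∀ (k : ℕ) (h : Fin H) (v : A → S) (B : Set (A → ℝ)), MeasurableSet B →
    μ⟦{ω | I.next k h ω = v ∧ I.rew k h ω ∈ B}|ℱ (k * H + h)⟧ =ᵐ[μ]
      fun ω => (M.trans h (I.state k h.castSucc ω) v).toReal *
        (M.reward h (I.state k h.castSucc ω)).real B

/-- The learner runs MVP-TL with confidence parameter `δ`. -/
def RunsMVPTL [Fintype S] [DecidableEq S] [Fintype A] [DecidableEq A] [Nonempty A]
    (I : Interaction S A H Ω) (δ : ℝ) : Prop :=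
  ∀ (ω : Ω) (k : ℕ), (I.data ω).IsGreedy δ k (I.pol k ω)

/-- The regret of the first `K` episodes against the optimal transition lookahead value. -/
noncomputable def regret [Fintype S] [Fintype A] [DecidableEq A]
    (I : Interaction S A H Ω) (M : MDP S A H) (K : ℕ) (ω : Ω) : ℝ :=
  ∑ k ∈ Finset.range K,
    (M.optimalValue 0 (I.state k 0 ω) - M.value (I.pol k ω).toPolicy 0 (I.state k 0 ω))

end Interaction

end LookaheadRL

set_option linter.unusedSectionVars false

namespace LookaheadRL

/-! The proof is optimism with variance-sensitive bonuses. The statistical point is that, although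
the learner estimates a law on `A → S`, the estimation costs a factor of order `SA` only, not one
that grows like the number of next-state vectors. Write Q* (`bellmanLookahead`), Q^π
(`policyLookahead`) and W (`optLookahead`) for the optimal, the policy's and the optimistic values
after the next states have been observed; P and E are the true and the empirical mean over next
states.

Optimism: Bernstein's inequality is needed for the fixed function Q* only. The mean plus the maximum
of the variance bonus and a constant is monotone above functions with values in `[0, B]`
(`IsMean.add_bonus_mono`), so the bonus that dominates the deviation of Q* passes to the larger
function W (`bellman_le_optimisticValue`).

The data-dependent term (E - P)(W - Q*): W and Q* are maxima over `a` of functions of the pair `(a,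
v a)`. Hence each level set `{Q* ≤ x < W}` consists of the vectors that hit one subset of `A × S`
and avoid another. There are 4^(SA) pairs of subsets, whatever the data, so a union bound adds a
multiple of `SA` to the logarithm. A relative Chernoff bound for each set, integrated over `x`,
gives E(W - Q*) ≤ (1 + 1/(4H)) P(W - Q*) + error (`empMean_gap_le`).

Recursion: the variances in the bonuses are replaced by that of Q^π, at the price of a further
fraction of P(W - Q^π)/H. The resulting factor 1 + 1/H per step compounds to at most e, so the gap
of an episode is at most a constant times the expected sum of bonuses along the policy's own
trajectory (`gap_le_cumulative`).

Summation: by the inequality of arithmetic and geometric means the bonuses split into variances and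
inverse visit counts. The variances of one episode add up to at most 2H² in expectation
(`cumulative_nextVar_le`). The expected inverse counts are compared with the realized ones by an
exponential supermartingale (`measure_cumulative_sum_ge_le`), and the realized ones form harmonic
sums. Balancing the weights gives H^(3/2) √(SK) L from the transitions and H √(SAK) L from the
rewards, with remainder H³ S² A L², where L is the logarithmic factor. -/

/-- Backward induction over the steps of an episode. -/
theorem backward_induction {H : ℕ} {p : ℕ → Prop} (top : ∀ h, H ≤ h → p h)
    (step : ∀ h, h < H → p (h + 1) → p h) (h : ℕ) : p h := by
  induction hj : H - h generalizing h with
  | zero => exact top h (by omega)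
  | succ j ih => exact step h (by omega) (ih (h + 1) (by omega))

/-! ### Values of policies and the optimality equations. -/

namespace MDP

variable {S A : Type*} [Fintype S] [Fintype A] [DecidableEq A] {H : ℕ}

/-- Expectation of a function of the next-state vector. -/
noncomputable def nextMean (M : MDP S A H) (h : Fin H) (s : S) (f : (A → S) → ℝ) : ℝ :=
  ∑ v, (M.trans h s v).toReal * f v

/-- Variance of a function of the next-state vector. -/
noncomputable def nextVar (M : MDP S A H) (h : Fin H) (s : S) (f : (A → S) → ℝ) : ℝ :=
  M.nextMean h s (fun v => (f v - M.nextMean h s f) ^ 2)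

/-- Mean reward of an action. -/
noncomputable def meanReward (M : MDP S A H) (h : Fin H) (s : S) (a : A) : ℝ :=
  ∫ R, R a ∂(M.reward h s)

/-- Expected sum of `ρ` along a trajectory of `π` from step `h` and state `s`. -/
noncomputable def cumulative (M : MDP S A H) (π : DetPolicy S A H)
    (ρ : Fin H → S → (A → S) → ℝ) (h : ℕ) (s : S) : ℝ :=
  if hh : h < H then
    M.nextMean ⟨h, hh⟩ s (fun v => ρ ⟨h, hh⟩ s v + cumulative M π ρ (h + 1) (v (π ⟨h, hh⟩ s v)))
  else 0
termination_by H - h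

/-- The solution of the optimality equations. -/
noncomputable def bellman [Nonempty A] (M : MDP S A H) (h : ℕ) (s : S) : ℝ :=
  if hh : h < H then
    M.nextMean ⟨h, hh⟩ s (fun v => Finset.univ.sup' Finset.univ_nonempty
      (fun a : A => M.meanReward ⟨h, hh⟩ s a + bellman M (h + 1) (v a)))
  else 0
termination_by H - h

/-- Optimal value of a state once the next states `v` are observed. -/
noncomputable def bellmanLookahead [Nonempty A] (M : MDP S A H) (h : Fin H) (s : S) (v : A → S) :
    ℝ :=
  Finset.univ.sup' Finset.univ_nonempty
      (fun a : A => M.meanReward h s a + M.bellman (h + 1) (v a))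

/-- The mean reward of the action that `π` plays. -/
noncomputable def policyReward (M : MDP S A H) (π : DetPolicy S A H) (h : Fin H) (s : S)
    (v : A → S) : ℝ :=
  M.meanReward h s (π h s v)

/-- Value of a deterministic policy once the next states `v` are observed. -/
noncomputable def policyLookahead (M : MDP S A H) (π : DetPolicy S A H) (h : Fin H) (s : S)
    (v : A → S) : ℝ :=
  M.meanReward h s (π h s v) + M.cumulative π (M.policyReward π) (h + 1) (v (π h s v))

section nextMean

variable (M : MDP S A H) (h : Fin H) (s : S)

theorem sum_toReal_trans : ∑ v, (M.trans h s v).toReal = 1 := by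
  rw [← ENNReal.toReal_sum (fun v _ => PMF.apply_ne_top _ _), ← tsum_fintype (L := .unconditional _),
    PMF.tsum_coe]
  rfl

theorem nextMean_const (c : ℝ) : M.nextMean h s (fun _ => c) = c := by
  rw [nextMean, ← Finset.sum_mul, sum_toReal_trans, one_mul]

theorem nextMean_add (f g : (A → S) → ℝ) :
    M.nextMean h s (fun v => f v + g v) = M.nextMean h s f + M.nextMean h s g := by
  simp only [nextMean, mul_add, Finset.sum_add_distrib]

theorem nextMean_sub (f g : (A → S) → ℝ) :
    M.nextMean h s (fun v => f v - g v) = M.nextMean h s f - M.nextMean h s g := by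
  simp only [nextMean, mul_sub, Finset.sum_sub_distrib]

theorem nextMean_const_mul (c : ℝ) (f : (A → S) → ℝ) :
    M.nextMean h s (fun v => c * f v) = c * M.nextMean h s f := by
  simp only [nextMean, Finset.mul_sum]
  exact Finset.sum_congr rfl fun v _ => by ring

variable {M h s}

theorem nextMean_mono {f g : (A → S) → ℝ} (hfg : ∀ v, f v ≤ g v) :
    M.nextMean h s f ≤ M.nextMean h s g :=
  Finset.sum_le_sum fun v _ => mul_le_mul_of_nonneg_left (hfg v) ENNReal.toReal_nonneg

theorem nextMean_nonneg {f : (A → S) → ℝ} (hf : ∀ v, 0 ≤ f v) : 0 ≤ M.nextMean h s f :=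
  Finset.sum_nonneg fun v _ => mul_nonneg ENNReal.toReal_nonneg (hf v)

theorem nextMean_le {f : (A → S) → ℝ} {c : ℝ} (hf : ∀ v, f v ≤ c) : M.nextMean h s f ≤ c :=
  (nextMean_mono hf).trans_eq (nextMean_const M h s c)

theorem nextVar_nonneg {f : (A → S) → ℝ} : 0 ≤ M.nextVar h s f :=
  nextMean_nonneg fun _ => sq_nonneg _

theorem nextVar_eq (f : (A → S) → ℝ) :
    M.nextVar h s f = M.nextMean h s (fun v => f v ^ 2) - (M.nextMean h s f) ^ 2 := by
  set m := M.nextMean h s f with hm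
  have : (fun v => (f v - M.nextMean h s f) ^ 2) =
      fun v => f v ^ 2 - (2 * m * f v - m ^ 2) := by
    funext v; rw [← hm]; ring
  rw [nextVar, this, nextMean_sub, nextMean_sub, nextMean_const_mul, nextMean_const, ← hm]
  ring

theorem nextVar_le_sq (f : (A → S) → ℝ) (c : ℝ) :
    M.nextVar h s f ≤ M.nextMean h s (fun v => (f v - c) ^ 2) := by
  have : (fun v => (f v - c) ^ 2) = fun v => f v ^ 2 - (2 * c * f v - c ^ 2) := by
    funext v; ring
  rw [nextVar_eq, this, nextMean_sub, nextMean_sub, nextMean_const_mul, nextMean_const]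
  nlinarith [sq_nonneg (M.nextMean h s f - c)]

/-- The variance of `f` is at most its second moment about the mean of `g`; then (x + y)² ≤ 2x² +
2y². It serves to exchange the variance of Q* for that of Q^π. -/
theorem nextVar_add_le (f g : (A → S) → ℝ) :
    M.nextVar h s f ≤ 2 * M.nextVar h s g + 2 * M.nextMean h s (fun v => (f v - g v) ^ 2) := by
  refine (nextVar_le_sq f (M.nextMean h s g)).trans ?_
  rw [nextVar, ← nextMean_const_mul, ← nextMean_const_mul, ← nextMean_add]
  refine nextMean_mono fun v => ?_
  nlinarith [sq_nonneg (f v - g v - (g v - M.nextMean h s g))]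

end nextMean

section reward

variable (M : MDP S A H) (h : Fin H) (s : S) (a : A)

theorem ae_reward_mem : ∀ᵐ R ∂(M.reward h s), R a ∈ Set.Icc (0 : ℝ) 1 :=
  (M.reward_mem h s).mono fun _ hR => hR a

theorem integrable_reward : Integrable (fun R : A → ℝ => R a) (M.reward h s) :=
  have := M.reward_prob h s
  Integrable.of_mem_Icc 0 1 (measurable_pi_apply a).aemeasurable (M.ae_reward_mem h s a)

theorem integrable_map_reward : Integrable id ((M.reward h s).map (fun R => R a)) :=
  (integrable_map_measure aestronglyMeasurable_id (measurable_pi_apply a).aemeasurable).2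
    (M.integrable_reward h s a)

theorem meanReward_nonneg : 0 ≤ M.meanReward h s a :=
  integral_nonneg_of_ae ((M.ae_reward_mem h s a).mono fun _ hR => hR.1)

theorem meanReward_le_one : M.meanReward h s a ≤ 1 := by
  have := M.reward_prob h s
  have := integral_mono_ae (M.integrable_reward h s a) (integrable_const (1 : ℝ))
    ((M.ae_reward_mem h s a).mono fun _ hR => hR.2)
  simpa [meanReward] using this

end reward

section cumulative

variable (M : MDP S A H) (π : DetPolicy S A H)

theorem cumulative_of_lt (ρ : Fin H → S → (A → S) → ℝ) (h : Fin H) (s : S) :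
    M.cumulative π ρ h s =
      M.nextMean h s (fun v => ρ h s v + M.cumulative π ρ (h + 1) (v (π h s v))) := by
  rw [cumulative, dif_pos h.2]

theorem cumulative_of_le (ρ : Fin H → S → (A → S) → ℝ) {h : ℕ} (hh : H ≤ h) (s : S) :
    M.cumulative π ρ h s = 0 := by
  rw [cumulative, dif_neg (by omega)]

variable {M π}

theorem cumulative_mono {ρ ρ' : Fin H → S → (A → S) → ℝ} (hρ : ∀ h s v, ρ h s v ≤ ρ' h s v)
    (h : ℕ) : ∀ s, M.cumulative π ρ h s ≤ M.cumulative π ρ' h s := by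
  induction h using backward_induction (H := H) with
  | top h hh => intro s; rw [cumulative_of_le _ _ _ hh, cumulative_of_le _ _ _ hh]
  | step h hh ih =>
    intro s
    rw [cumulative_of_lt M π ρ ⟨h, hh⟩, cumulative_of_lt M π ρ' ⟨h, hh⟩]
    exact nextMean_mono fun v => add_le_add (hρ _ _ _) (ih _)

theorem cumulative_add (ρ ρ' : Fin H → S → (A → S) → ℝ) (h : ℕ) :
    ∀ s, M.cumulative π (fun h s v => ρ h s v + ρ' h s v) h s =
      M.cumulative π ρ h s + M.cumulative π ρ' h s := by
  induction h using backward_induction (H := H) with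
  | top h hh => intro s; simp only [cumulative_of_le _ _ _ hh, add_zero]
  | step h hh ih =>
    intro s
    rw [cumulative_of_lt M π ρ ⟨h, hh⟩, cumulative_of_lt M π ρ' ⟨h, hh⟩,
      cumulative_of_lt M π _ ⟨h, hh⟩, ← nextMean_add]
    congr 1; funext v; simp only [ih]; ring

theorem cumulative_const_mul (c : ℝ) (ρ : Fin H → S → (A → S) → ℝ) (h : ℕ) :
    ∀ s, M.cumulative π (fun h s v => c * ρ h s v) h s = c * M.cumulative π ρ h s := by
  induction h using backward_induction (H := H) with
  | top h hh => intro s; simp only [cumulative_of_le _ _ _ hh, mul_zero]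
  | step h hh ih =>
    intro s
    rw [cumulative_of_lt M π ρ ⟨h, hh⟩, cumulative_of_lt M π _ ⟨h, hh⟩, ← nextMean_const_mul]
    congr 1; funext v; simp only [ih]; ring

theorem cumulative_nonneg {ρ : Fin H → S → (A → S) → ℝ} (hρ : ∀ h s v, 0 ≤ ρ h s v)
    (h : ℕ) : ∀ s, 0 ≤ M.cumulative π ρ h s := by
  induction h using backward_induction (H := H) with
  | top h hh => intro s; rw [cumulative_of_le _ _ _ hh]
  | step h hh ih =>
    intro s
    rw [cumulative_of_lt M π ρ ⟨h, hh⟩]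
    exact nextMean_nonneg fun v => add_nonneg (hρ _ _ _) (ih _)

theorem cumulative_le {ρ : Fin H → S → (A → S) → ℝ} {c : ℝ} (hρ : ∀ h s v, ρ h s v ≤ c)
    (h : ℕ) : ∀ s, h ≤ H → M.cumulative π ρ h s ≤ c * ((H : ℝ) - h) := by
  induction h using backward_induction (H := H) with
  | top h hh =>
    intro s hh'
    obtain rfl : h = H := le_antisymm hh' hh
    simp [cumulative_of_le _ _ _ hh]
  | step h hh ih =>
    intro s _
    rw [cumulative_of_lt M π ρ ⟨h, hh⟩]
    refine nextMean_le fun v => ?_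
    have := add_le_add (hρ ⟨h, hh⟩ s v) (ih (v (π ⟨h, hh⟩ s v)) hh)
    refine this.trans_eq ?_
    push_cast; ring

end cumulative

section value

variable (M : MDP S A H)

/-- Both properties are carried through one induction: the sum of reward and later return is
integrable on the product space only because both factors are also finite measures. -/
theorem returnLaw_aux (π : Policy S A H) (h : ℕ) :
    ∀ s, IsProbabilityMeasure (M.returnLaw π h s) ∧ Integrable id (M.returnLaw π h s) := by
  induction h using backward_induction (H := H) with
  | top h hh =>
    intro s
    rw [returnLaw, dif_neg (by omega)]
    exact ⟨inferInstance, integrable_dirac (by simp)⟩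
  | step h hh ih =>
    intro s
    have := M.reward_prob ⟨h, hh⟩ s
    have := fun s => (ih s).1
    have : ∀ a, IsProbabilityMeasure ((M.reward ⟨h, hh⟩ s).map (fun R => R a)) := fun a =>
      Measure.isProbabilityMeasure_map (measurable_pi_apply a).aemeasurable
    rw [returnLaw, dif_pos hh]
    constructor
    · constructor
      simp only [Measure.coe_finsetSum, Finset.sum_apply, Measure.smul_apply, measure_univ,
        smul_eq_mul, mul_one]
      have h1 : ∀ v, ∑ a, π ⟨h, hh⟩ s v a = 1 := fun v => by
        rw [← tsum_fintype (L := .unconditional _), PMF.tsum_coe]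
      simp only [h1, mul_one]
      rw [← tsum_fintype (L := .unconditional _), PMF.tsum_coe]
    · refine integrable_finsetSum_measure.2 fun v _ => Integrable.smul_measure ?_ (PMF.apply_ne_top _ _)
      refine integrable_finsetSum_measure.2 fun a _ => Integrable.smul_measure ?_ (PMF.apply_ne_top _ _)
      rw [Measure.conv, integrable_map_measure (by fun_prop) (by fun_prop)]
      refine Integrable.add (Integrable.comp_fst (f := id) ?_ _) (Integrable.comp_snd (f := id) (ih _).2 _)
      exact M.integrable_map_reward _ _ _

theorem value_of_le (π : Policy S A H) {h : ℕ} (hh : H ≤ h) (s : S) : M.value π h s = 0 := by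
  rw [value, returnLaw, dif_neg (by omega)]
  simp

theorem value_of_lt (π : Policy S A H) (h : Fin H) (s : S) :
    M.value π h s = M.nextMean h s (fun v => ∑ a, (π h s v a).toReal *
      (M.meanReward h s a + M.value π (h + 1) (v a))) := by
  have := M.reward_prob h s
  have := fun s => (M.returnLaw_aux π (h + 1) s).1
  have hint := fun s => (M.returnLaw_aux π (h + 1) s).2
  have : ∀ a, IsProbabilityMeasure ((M.reward h s).map (fun R => R a)) := fun a =>
      Measure.isProbabilityMeasure_map (measurable_pi_apply a).aemeasurable
  have hr : ∀ a, Integrable id ((M.reward h s).map (fun R => R a)) := fun a =>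
    M.integrable_map_reward _ _ _
  have hc : ∀ a s', Integrable id
      (Measure.conv ((M.reward h s).map (fun R => R a)) (M.returnLaw π (h + 1) s')) := by
    intro a s'
    rw [Measure.conv, integrable_map_measure (by fun_prop) (by fun_prop)]
    exact Integrable.add (Integrable.comp_fst (f := id) (hr a) _)
      (Integrable.comp_snd (f := id) (hint _) _)
  rw [value, returnLaw, dif_pos h.2, integral_finsetSum_measure, nextMean]
  · refine Finset.sum_congr rfl fun v _ => ?_
    rw [integral_smul_measure, integral_finsetSum_measure, smul_eq_mul]
    · congr 1
      refine Finset.sum_congr rfl fun a _ => ?_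
      rw [integral_smul_measure, smul_eq_mul, Measure.conv, integral_map (by fun_prop) (by fun_prop),
        integral_add (f := fun x : ℝ × ℝ => x.1) (g := fun x : ℝ × ℝ => x.2)
          (Integrable.comp_fst (f := id) (hr a) _)
          (Integrable.comp_snd (f := id) (hint _) _), integral_fun_fst (f := fun x => x), integral_fun_snd (f := fun x => x)]
      rw [integral_map (measurable_pi_apply a).aemeasurable (by fun_prop)]
      simp [meanReward, value]
    · exact fun a _ => (hc _ _).smul_measure (PMF.apply_ne_top _ _)
  · exact fun v _ => Integrable.smul_measure (integrable_finsetSum_measure.2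
      fun a _ => (hc _ _).smul_measure (PMF.apply_ne_top _ _)) (PMF.apply_ne_top _ _)

/-- After this identity the law of the return plays no role for the learner's policies; everything
rests on the finite recursion of `cumulative`. -/
theorem value_toPolicy (π : DetPolicy S A H) (h : ℕ) :
    ∀ s, M.value π.toPolicy h s = M.cumulative π (M.policyReward π) h s := by
  induction h using backward_induction (H := H) with
  | top h hh => intro s; rw [value_of_le _ _ hh, cumulative_of_le _ _ _ hh]
  | step h hh ih =>
    intro s
    rw [value_of_lt M _ ⟨h, hh⟩, cumulative_of_lt M π _ ⟨h, hh⟩]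
    congr 1; funext v
    rw [Finset.sum_eq_single (π ⟨h, hh⟩ s v)]
    · simp [DetPolicy.toPolicy, ih, policyReward]
    · intro a _ ha; simp [DetPolicy.toPolicy, ha]
    · simp

theorem cumulative_eq_nextMean (π : DetPolicy S A H) (h : Fin H) (s : S) :
    M.cumulative π (M.policyReward π) h s = M.nextMean h s (M.policyLookahead π h s) := by
  rw [cumulative_of_lt]; rfl

theorem policyLookahead_nonneg (π : DetPolicy S A H) (h : Fin H) (s : S) (v : A → S) :
    0 ≤ M.policyLookahead π h s v :=
  add_nonneg (M.meanReward_nonneg _ _ _)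
    (cumulative_nonneg (fun _ _ _ => M.meanReward_nonneg _ _ _) _ _)

/-- Law of total variance for the values of a policy. -/
theorem cumulative_nextVar_le (π : DetPolicy S A H) (s : S) :
    M.cumulative π (fun h s _ => M.nextVar h s (M.policyLookahead π h s)) 0 s ≤
      2 * (H : ℝ) ^ 2 := by
  -- The square of the value is kept on the left because the variance is a second moment minus
  -- exactly this square, so that the squares telescope. The inductive step uses r² ≤ r and 2rV ≤
  -- 2r(H - h - 1) for the reward r and the next value V.
  have key : ∀ h, ∀ s, h ≤ H →
      M.cumulative π (fun h s _ => M.nextVar h s (M.policyLookahead π h s)) h s +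
        M.cumulative π (M.policyReward π) h s ^ 2 ≤
      2 * ((H : ℝ) - h) * M.cumulative π (M.policyReward π) h s := by
    intro h
    induction h using backward_induction (H := H) with
    | top h hh => intro s _; simp [cumulative_of_le _ _ _ hh]
    | step h hh ih =>
      intro s _
      rw [cumulative_of_lt M π (fun h s _ => M.nextVar h s (M.policyLookahead π h s)) ⟨h, hh⟩,
        cumulative_eq_nextMean M π ⟨h, hh⟩, nextMean_add, nextMean_const, nextVar_eq]
      rw [← nextMean_const_mul]
      have : M.nextMean ⟨h, hh⟩ s (fun v => M.policyLookahead π ⟨h, hh⟩ s v ^ 2) +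
          M.nextMean ⟨h, hh⟩ s (fun v => M.cumulative π
            (fun h s _ => M.nextVar h s (M.policyLookahead π h s)) (h + 1) (v (π ⟨h, hh⟩ s v))) ≤
          M.nextMean ⟨h, hh⟩ s
            (fun v => 2 * ((H : ℝ) - h) * M.policyLookahead π ⟨h, hh⟩ s v) := by
        rw [← nextMean_add]
        refine nextMean_mono fun v => ?_
        have h1 := ih (v (π ⟨h, hh⟩ s v)) hh
        have h2 := M.meanReward_nonneg ⟨h, hh⟩ s (π ⟨h, hh⟩ s v)
        have h3 := M.meanReward_le_one ⟨h, hh⟩ s (π ⟨h, hh⟩ s v)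
        have h4 := cumulative_le (M := M) (π := π) (ρ := M.policyReward π) (c := 1)
          (fun h s v => M.meanReward_le_one _ _ _) (h + 1) (v (π ⟨h, hh⟩ s v)) hh
        have h5 := cumulative_nonneg (M := M) (π := π) (ρ := M.policyReward π)
          (fun h s v => M.meanReward_nonneg _ _ _) (h + 1) (v (π ⟨h, hh⟩ s v))
        simp only [policyLookahead]
        set r := M.meanReward ⟨h, hh⟩ s (π ⟨h, hh⟩ s v)
        set V := M.cumulative π (M.policyReward π) (h + 1) (v (π ⟨h, hh⟩ s v))
        push_cast at h1 h4 ⊢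
        have h6 : (h : ℝ) + 1 ≤ H := by exact_mod_cast hh
        nlinarith [mul_nonneg h2 h5, mul_nonneg h2 (sub_nonneg.2 h3),
          mul_nonneg h2 (sub_nonneg.2 h4)]
      simp only [nextMean_const_mul] at this ⊢
      linarith
  have h1 := key 0 s (Nat.zero_le _)
  have h4 := cumulative_le (M := M) (π := π) (ρ := M.policyReward π) (c := 1)
          (fun h s v => M.meanReward_le_one _ _ _) 0 s (Nat.zero_le _)
  simp only [Nat.cast_zero, sub_zero, one_mul] at h1 h4
  nlinarith [sq_nonneg (M.cumulative π (M.policyReward π) 0 s), Nat.cast_nonneg (α := ℝ) H]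

variable [Nonempty A]

theorem bellman_of_lt (h : Fin H) (s : S) :
    M.bellman h s = M.nextMean h s (M.bellmanLookahead h s) := by
  rw [bellman, dif_pos h.2]; rfl

theorem bellman_of_le {h : ℕ} (hh : H ≤ h) (s : S) : M.bellman h s = 0 := by
  rw [bellman, dif_neg (by omega)]

theorem le_bellmanLookahead (h : Fin H) (s : S) (v : A → S) (a : A) :
    M.meanReward h s a + M.bellman (h + 1) (v a) ≤ M.bellmanLookahead h s v :=
  Finset.le_sup' (fun a => M.meanReward h s a + M.bellman (h + 1) (v a)) (Finset.mem_univ a)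

theorem value_le_bellman (π : Policy S A H) (h : ℕ) : ∀ s, M.value π h s ≤ M.bellman h s := by
  induction h using backward_induction (H := H) with
  | top h hh => intro s; rw [value_of_le _ _ hh, bellman_of_le _ hh]
  | step h hh ih =>
    intro s
    rw [value_of_lt M _ ⟨h, hh⟩, bellman_of_lt M ⟨h, hh⟩]
    refine nextMean_mono fun v => ?_
    have h1 : ∑ a, (π ⟨h, hh⟩ s v a).toReal = 1 := by
      rw [← ENNReal.toReal_sum (fun v _ => PMF.apply_ne_top _ _),
        ← tsum_fintype (L := .unconditional _), PMF.tsum_coe]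
      rfl
    calc _ ≤ ∑ a, (π ⟨h, hh⟩ s v a).toReal * M.bellmanLookahead ⟨h, hh⟩ s v :=
          Finset.sum_le_sum fun a _ => mul_le_mul_of_nonneg_left
            ((add_le_add le_rfl (ih _)).trans (M.le_bellmanLookahead ⟨h, hh⟩ s v a))
            ENNReal.toReal_nonneg
      _ = _ := by rw [← Finset.sum_mul, h1, one_mul]

/-- This direction suffices for an upper bound on the regret; that the optimality equations are
attained by a policy is never needed. -/
theorem optimalValue_le_bellman (h : ℕ) (s : S) : M.optimalValue h s ≤ M.bellman h s :=
  have : Nonempty (Policy S A H) := ⟨fun _ _ _ => PMF.pure (Classical.arbitrary A)⟩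
  ciSup_le fun π => M.value_le_bellman π h s

theorem bellman_mem (h : ℕ) : ∀ s, 0 ≤ M.bellman h s ∧ M.bellman h s ≤ ((H - h : ℕ) : ℝ) := by
  induction h using backward_induction (H := H) with
  | top h hh => intro s; rw [bellman_of_le _ hh]; simp
  | step h hh ih =>
    intro s
    rw [bellman_of_lt M ⟨h, hh⟩]
    constructor
    · refine nextMean_nonneg fun v => ?_
      exact (add_nonneg (M.meanReward_nonneg _ _ (Classical.arbitrary A)) (ih _).1).trans
        (M.le_bellmanLookahead ⟨h, hh⟩ s v (Classical.arbitrary A))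
    · refine nextMean_le fun v => Finset.sup'_le _ _ fun a _ => ?_
      have h1 := M.meanReward_le_one ⟨h, hh⟩ s a
      have h2 := (ih (v a)).2
      have h3 : ((H - h : ℕ) : ℝ) = ((H - (h + 1) : ℕ) : ℝ) + 1 := by
        rw [← Nat.cast_succ]; congr 1; omega
      dsimp only
      linarith

theorem bellman_nonneg (h : ℕ) (s : S) : 0 ≤ M.bellman h s := (M.bellman_mem h s).1

theorem bellman_le (h : ℕ) (s : S) : M.bellman h s ≤ H :=
  (M.bellman_mem h s).2.trans (by exact_mod_cast Nat.sub_le _ _)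

theorem bellmanLookahead_nonneg (h : Fin H) (s : S) (v : A → S) : 0 ≤ M.bellmanLookahead h s v :=
  (add_nonneg (M.meanReward_nonneg _ _ (Classical.arbitrary A)) (M.bellman_nonneg _ _)).trans
        (M.le_bellmanLookahead h s v (Classical.arbitrary A))

theorem bellmanLookahead_le (h : Fin H) (s : S) (v : A → S) : M.bellmanLookahead h s v ≤ H := by
  refine Finset.sup'_le _ _ fun a _ => ?_
  have h1 := M.meanReward_le_one h s a
  have h2 := (M.bellman_mem (h + 1) (v a)).2
  have h3 : (H : ℝ) ≥ ((H - (h + 1) : ℕ) : ℝ) + 1 := by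
    rw [← Nat.cast_succ]; exact_mod_cast (by omega : (H - (h + 1)).succ ≤ H)
  linarith

theorem cumulative_policyReward_le_bellman (π : DetPolicy S A H) (h : ℕ) (s : S) :
    M.cumulative π (M.policyReward π) h s ≤ M.bellman h s := by
  rw [← value_toPolicy]; exact M.value_le_bellman _ _ _

theorem policyLookahead_le_bellmanLookahead (π : DetPolicy S A H) (h : Fin H) (s : S) (v : A → S) :
    M.policyLookahead π h s v ≤ M.bellmanLookahead h s v :=
  (add_le_add le_rfl (M.cumulative_policyReward_le_bellman π _ _)).trans
    (M.le_bellmanLookahead h s v _)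

end value

end MDP

/-! ### Variance calculus common to the true and the empirical means. -/

/-- A normalized positive linear functional on real functions. -/
structure IsMean {α : Type*} (E : (α → ℝ) → ℝ) : Prop where
  add : ∀ f g, E (fun x => f x + g x) = E f + E g
  const_mul : ∀ (c : ℝ) f, E (fun x => c * f x) = c * E f
  const : ∀ c : ℝ, E (fun _ => c) = c
  mono : ∀ f g : α → ℝ, (∀ x, f x ≤ g x) → E f ≤ E g

namespace IsMean

variable {α : Type*} {E : (α → ℝ) → ℝ} (hE : IsMean E)
include hE

theorem sub (f g : α → ℝ) : E (fun x => f x - g x) = E f - E g := by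
  have h := hE.add f (fun x => (-1) * g x)
  rw [hE.const_mul] at h
  rw [show (fun x => f x - g x) = fun x => f x + (-1) * g x by funext x; ring, h]
  ring

theorem nonneg {f : α → ℝ} (hf : ∀ x, 0 ≤ f x) : 0 ≤ E f := by
  simpa [hE.const] using hE.mono (fun _ => 0) f hf

theorem le_const {f : α → ℝ} {c : ℝ} (hf : ∀ x, f x ≤ c) : E f ≤ c := by
  simpa [hE.const] using hE.mono f (fun _ => c) hf

theorem mul_sub_const (f g : α → ℝ) (b c : ℝ) :
    E (fun x => (f x - b) * (g x - c)) = E (fun x => f x * g x) - c * E f - b * E g + b * c := by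
  have : (fun x => (f x - b) * (g x - c)) =
      fun x => f x * g x - (c * f x + (b * g x - b * c)) := by
    funext x; ring
  rw [this, hE.sub, hE.add, hE.sub, hE.const_mul, hE.const_mul, hE.const]
  ring

theorem sq_sub_const (f : α → ℝ) (c : ℝ) :
    E (fun x => (f x - c) ^ 2) = E (fun x => f x ^ 2) - E f ^ 2 + (E f - c) ^ 2 := by
  simp only [sq (_ - c), hE.mul_sub_const, sq (f _)]
  ring

theorem variance_nonneg (f : α → ℝ) : 0 ≤ E (fun x => f x ^ 2) - E f ^ 2 := by
  have h := hE.sq_sub_const f (E f)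
  rw [sub_self, zero_pow two_ne_zero, add_zero] at h
  exact h ▸ hE.nonneg fun x => sq_nonneg _

theorem variance_add_le (f g : α → ℝ) :
    E (fun x => f x ^ 2) - E f ^ 2 ≤
      2 * (E (fun x => g x ^ 2) - E g ^ 2) + 2 * E (fun x => (f x - g x) ^ 2) := by
  have h1 := hE.sq_sub_const f (E g)
  have h2 := hE.sq_sub_const g (E g)
  have h3 : E (fun x => (f x - E g) ^ 2) ≤
      E (fun x => 2 * (g x - E g) ^ 2 + 2 * (f x - g x) ^ 2) :=
    hE.mono _ _ fun x => by nlinarith [sq_nonneg (f x - g x - (g x - E g))]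
  rw [hE.add, hE.const_mul, hE.const_mul] at h3
  nlinarith [sq_nonneg (E f - E g)]

/-- The variance of `f + c g` is a nonnegative quadratic polynomial in `c`, so its discriminant is
nonpositive. -/
theorem covariance_sq_le (f g : α → ℝ) :
    (E (fun x => f x * g x) - E f * E g) ^ 2 ≤
      (E (fun x => f x ^ 2) - E f ^ 2) * (E (fun x => g x ^ 2) - E g ^ 2) := by
  have key : ∀ x : ℝ, 0 ≤ (E (fun x => g x ^ 2) - E g ^ 2) * (x * x) +
      2 * (E (fun x => f x * g x) - E f * E g) * x + (E (fun x => f x ^ 2) - E f ^ 2) := by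
    intro c
    have h := hE.variance_nonneg (fun x => f x + c * g x)
    have h2 : (fun x => (f x + c * g x) ^ 2) =
        fun x => f x ^ 2 + (2 * c * (f x * g x) + c ^ 2 * g x ^ 2) := by
      funext x; ring
    rw [h2, hE.add, hE.add, hE.add, hE.const_mul, hE.const_mul, hE.const_mul] at h
    nlinarith
  have := discrim_le_zero key
  rw [discrim] at this
  nlinarith

/-- Monotonicity of the mean augmented by a variance-based bonus. -/
theorem add_bonus_mono {f g : α → ℝ} {B t : ℝ} (hB : 0 ≤ B) (ht : 0 ≤ t) (hf : ∀ x, 0 ≤ f x)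
    (hfg : ∀ x, f x ≤ g x) (hfB : ∀ x, f x ≤ B) :
    E f + max (√(t * (E (fun x => f x ^ 2) - E f ^ 2))) (t * B) ≤
      E g + max (√(t * (E (fun x => g x ^ 2) - E g ^ 2))) (t * B) := by
  have hEfg := hE.mono f g hfg
  rcases le_or_gt (√(t * (E (fun x => f x ^ 2) - E f ^ 2))) (t * B) with h | h
  · rw [max_eq_right h]
    exact add_le_add hEfg (le_max_right _ _)
  rw [max_eq_left h.le]
  refine le_trans ?_ (add_le_add le_rfl (le_max_left _ _))
  have hvf := hE.variance_nonneg f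
  have hvg := hE.variance_nonneg g
  have hcs := hE.covariance_sq_le f g
  set a := E (fun x => f x ^ 2) - E f ^ 2 with ha
  set b := E (fun x => g x ^ 2) - E g ^ 2
  rw [Real.sqrt_mul ht, Real.sqrt_mul ht] at *
  have hcov : E (fun x => f x * g x) - E f * E g ≤ √a * √b := by
    rw [← Real.sqrt_mul hvf]; exact Real.le_sqrt_of_sq_le hcs
  -- the deviation of `f` from its mean is at least `-B`
  have hdev : -B * (E g - E f) ≤ E (fun x => f x * g x) - E f * E g - a := by
    have h1 : E (fun x => -B * (g x - f x)) ≤ E (fun x => (f x - E f) * (g x - f x - 0)) := by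
      refine hE.mono _ _ fun x => ?_
      have h2 := hE.le_const hfB
      rw [sub_zero]
      exact mul_le_mul_of_nonneg_right (by linarith [hf x]) (sub_nonneg.2 (hfg x))
    have h2 : (fun x => f x * (g x - f x)) = fun x => f x * g x - f x ^ 2 := by
      funext x; ring
    rw [hE.const_mul, hE.sub, hE.mul_sub_const, hE.sub, h2, hE.sub] at h1
    rw [ha]; nlinarith
  have hsa : √a * √a = a := Real.mul_self_sqrt hvf
  have hst : √t * √t = t := Real.mul_self_sqrt ht
  have h0t := Real.sqrt_nonneg t
  have h0a := Real.sqrt_nonneg a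
  rcases h0t.eq_or_lt with h0 | h0
  · rw [← h0]; linarith
  have h3 : √t * B ≤ √a := by
    have h' : √t * (√t * B) < √t * √a := by rwa [← mul_assoc, hst]
    exact (lt_of_mul_lt_mul_left h' h0t).le
  have ha0 : 0 < √a := lt_of_le_of_ne h0a fun h4 => by
    rw [← h4, mul_zero] at h
    exact absurd h (not_lt.2 (mul_nonneg ht hB))
  -- Cauchy-Schwarz for the covariance meets the lower bound for Cov(f, g - f): the loss in standard
  -- deviation, times √a, is at most B times the gain in mean. As √t B ≤ √a in the present case, √a
  -- cancels after multiplication by √t.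
  have h5 : √a * (√a - √b) ≤ B * (E g - E f) := by nlinarith
  have h6 : √a * (√t * (√a - √b)) ≤ √a * (E g - E f) := by
    calc _ = √t * (√a * (√a - √b)) := by ring
      _ ≤ √t * (B * (E g - E f)) := mul_le_mul_of_nonneg_left h5 h0t
      _ = √t * B * (E g - E f) := by ring
      _ ≤ _ := mul_le_mul_of_nonneg_right h3 (sub_nonneg.2 hEfg)
  have h7 := le_of_mul_le_mul_left h6 ha0
  nlinarith

end IsMean

/-! ### Integration over level sets, and sums of inverse visit counts. -/

/-- A relative bound for all the level sets `{u ≤ t < w}` gives one for `w - u`. -/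
theorem sum_mul_sub_le_of_level_sets {ι κ : Type*} (s : Finset ι) (t : Finset κ) (p u w : ι → ℝ)
    (q u' w' : κ → ℝ) {a b B : ℝ} (hB : 0 ≤ B) (hu : ∀ i, 0 ≤ u i) (huw : ∀ i, u i ≤ w i)
    (hw : ∀ i, w i ≤ B) (hu' : ∀ i, 0 ≤ u' i) (huw' : ∀ i, u' i ≤ w' i) (hw' : ∀ i, w' i ≤ B)
    (h : ∀ x : ℝ, ∑ i ∈ s, p i * (if u i ≤ x ∧ x < w i then 1 else 0) ≤
      a * ∑ i ∈ t, q i * (if u' i ≤ x ∧ x < w' i then 1 else 0) + b) :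
    ∑ i ∈ s, p i * (w i - u i) ≤ a * ∑ i ∈ t, q i * (w' i - u' i) + b * B := by
  -- Layer-cake formula: `w - u` is the integral over `x` in `[0, B]` of the indicator of `u ≤ x <
  -- w`. The additive error `b` is integrated over the same interval and becomes `b * B`.
  have hvol : ∀ c d : ℝ, 0 ≤ c → c ≤ d → d ≤ B →
      ∫ x in Set.Icc 0 B, (if c ≤ x ∧ x < d then (1 : ℝ) else 0) = d - c := by
    intro c d hc hcd hd
    have h1 : (fun x => if c ≤ x ∧ x < d then (1 : ℝ) else 0) =
        (Set.Ico c d).indicator (fun _ => 1) := by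
      funext x; simp [Set.indicator, Set.mem_Ico]
    rw [h1, setIntegral_indicator measurableSet_Ico, Set.inter_eq_right.2, setIntegral_const]
    · simp [Measure.real, ENNReal.toReal_ofReal (sub_nonneg.2 hcd)]
    · exact fun x hx => ⟨hc.trans hx.1, hx.2.le.trans hd⟩
  have hint : ∀ c d : ℝ, Integrable (fun x => if c ≤ x ∧ x < d then (1 : ℝ) else 0)
      (volume.restrict (Set.Icc 0 B)) := by
    intro c d
    have h1 : (fun x => if c ≤ x ∧ x < d then (1 : ℝ) else 0) =
        (Set.Ico c d).indicator (fun _ => 1) := by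
      funext x; simp [Set.indicator, Set.mem_Ico]
    rw [h1]
    exact (integrable_const _).indicator measurableSet_Ico
  have e1 : ∑ i ∈ s, p i * (w i - u i) = ∫ x in Set.Icc 0 B,
      ∑ i ∈ s, p i * (if u i ≤ x ∧ x < w i then (1 : ℝ) else 0) := by
    rw [integral_finsetSum _ fun i _ => (hint _ _).const_mul _]
    exact Finset.sum_congr rfl fun i _ => by
      rw [integral_const_mul, hvol _ _ (hu i) (huw i) (hw i)]
  have e2 : ∑ i ∈ t, q i * (w' i - u' i) = ∫ x in Set.Icc 0 B,
      ∑ i ∈ t, q i * (if u' i ≤ x ∧ x < w' i then (1 : ℝ) else 0) := by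
    rw [integral_finsetSum _ fun i _ => (hint _ _).const_mul _]
    exact Finset.sum_congr rfl fun i _ => by
      rw [integral_const_mul, hvol _ _ (hu' i) (huw' i) (hw' i)]
  have i1 := integrable_finsetSum s (μ := volume.restrict (Set.Icc 0 B))
    fun i _ => (hint (u i) (w i)).const_mul (p i)
  have i2 := integrable_finsetSum t (μ := volume.restrict (Set.Icc 0 B))
    fun i _ => (hint (u' i) (w' i)).const_mul (q i)
  rw [e1, e2]
  refine (integral_mono i1 ((i2.const_mul a).add (integrable_const b)) h).trans_eq ?_
  simp only [Pi.add_apply]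
  rw [integral_add (i2.const_mul a) (integrable_const b), integral_const_mul, setIntegral_const]
  simp [Measure.real, hB, mul_comm]

/-- The term `i = 0` equals 1 because of the maximum; the others form a harmonic sum, at most 1 +
log K. -/
theorem sum_range_inv_max_le_log {n K : ℕ} (hn : n ≤ K) (hK : 1 ≤ K) :
    ∑ i ∈ Finset.range n, (1 : ℝ) / max (i : ℝ) 1 ≤ 2 + Real.log K := by
  have hlog : 0 ≤ Real.log K := Real.log_nonneg (by exact_mod_cast hK)
  rcases n with _ | m
  · simp; linarith
  rw [Finset.sum_range_succ']
  have h1 : ∑ i ∈ Finset.range m, (1 : ℝ) / max ((i + 1 : ℕ) : ℝ) 1 = ((harmonic m : ℚ) : ℝ) := by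
    rw [harmonic]; push_cast
    refine Finset.sum_congr rfl fun i _ => ?_
    rw [max_eq_left (by linarith [Nat.cast_nonneg (α := ℝ) i]), one_div]
  have h2 := harmonic_le_one_add_log m
  have h3 : Real.log m ≤ Real.log K := by
    rcases m with _ | m
    · simpa using hlog
    · exact Real.log_le_log (by positivity) (by exact_mod_cast (by omega))
  rw [h1]
  simp
  linarith

/-- Sum of the inverse numbers of earlier visits. -/
theorem sum_inv_visits_le {ι : Type*} [Fintype ι] [DecidableEq ι] (x : ℕ → ι) {K : ℕ}
    (hK : 1 ≤ K) :
    ∑ k ∈ Finset.range K,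
        (1 : ℝ) / max (((Finset.range k).filter (fun j => x j = x k)).card : ℝ) 1 ≤
      Fintype.card ι * (2 + Real.log K) := by
  -- Grouping the times by the value visited: successive visits of `i` see the counts 0, 1, 2, ….
  have key : ∀ n, ∑ k ∈ Finset.range n,
      (1 : ℝ) / max (((Finset.range k).filter (fun j => x j = x k)).card : ℝ) 1 =
      ∑ i : ι, ∑ m ∈ Finset.range ((Finset.range n).filter (fun j => x j = i)).card,
        (1 : ℝ) / max (m : ℝ) 1 := by
    intro n
    induction n with
    | zero => simp
    | succ n ih =>
      rw [Finset.sum_range_succ, ih]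
      have : ∀ i, ∑ m ∈ Finset.range ((Finset.range (n + 1)).filter (fun j => x j = i)).card,
            (1 : ℝ) / max (m : ℝ) 1 =
          ∑ m ∈ Finset.range ((Finset.range n).filter (fun j => x j = i)).card,
            (1 : ℝ) / max (m : ℝ) 1 + if x n = i then
              (1 : ℝ) / max (((Finset.range n).filter (fun j => x j = i)).card : ℝ) 1 else 0 := by
        intro i
        rw [Finset.range_add_one, Finset.filter_insert]
        split_ifs with h
        · rw [Finset.card_insert_of_notMem (by simp), Finset.sum_range_succ]
        · simp
      simp only [this, Finset.sum_add_distrib, Finset.sum_ite_eq, Finset.mem_univ, if_true]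
  rw [key, ← nsmul_eq_mul, ← Finset.card_univ, ← Finset.sum_const]
  refine Finset.sum_le_sum fun i _ => sum_range_inv_max_le_log ?_ hK
  exact (Finset.card_filter_le _ _).trans (by simp)

/-! ### Exponential moments of bounded functions. -/

theorem exp_neg_le_one_sub_half {x : ℝ} (h0 : 0 ≤ x) (h1 : x ≤ 1) :
    Real.exp (-x) ≤ 1 - x / 2 := by
  have h2 : Real.exp (-x) * Real.exp x = 1 := by rw [← Real.exp_add]; simp
  have h3 := Real.add_one_le_exp x
  have h4 := Real.exp_pos (-x)
  nlinarith

/-- One step of the comparison of expected and realized sums: `y` is the present term, `g` the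
expected remainder. The cross term of (1 - y/2)(1 - g/4) is absorbed because half of `y` is given
away. -/
theorem exp_neg_mul_one_sub_le {y g : ℝ} (hy0 : 0 ≤ y) (hy1 : y ≤ 1) (hg1 : g ≤ 1) :
    Real.exp (-y) * (1 - g / 4) ≤ 1 - (y + g) / 4 := by
  have := mul_le_mul_of_nonneg_right (exp_neg_le_one_sub_half hy0 hy1)
    (by linarith : 0 ≤ 1 - g / 4)
  nlinarith

theorem exp_le_one_add_add_sq {x : ℝ} (hx : |x| ≤ 1) : Real.exp x ≤ 1 + x + x ^ 2 := by
  have := (abs_le.1 (Real.abs_exp_sub_one_sub_id_le hx)).2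
  linarith

namespace IsMean

variable {α : Type*} {E : (α → ℝ) → ℝ} (hE : IsMean E)
include hE

theorem exp_sub_le_one {φ : α → ℝ} {c : ℝ} (h : E (fun x => Real.exp (φ x)) ≤ 1 + c) :
    E (fun x => Real.exp (φ x - c)) ≤ 1 := by
  have h1 : (fun x => Real.exp (φ x - c)) = fun x => Real.exp (-c) * Real.exp (φ x) := by
    funext x; rw [← Real.exp_add]; ring_nf
  rw [h1, hE.const_mul]
  calc _ ≤ Real.exp (-c) * Real.exp c := by
        refine mul_le_mul_of_nonneg_left (h.trans ?_) (Real.exp_pos _).le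
        rw [add_comm]; exact Real.add_one_le_exp c
    _ = 1 := by rw [← Real.exp_add]; simp

/-- From e^x ≤ 1 + x + x² for |x| ≤ 1: the linear term has mean zero, the quadratic one is the
variance, which the compensator removes. -/
theorem exp_bernstein {f : α → ℝ} (hf0 : ∀ x, 0 ≤ f x) (hf1 : ∀ x, f x ≤ 1) {l : ℝ}
    (hl : |l| ≤ 1) :
    E (fun x => Real.exp (l * (f x - E f) - l ^ 2 * (E (fun x => (f x - E f) ^ 2)))) ≤ 1 := by
  refine hE.exp_sub_le_one (φ := fun x => l * (f x - E f)) ?_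
  have h1 : ∀ x, |f x - E f| ≤ 1 := fun x => by
    have := hE.nonneg hf0
    have := hE.le_const hf1
    rw [abs_le]; constructor <;> linarith [hf0 x, hf1 x]
  refine (hE.mono _ (fun x => 1 + (l * (f x - E f) + l ^ 2 * (f x - E f) ^ 2))
    fun x => ?_).trans_eq ?_
  · have := exp_le_one_add_add_sq (x := l * (f x - E f))
      (by rw [abs_mul]; exact mul_le_one₀ hl (abs_nonneg _) (h1 x))
    linarith [mul_pow l (f x - E f) 2]
  · rw [hE.add, hE.add, hE.const_mul, hE.const_mul, hE.sub, hE.const, hE.const]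
    ring

/-- Since `f` takes values in `[0, 1]`, f² ≤ f, and the second-order term is bounded by the mean
itself. A small `l` thus gives a deviation bound relative to the mean with a factor `1 + l` close to
one. -/
theorem exp_relative_upper {f : α → ℝ} (hf0 : ∀ x, 0 ≤ f x) (hf1 : ∀ x, f x ≤ 1) {l : ℝ}
    (hl0 : 0 ≤ l) (hl1 : l ≤ 1) :
    E (fun x => Real.exp (l * f x - (l + l ^ 2) * E f)) ≤ 1 := by
  refine hE.exp_sub_le_one (φ := fun x => l * f x) ?_
  refine (hE.mono _ (fun x => 1 + (l + l ^ 2) * f x) fun x => ?_).trans_eq ?_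
  · have := exp_le_one_add_add_sq (x := l * f x)
      (by rw [abs_of_nonneg (mul_nonneg hl0 (hf0 x))]; exact mul_le_one₀ hl1 (hf0 x) (hf1 x))
    nlinarith [mul_nonneg (sq_nonneg l) (mul_nonneg (hf0 x) (sub_nonneg.2 (hf1 x)))]
  · rw [hE.add, hE.const_mul, hE.const]

/-- Here e^(-x) ≤ 1 - x/2 on `[0, 1]` replaces the quadratic expansion; the factor 2 that it costs
is harmless for variances. -/
theorem exp_relative_lower {f : α → ℝ} (hf0 : ∀ x, 0 ≤ f x) (hf1 : ∀ x, f x ≤ 1) :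
    E (fun x => Real.exp (E f / 2 - f x)) ≤ 1 := by
  have h := hE.exp_sub_le_one (φ := fun x => -f x) (c := -(E f / 2)) ?_
  · refine le_of_eq_of_le (congrArg E (funext fun x => ?_)) h
    ring_nf
  refine (hE.mono _ (fun x => 1 + (-(1 / 2)) * f x) fun x => ?_).trans_eq ?_
  · have := exp_neg_le_one_sub_half (hf0 x) (hf1 x)
    linarith
  · rw [hE.add, hE.const_mul, hE.const]; ring

end IsMean

theorem MDP.isMean_nextMean {S A : Type*} [Fintype S] [Fintype A] [DecidableEq A] {H : ℕ}
    (M : MDP S A H) (h : Fin H) (s : S) : IsMean (M.nextMean h s) where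
  add := M.nextMean_add h s
  const_mul := M.nextMean_const_mul h s
  const := M.nextMean_const h s
  mono _ _ := MDP.nextMean_mono

theorem Data.isMean_empMean {S A : Type*} [Fintype S] [DecidableEq S] [Fintype A] [DecidableEq A]
    {H : ℕ} (D : Data S A H) {k : ℕ} {h : Fin H} {s : S} (hn : D.count k h s ≠ 0) :
    IsMean (D.empMean k h s) where
  add f g := by simp only [empMean, Finset.sum_add_distrib, add_div]
  const_mul c f := by simp only [empMean, ← Finset.mul_sum, mul_div_assoc]
  const c := by
    simp only [empMean, Finset.sum_const, nsmul_eq_mul]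
    rw [← count, mul_div_assoc, mul_div_cancel₀]
    exact_mod_cast hn
  mono f g hfg := by
    unfold empMean
    gcongr with j _
    exact hfg _

/-! ### Integration of one step of the interaction, given the past. -/

open scoped ENNReal

/-- A random state, action or next-state vector may be substituted into a family of measurable
functions because it takes countably many values; no joint measurability is required. -/
theorem measurable_comp_index {Ω ι γ : Type*} [Countable ι] {m : MeasurableSpace Ω}
    [MeasurableSpace γ] {idx : Ω → ι} (hidx : Measurable[m, ⊤] idx) {G : ι → Ω → γ}
    (hG : ∀ i, Measurable[m] (G i)) : Measurable[m] (fun ω => G (idx ω) ω) := by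
  intro t ht
  have : (fun ω => G (idx ω) ω) ⁻¹' t = ⋃ i, idx ⁻¹' {i} ∩ G i ⁻¹' t := by
    ext ω; simp
  rw [this]
  exact MeasurableSet.iUnion fun i => (hidx (t := {i}) trivial).inter (hG i ht)

theorem measurable_of_top {Ω ι γ : Type*} {m : MeasurableSpace Ω} [MeasurableSpace γ]
    {f : Ω → ι} (hf : Measurable[m, ⊤] f) (F : ι → γ) : Measurable[m] (fun ω => F (f ω)) :=
  fun t _ => hf (t := F ⁻¹' t) trivial

theorem measurable_top_comp_index {Ω ι γ : Type*} [Countable ι] {m : MeasurableSpace Ω}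
    {idx : Ω → ι} (hidx : Measurable[m, ⊤] idx) {G : ι → Ω → γ}
    (hG : ∀ i, Measurable[m, ⊤] (G i)) : Measurable[m, ⊤] (fun ω => G (idx ω) ω) :=
  @measurable_comp_index Ω ι γ _ m ⊤ idx hidx G hG

namespace Interaction.InEnvironment

variable {S A Ω : Type*} [Fintype S] [DecidableEq S] [Fintype A] [DecidableEq A] {H : ℕ}
  {M : MDP S A H} {mΩ : MeasurableSpace Ω} {μ : Measure Ω}
  {ℱ : Filtration ℕ mΩ} {I : Interaction S A H Ω} (hI : I.InEnvironment M μ ℱ)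

section measurability

include hI

theorem pol_measurable_of_le {k n : ℕ} (hn : k * H ≤ n) : Measurable[ℱ n, ⊤] (I.pol k) :=
  (hI.pol_measurable k).mono (ℱ.mono hn) le_rfl

/-- A later state is a function of the previous state, the next-state vector and the policy, so that
the assumption on initial states propagates through the episode. -/
theorem state_measurable (k h : ℕ) (hh : h < H + 1) :
    Measurable[ℱ (k * H + h), ⊤] (I.state k ⟨h, hh⟩) := by
  induction h with
  | zero => exact hI.init_measurable k
  | succ h ih =>
    have hh' : h < H := by omega
    have h1 : I.state k ⟨h + 1, hh⟩ = fun ω => I.next k ⟨h, hh'⟩ ω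
        (I.pol k ω ⟨h, hh'⟩ (I.state k ⟨h, by omega⟩ ω) (I.next k ⟨h, hh'⟩ ω)) := by
      funext ω; exact hI.step k ⟨h, hh'⟩ ω
    rw [h1]
    have h2 : Measurable[ℱ (k * H + (h + 1)), ⊤] (I.next k ⟨h, hh'⟩) :=
      hI.next_measurable k ⟨h, hh'⟩
    have h3 : Measurable[ℱ (k * H + (h + 1)), ⊤] (I.state k ⟨h, by omega⟩) :=
      (ih (by omega)).mono (ℱ.mono (by omega)) le_rfl
    have h4 := hI.pol_measurable_of_le (k := k) (n := k * H + (h + 1)) (by omega)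
    refine measurable_top_comp_index h2
      (G := fun v ω => v (I.pol k ω ⟨h, hh'⟩ (I.state k ⟨h, by omega⟩ ω) v)) fun v => ?_
    refine measurable_top_comp_index h3
      (G := fun s ω => v (I.pol k ω ⟨h, hh'⟩ s v)) fun s => ?_
    exact @measurable_of_top Ω _ S (_) ⊤ _ h4 fun π => v (π ⟨h, hh'⟩ s v)

theorem state_measurable' {k : ℕ} {h : Fin H} {n : ℕ} (hn : k * H + h ≤ n) :
    Measurable[ℱ n, ⊤] (I.state k h.castSucc) :=
  (hI.state_measurable k h (by omega)).mono (ℱ.mono hn) le_rfl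

theorem action_measurable {k : ℕ} {h : Fin H} {n : ℕ} (hn : k * H + h + 1 ≤ n) :
    Measurable[ℱ n, ⊤] (I.action k h) := by
  have h2 : Measurable[ℱ n, ⊤] (I.next k h) :=
      (hI.next_measurable k h).mono (ℱ.mono hn) le_rfl
  refine measurable_top_comp_index h2
      (G := fun v ω => I.pol k ω h (I.state k h.castSucc ω) v) fun v => ?_
  refine measurable_top_comp_index (hI.state_measurable' (by omega : k * H + h ≤ n))
      (G := fun s ω => I.pol k ω h s v) fun s => ?_
  exact @measurable_of_top Ω _ A (_) ⊤ _ (hI.pol_measurable_of_le (by omega)) fun π => π h s v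

end measurability

section step

variable [IsProbabilityMeasure μ]
include hI

/-- On the event that the state is `s` the conditional law is constant, so integrating the
conditional probability over a past event yields a product. -/
theorem measure_inter_eq (k : ℕ) (h : Fin H) (s : S) (v : A → S) {T : Set Ω}
    (hT : MeasurableSet[ℱ (k * H + h)] T) {B : Set (A → ℝ)} (hB : MeasurableSet B) :
    μ (I.rew k h ⁻¹' B ∩ (T ∩ ({ω | I.state k h.castSucc ω = s} ∩ {ω | I.next k h ω = v}))) =
      M.trans h s v * M.reward h s B * μ (T ∩ {ω | I.state k h.castSucc ω = s}) := by
  have := M.reward_prob h s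
  have hm := ℱ.le (k * H + h)
  have hstate : MeasurableSet[ℱ (k * H + h)] {ω | I.state k h.castSucc ω = s} :=
    hI.state_measurable' le_rfl (t := {s}) trivial
  have hT' := hT.inter hstate
  have hE : MeasurableSet {ω | I.next k h ω = v ∧ I.rew k h ω ∈ B} :=
    (ℱ.le _ _ (hI.next_measurable k h (t := {v}) trivial)).inter (hI.rew_measurable k h hB)
  set E := {ω | I.next k h ω = v ∧ I.rew k h ω ∈ B} with hEdef
  have h1 : ∫ ω in T ∩ {ω | I.state k h.castSucc ω = s}, (μ⟦E|ℱ (k * H + h)⟧) ω ∂μ =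
      ∫ ω in T ∩ {ω | I.state k h.castSucc ω = s}, E.indicator (fun _ => (1 : ℝ)) ω ∂μ :=
    setIntegral_condExp hm ((integrable_const 1).indicator hE) hT'
  have h2 : ∫ ω in T ∩ {ω | I.state k h.castSucc ω = s}, (μ⟦E|ℱ (k * H + h)⟧) ω ∂μ =
      ∫ ω in T ∩ {ω | I.state k h.castSucc ω = s},
        (M.trans h s v).toReal * (M.reward h s).real B ∂μ := by
    refine (setIntegral_congr_ae (hm _ hT') ?_)
    filter_upwards [hI.cond_law k h v B hB] with ω hω hmem
    rw [hω, hmem.2]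
  rw [h2, setIntegral_indicator hE, setIntegral_const, setIntegral_const] at h1
  have h3 : I.rew k h ⁻¹' B ∩ (T ∩ ({ω | I.state k h.castSucc ω = s} ∩ {ω | I.next k h ω = v})) =
      T ∩ {ω | I.state k h.castSucc ω = s} ∩ E := by
    ext ω; simp [hEdef]; tauto
  rw [h3]
  rw [← ENNReal.toReal_eq_toReal_iff' (measure_ne_top _ _)
    (ENNReal.mul_ne_top (ENNReal.mul_ne_top (PMF.apply_ne_top _ _) (measure_ne_top _ _))
      (measure_ne_top _ _)), ENNReal.toReal_mul, ENNReal.toReal_mul]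
  simp only [Measure.real, smul_eq_mul, mul_one] at h1
  rw [← h1]; ring

theorem lintegral_inter_eq (k : ℕ) (h : Fin H) (s : S) (v : A → S) {T : Set Ω}
    (hT : MeasurableSet[ℱ (k * H + h)] T) {ψ : (A → ℝ) → ℝ≥0∞} (hψ : Measurable ψ) :
    ∫⁻ ω in T ∩ ({ω | I.state k h.castSucc ω = s} ∩ {ω | I.next k h ω = v}), ψ (I.rew k h ω) ∂μ =
      M.trans h s v * (∫⁻ R, ψ R ∂(M.reward h s)) *
        μ (T ∩ {ω | I.state k h.castSucc ω = s}) := by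
  have hmeas : (μ.restrict (T ∩ ({ω | I.state k h.castSucc ω = s} ∩
      {ω | I.next k h ω = v}))).map (I.rew k h) =
      (M.trans h s v * μ (T ∩ {ω | I.state k h.castSucc ω = s})) • M.reward h s := by
    ext B hB
    rw [Measure.map_apply (hI.rew_measurable k h) hB,
      Measure.restrict_apply (hI.rew_measurable k h hB), hI.measure_inter_eq k h s v hT hB,
      Measure.smul_apply, smul_eq_mul]
    ring
  rw [← lintegral_map hψ (hI.rew_measurable k h), hmeas, lintegral_smul_measure, smul_eq_mul]
  ring

/-- The formula for past events says that two measures agree on the σ-algebra of the past; hence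
they give the same integral to every weight `Z` measurable there. -/
theorem setLIntegral_step (k : ℕ) (h : Fin H) (s : S) (v : A → S) {Z : Ω → ℝ≥0∞}
    (hZ : Measurable[ℱ (k * H + h)] Z) {ψ : (A → ℝ) → ℝ≥0∞} (hψ : Measurable ψ) :
    ∫⁻ ω in {ω | I.state k h.castSucc ω = s} ∩ {ω | I.next k h ω = v},
        Z ω * ψ (I.rew k h ω) ∂μ =
      M.trans h s v * (∫⁻ R, ψ R ∂(M.reward h s)) *
        ∫⁻ ω in {ω | I.state k h.castSucc ω = s}, Z ω ∂μ := by
  have hm := ℱ.le (k * H + h)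
  have hψr : Measurable (fun ω => ψ (I.rew k h ω)) := hψ.comp (hI.rew_measurable k h)
  set c := M.trans h s v * (∫⁻ R, ψ R ∂(M.reward h s))
  have hmeas : ((μ.restrict ({ω | I.state k h.castSucc ω = s} ∩
        {ω | I.next k h ω = v})).withDensity (fun ω => ψ (I.rew k h ω))).trim hm =
      c • (μ.restrict {ω | I.state k h.castSucc ω = s}).trim hm := by
    refine @Measure.ext _ (ℱ (k * H + h)) _ _ fun T hT => ?_
    rw [trim_measurableSet_eq hm hT, Measure.smul_apply, trim_measurableSet_eq hm hT,
      withDensity_apply _ (hm _ hT), Measure.restrict_restrict (hm _ hT),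
      Measure.restrict_apply (hm _ hT), hI.lintegral_inter_eq k h s v hT hψ, smul_eq_mul]
  have hZ' : Measurable Z := hZ.mono hm le_rfl
  calc _ = ∫⁻ ω, Z ω ∂((μ.restrict ({ω | I.state k h.castSucc ω = s} ∩
        {ω | I.next k h ω = v})).withDensity (fun ω => ψ (I.rew k h ω))) := by
        rw [lintegral_withDensity_eq_lintegral_mul _ hψr hZ']
        simp only [Pi.mul_apply, mul_comm]
    _ = _ := by
        rw [← lintegral_trim hm hZ, hmeas, lintegral_smul_measure, lintegral_trim hm hZ, smul_eq_mul]

/-- Integration of one step of the interaction, given the past. -/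
theorem lintegral_step (k : ℕ) (h : Fin H) {G : S → (A → S) → Ω → ℝ≥0∞}
    (hG : ∀ s v, Measurable[ℱ (k * H + h)] (G s v)) {ψ : (A → ℝ) → ℝ≥0∞} (hψ : Measurable ψ) :
    ∫⁻ ω, G (I.state k h.castSucc ω) (I.next k h ω) ω * ψ (I.rew k h ω) ∂μ =
      ∫⁻ ω, (∑ v, M.trans h (I.state k h.castSucc ω) v * G (I.state k h.castSucc ω) v ω) *
        ∫⁻ R, ψ R ∂(M.reward h (I.state k h.castSucc ω)) ∂μ := by
  have hm := ℱ.le (k * H + h)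
  have hst : ∀ s, MeasurableSet {ω | I.state k h.castSucc ω = s} := fun s =>
    hm _ (hI.state_measurable' le_rfl (t := {s}) trivial)
  have hnx : ∀ v, MeasurableSet {ω | I.next k h ω = v} := fun v =>
    ℱ.le _ _ (hI.next_measurable k h (t := {v}) trivial)
  have hu : (⋃ p : S × (A → S), {ω | I.state k h.castSucc ω = p.1} ∩ {ω | I.next k h ω = p.2}) =
      Set.univ := by
    ext ω; simp
  have hu' : (⋃ s : S, {ω | I.state k h.castSucc ω = s}) = Set.univ := by
    ext ω; simp
  rw [← setLIntegral_univ, ← hu, lintegral_iUnion (s := fun p : S × (A → S) =>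
      {ω | I.state k h.castSucc ω = p.1} ∩ {ω | I.next k h ω = p.2})
      (fun p => (hst p.1).inter (hnx p.2)),
    ← setLIntegral_univ (μ := μ) (f := fun ω => (∑ v, M.trans h (I.state k h.castSucc ω) v *
      G (I.state k h.castSucc ω) v ω) * ∫⁻ R, ψ R ∂(M.reward h (I.state k h.castSucc ω))),
    ← hu', lintegral_iUnion (s := fun s => {ω | I.state k h.castSucc ω = s}) hst, tsum_fintype, tsum_fintype, Fintype.sum_prod_type]
  · refine Finset.sum_congr rfl fun s _ => ?_
    have e1 : ∀ v, ∫⁻ ω in {ω | I.state k h.castSucc ω = s} ∩ {ω | I.next k h ω = v},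
        G (I.state k h.castSucc ω) (I.next k h ω) ω * ψ (I.rew k h ω) ∂μ =
        M.trans h s v * (∫⁻ R, ψ R ∂(M.reward h s)) *
        ∫⁻ ω in {ω | I.state k h.castSucc ω = s}, G s v ω ∂μ := fun v => by
      rw [← hI.setLIntegral_step k h s v (hG s v) hψ]
      exact setLIntegral_congr_fun ((hst s).inter (hnx v)) fun ω hω => by
        obtain ⟨h1, h2⟩ := hω
        simp only [Set.mem_ofPred_eq] at h1 h2
        rw [h1, h2]
    have e2 : ∫⁻ ω in {ω | I.state k h.castSucc ω = s},
        (∑ v, M.trans h (I.state k h.castSucc ω) v * G (I.state k h.castSucc ω) v ω) *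
        ∫⁻ R, ψ R ∂(M.reward h (I.state k h.castSucc ω)) ∂μ =
        ∫⁻ ω in {ω | I.state k h.castSucc ω = s},
          ∑ v, (M.trans h s v * (∫⁻ R, ψ R ∂(M.reward h s))) * G s v ω ∂μ :=
      setLIntegral_congr_fun (hst s) fun ω hω => by
        simp only [Set.mem_ofPred_eq] at hω
        simp only [hω, Finset.sum_mul]
        exact Finset.sum_congr rfl fun v _ => by ring
    rw [e2, lintegral_finsetSum _ fun v _ => ((hG s v).mono hm le_rfl).const_mul _]
    refine Finset.sum_congr rfl fun v _ => ?_
    dsimp only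
    rw [e1, lintegral_const_mul _ ((hG s v).mono hm le_rfl)]
  · intro s s' hss
    refine Set.disjoint_left.2 fun ω h1 h2 => hss ?_
    exact h1.symm.trans h2
  · intro p p' hpp
    refine Set.disjoint_left.2 fun ω h1 h2 => hpp ?_
    exact Prod.ext (h1.1.symm.trans h2.1) (h1.2.symm.trans h2.2)

end step

end Interaction.InEnvironment

/-! ### Exponential supermartingales and tail bounds. -/

namespace MDP

variable {S A : Type*} [Fintype S] [Fintype A] [DecidableEq A] {H : ℕ} (M : MDP S A H)

theorem sum_trans_mul_ofReal (h : Fin H) (s : S) {f : (A → S) → ℝ} (hf : ∀ v, 0 ≤ f v) :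
    ∑ v, M.trans h s v * ENNReal.ofReal (f v) = ENNReal.ofReal (M.nextMean h s f) := by
  rw [nextMean, ENNReal.ofReal_sum_of_nonneg fun v _ => mul_nonneg ENNReal.toReal_nonneg (hf v)]
  refine Finset.sum_congr rfl fun v _ => ?_
  rw [ENNReal.ofReal_mul ENNReal.toReal_nonneg, ENNReal.ofReal_toReal (PMF.apply_ne_top _ _)]

theorem sum_trans (h : Fin H) (s : S) : ∑ v, M.trans h s v = 1 := by
  rw [← tsum_fintype (L := .unconditional _), PMF.tsum_coe]

/-- Hoeffding's lemma: a variable in `[0, 1]` is sub-Gaussian with variance proxy 1/4, whence the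
compensator l²/8. -/
theorem lintegral_exp_reward_le_one (h : Fin H) (s : S) (a : A) (l : ℝ) :
    ∫⁻ R, ENNReal.ofReal (Real.exp (l * (R a - M.meanReward h s a) - l ^ 2 / 8))
      ∂(M.reward h s) ≤ 1 := by
  have := M.reward_prob h s
  have hsub := hasSubgaussianMGF_of_mem_Icc (measurable_pi_apply a).aemeasurable
    (M.ae_reward_mem h s a)
  have h1 := hsub.mgf_le l
  have h2 := hsub.integrable_exp_mul l
  have h3 : ∀ R : A → ℝ, Real.exp (l * (R a - M.meanReward h s a) - l ^ 2 / 8) =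
      Real.exp (l * (R a - ∫ R, R a ∂(M.reward h s))) * Real.exp (-(l ^ 2 / 8)) := fun R => by
    rw [← Real.exp_add]; rfl
  simp only [h3]
  rw [← ofReal_integral_eq_lintegral_ofReal (h2.mul_const _)
    (Filter.Eventually.of_forall fun _ => by positivity), integral_mul_const,
    ENNReal.ofReal_le_one]
  rw [mgf] at h1
  calc _ ≤ _ := mul_le_mul_of_nonneg_right h1 (Real.exp_pos _).le
    _ = 1 := by
      rw [← Real.exp_add, Real.exp_eq_one_iff]
      push_cast
      norm_num
      ring

theorem measurable_cumulative {Ω : Type*} [Finite S] {m : MeasurableSpace Ω} {π : Ω → DetPolicy S A H}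
    (hπ : Measurable[m, ⊤] π) {ρ : Ω → Fin H → S → (A → S) → ℝ}
    (hρ : ∀ h s v, Measurable[m] (fun ω => ρ ω h s v)) (h : ℕ) :
    ∀ s, Measurable[m] (fun ω => M.cumulative (π ω) (ρ ω) h s) := by
  induction h using backward_induction (H := H) with
  | top h hh =>
    intro s
    simp only [cumulative_of_le _ _ _ hh]
    exact measurable_const
  | step h hh ih =>
    intro s
    have h1 : (fun ω => M.cumulative (π ω) (ρ ω) h s) = fun ω => M.nextMean ⟨h, hh⟩ s
        (fun v => ρ ω ⟨h, hh⟩ s v + M.cumulative (π ω) (ρ ω) (h + 1) (v (π ω ⟨h, hh⟩ s v))) := by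
      funext ω; exact M.cumulative_of_lt _ _ ⟨h, hh⟩ s
    rw [h1]
    simp only [nextMean]
    refine Finset.measurable_sum _ fun v _ => Measurable.const_mul ((hρ _ _ _).add ?_) _
    refine measurable_comp_index (idx := fun ω => v (π ω ⟨h, hh⟩ s v))
      (G := fun s' ω => M.cumulative (π ω) (ρ ω) (h + 1) s') ?_ ih
    exact @measurable_of_top Ω _ S _ ⊤ _ hπ fun π => v (π ⟨h, hh⟩ s v)

end MDP

/-- The exponentials of the partial sums form a supermartingale along the starting times of
episodes; Markov's inequality concludes. The hypothesis is stated with a weight `Z` from the past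
instead of a conditional expectation. -/
theorem measure_sum_ge_le {Ω : Type*} {mΩ : MeasurableSpace Ω} {μ : Measure Ω}
    [IsProbabilityMeasure μ] {ℱ : Filtration ℕ mΩ} {H : ℕ} {ξ : ℕ → Ω → ℝ}
    (hmeas : ∀ j, Measurable[ℱ ((j + 1) * H)] (ξ j))
    (hstep : ∀ j (Z : Ω → ℝ≥0∞), Measurable[ℱ (j * H)] Z →
      ∫⁻ ω, Z ω * ENNReal.ofReal (Real.exp (ξ j ω)) ∂μ ≤ ∫⁻ ω, Z ω ∂μ) (k : ℕ) (L : ℝ) :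
    μ {ω | L ≤ ∑ j ∈ Finset.range k, ξ j ω} ≤ ENNReal.ofReal (Real.exp (-L)) := by
  have hsum : ∀ k, Measurable[ℱ (k * H)] (fun ω => ∑ j ∈ Finset.range k, ξ j ω) := fun k =>
    Finset.measurable_sum _ fun j hj => (hmeas j).mono
      (ℱ.mono (Nat.mul_le_mul_right _ (Finset.mem_range.1 hj))) le_rfl
  have hexp : ∀ k, Measurable[ℱ (k * H)]
      (fun ω => ENNReal.ofReal (Real.exp (∑ j ∈ Finset.range k, ξ j ω))) := fun k =>
    ENNReal.measurable_ofReal.comp (Real.measurable_exp.comp (hsum k))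
  have hle : ∀ k, ∫⁻ ω, ENNReal.ofReal (Real.exp (∑ j ∈ Finset.range k, ξ j ω)) ∂μ ≤ 1 := by
    intro k
    induction k with
    | zero => simp
    | succ k ih =>
      refine le_trans (le_of_eq ?_) ((hstep k _ (hexp k)).trans ih)
      refine lintegral_congr fun ω => ?_
      rw [Finset.sum_range_succ, Real.exp_add, ENNReal.ofReal_mul (Real.exp_pos _).le]
  have hsub : {ω | L ≤ ∑ j ∈ Finset.range k, ξ j ω} ⊆ {ω | ENNReal.ofReal (Real.exp L) ≤
      ENNReal.ofReal (Real.exp (∑ j ∈ Finset.range k, ξ j ω))} := fun ω hω =>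
    ENNReal.ofReal_le_ofReal (Real.exp_le_exp.2 hω)
  have hmk := meas_ge_le_lintegral_div ((hexp k).mono (ℱ.le _) le_rfl).aemeasurable (μ := μ)
    (ε := ENNReal.ofReal (Real.exp L)) (by simpa using Real.exp_pos L) ENNReal.ofReal_ne_top
  refine (measure_mono hsub).trans (hmk.trans ?_)
  rw [Real.exp_neg, ENNReal.ofReal_inv_of_pos (Real.exp_pos _), ← one_div]
  exact ENNReal.div_le_div_right (hle k) _

namespace Interaction.InEnvironment

variable {S A Ω : Type*} [Fintype S] [DecidableEq S] [Fintype A] [DecidableEq A] {H : ℕ}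
  {M : MDP S A H} {mΩ : MeasurableSpace Ω} {μ : Measure Ω}
  {ℱ : Filtration ℕ mΩ} {I : Interaction S A H Ω} (hI : I.InEnvironment M μ ℱ)
  [IsProbabilityMeasure μ]

include hI

theorem ae_reward_mem : ∀ᵐ ω ∂μ, ∀ k h, I.reward k h ω ∈ Set.Icc (0 : ℝ) 1 := by
  rw [ae_all_iff]; intro k
  rw [ae_all_iff]; intro h
  -- The whole reward vector is considered, so that the dependence of the played action on the past
  -- and on the next states does not matter.
  set B : Set (A → ℝ) := {R | ∀ a, R a ∈ Set.Icc (0 : ℝ) 1} with hBdef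
  have hB : MeasurableSet B := by
    have : B = ⋂ a, (fun R : A → ℝ => R a) ⁻¹' Set.Icc 0 1 := by ext R; simp [B]
    rw [this]
    exact MeasurableSet.iInter fun a => measurable_pi_apply a measurableSet_Icc
  have h1 := hI.lintegral_step k h (G := fun _ _ _ => 1) (fun _ _ => measurable_const)
    (ψ := Bᶜ.indicator 1) (measurable_one.indicator hB.compl)
  have h2 : ∀ s, ∫⁻ R, Bᶜ.indicator 1 R ∂(M.reward h s) = 0 := fun s => by
    rw [lintegral_indicator_one hB.compl]
    exact M.reward_mem h s
  simp only [h2, mul_zero, lintegral_zero, one_mul] at h1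
  have h3 : (fun ω => Bᶜ.indicator (1 : (A → ℝ) → ℝ≥0∞) (I.rew k h ω)) =
      (I.rew k h ⁻¹' Bᶜ).indicator 1 := by
    funext ω; simp [Set.indicator]
  rw [h3, lintegral_indicator_one (hI.rew_measurable k h hB.compl)] at h1
  filter_upwards [measure_eq_zero_iff_ae_notMem.1 h1] with ω hω
  have hmem : I.rew k h ω ∈ B := by simpa using hω
  exact hmem _

/-- Exponential tail bound for sums over the next states observed at `(h, s)`. -/
theorem measure_next_sum_ge_le (h : Fin H) (s : S) {φ : (A → S) → ℝ}
    (hφ : M.nextMean h s (fun v => Real.exp (φ v)) ≤ 1) (k : ℕ) (L : ℝ) :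
    μ {ω | L ≤ ∑ j ∈ (Finset.range k).filter (fun j => (I.data ω j h).state = s),
      φ (I.data ω j h).next} ≤ ENNReal.ofReal (Real.exp (-L)) := by
  simp only [Finset.sum_filter]
  have hle : ∀ j, j * H + h + 1 ≤ (j + 1) * H := fun j => by
    have := h.2; rw [add_mul]; omega
  refine measure_sum_ge_le (ℱ := ℱ) (H := H)
    -- An episode that does not visit `s` contributes 0, that is, a factor 1. The random number of
    -- visits therefore needs no stopping argument.
    (ξ := fun j ω => if (I.data ω j h).state = s then φ (I.data ω j h).next else 0) ?_ ?_ k L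
  · intro j
    refine measurable_comp_index (idx := I.next j h)
      (G := fun v ω => if I.state j h.castSucc ω = s then φ v else 0)
      ((hI.next_measurable j h).mono (ℱ.mono (hle j)) le_rfl) fun v => ?_
    exact measurable_of_top (hI.state_measurable' (by have := hle j; omega))
      (fun s' => if s' = s then φ v else 0)
  · intro j Z hZ
    have hZ' : Measurable[ℱ (j * H + h)] Z := hZ.mono (ℱ.mono (by omega)) le_rfl
    have h1 := hI.lintegral_step j h
      (G := fun s' v ω => Z ω * ENNReal.ofReal (Real.exp (if s' = s then φ v else 0)))
      (fun s' v => hZ'.mul_const _) (ψ := fun _ => 1) measurable_const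
    have := M.reward_prob h
    simp only [mul_one, lintegral_const, measure_univ] at h1
    refine le_of_eq_of_le h1 (lintegral_mono fun ω => ?_)
    dsimp only
    have h2 : ∀ s', ∑ v, M.trans h s' v *
        (Z ω * ENNReal.ofReal (Real.exp (if s' = s then φ v else 0))) =
        Z ω * ∑ v, M.trans h s' v * ENNReal.ofReal (Real.exp (if s' = s then φ v else 0)) := by
      intro s'
      rw [Finset.mul_sum]
      exact Finset.sum_congr rfl fun v _ => by ring
    rw [h2, M.sum_trans_mul_ofReal h _ fun v => (Real.exp_pos _).le]
    refine mul_le_of_le_one_right' (ENNReal.ofReal_le_one.2 ?_)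
    by_cases hs : I.state j h.castSucc ω = s
    · simpa [hs] using hφ
    · simp [hs, MDP.nextMean_const]

/-- Exponential tail bound for sums over the rewards collected at `(h, s, a)`. -/
theorem measure_reward_sum_ge_le (h : Fin H) (s : S) (a : A) {φ : ℝ → ℝ} (hφm : Measurable φ)
    (hφ : ∫⁻ R, ENNReal.ofReal (Real.exp (φ (R a))) ∂(M.reward h s) ≤ 1) (k : ℕ) (L : ℝ) :
    μ {ω | L ≤ ∑ j ∈ (Finset.range k).filter
      (fun j => (I.data ω j h).state = s ∧ (I.data ω j h).action = a),
      φ (I.data ω j h).reward} ≤ ENNReal.ofReal (Real.exp (-L)) := by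
  simp only [Finset.sum_filter]
  have hle : ∀ j, j * H + h + 1 ≤ (j + 1) * H := fun j => by
    have := h.2; rw [add_mul]; omega
  have hψ : Measurable (fun R : A → ℝ => ENNReal.ofReal (Real.exp (φ (R a)))) :=
    ENNReal.measurable_ofReal.comp (Real.measurable_exp.comp (hφm.comp (measurable_pi_apply a)))
  refine measure_sum_ge_le (ℱ := ℱ) (H := H)
    (ξ := fun j ω => if (I.data ω j h).state = s ∧ (I.data ω j h).action = a then
      φ (I.data ω j h).reward else 0) ?_ ?_ k L
  · intro j
    refine Measurable.ite ?_ (hφm.comp ((hI.reward_measurable j h).mono (ℱ.mono (hle j)) le_rfl))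
      measurable_const
    exact MeasurableSet.inter
      (hI.state_measurable' (k := j) (h := h) (by have := hle j; omega) (t := {s}) trivial)
      (hI.action_measurable (k := j) (h := h) (hle j) (t := {a}) trivial)
  · intro j Z hZ
    have hZ' : Measurable[ℱ (j * H + h)] Z := hZ.mono (ℱ.mono (by omega)) le_rfl
    have hp : ∀ s' v, MeasurableSet[ℱ (j * H + h)] {ω | s' = s ∧ I.pol j ω h s' v = a} :=
      fun s' v => hI.pol_measurable_of_le (k := j) (by omega)
        (t := {π | s' = s ∧ π h s' v = a}) trivial
    -- The weight is split according to whether `(s, a)` is played. This event is determined by the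
    -- past and the next states, hence independent of the rewards given these; on it the reward of
    -- the fixed action `a` is integrated, off it the factor is 1.
    have hG1 : ∀ s' v, Measurable[ℱ (j * H + h)]
        (fun ω => if s' = s ∧ I.pol j ω h s' v = a then Z ω else 0) := fun s' v =>
      Measurable.ite (hp s' v) hZ' measurable_const
    have hG2 : ∀ s' v, Measurable[ℱ (j * H + h)]
        (fun ω => if s' = s ∧ I.pol j ω h s' v = a then 0 else Z ω) := fun s' v =>
      Measurable.ite (hp s' v) measurable_const hZ'
    have h1 := hI.lintegral_step j h
      (G := fun s' v ω => if s' = s ∧ I.pol j ω h s' v = a then Z ω else 0) hG1 hψ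
    have h2 := hI.lintegral_step j h
      (G := fun s' v ω => if s' = s ∧ I.pol j ω h s' v = a then 0 else Z ω) hG2
      (ψ := fun _ => 1) measurable_const
    have := M.reward_prob h
    simp only [mul_one, lintegral_const, measure_univ] at h2
    have hmeas2 : ∀ {F : S → (A → S) → Ω → ℝ≥0∞},
        (∀ s' v, Measurable[ℱ (j * H + h)] (F s' v)) →
        Measurable (fun ω => F (I.state j h.castSucc ω) (I.next j h ω) ω) := by
      intro F hF
      refine measurable_comp_index (idx := I.next j h)
        (G := fun v ω => F (I.state j h.castSucc ω) v ω)
        ((hI.next_measurable j h).mono (ℱ.le _) le_rfl) fun v => ?_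
      exact measurable_comp_index (idx := I.state j h.castSucc) (G := fun s' ω => F s' v ω)
        ((hI.state_measurable' le_rfl).mono (ℱ.le _) le_rfl)
        fun s' => (hF s' v).mono (ℱ.le _) le_rfl
    have hmeas3 : Measurable (fun ω => ∑ v, M.trans h (I.state j h.castSucc ω) v *
        (if I.state j h.castSucc ω = s ∧ I.pol j ω h (I.state j h.castSucc ω) v = a then 0
          else Z ω)) :=
      Finset.measurable_sum _ fun v _ =>
        measurable_comp_index (idx := I.state j h.castSucc) (G := fun s' ω => M.trans h s' v *
          (if s' = s ∧ I.pol j ω h s' v = a then 0 else Z ω))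
          ((hI.state_measurable' le_rfl).mono (ℱ.le _) le_rfl)
          fun s' => ((hG2 s' v).mono (ℱ.le _) le_rfl).const_mul _
    calc ∫⁻ ω, Z ω * ENNReal.ofReal (Real.exp (if (I.data ω j h).state = s ∧
          (I.data ω j h).action = a then φ (I.data ω j h).reward else 0)) ∂μ
        = ∫⁻ ω, ((if I.state j h.castSucc ω = s ∧
            I.pol j ω h (I.state j h.castSucc ω) (I.next j h ω) = a then 0 else Z ω) +
            (if I.state j h.castSucc ω = s ∧
            I.pol j ω h (I.state j h.castSucc ω) (I.next j h ω) = a then Z ω else 0) *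
              ENNReal.ofReal (Real.exp (φ (I.rew j h ω a)))) ∂μ := by
          refine lintegral_congr fun ω => ?_
          have e : ((I.data ω j h).state = s ∧ (I.data ω j h).action = a) ↔
            (I.state j h.castSucc ω = s ∧
            I.pol j ω h (I.state j h.castSucc ω) (I.next j h ω) = a) := Iff.rfl
          by_cases hc : (I.data ω j h).state = s ∧ (I.data ω j h).action = a
          · rw [if_pos hc, if_pos (e.1 hc), if_pos (e.1 hc), zero_add, ← hc.2]
            rfl
          · rw [if_neg hc, if_neg (fun h => hc (e.2 h)), if_neg (fun h => hc (e.2 h))]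
            simp
      _ ≤ ∫⁻ ω, ((∑ v, M.trans h (I.state j h.castSucc ω) v *
            (if I.state j h.castSucc ω = s ∧ I.pol j ω h (I.state j h.castSucc ω) v = a then 0
              else Z ω)) + (∑ v, M.trans h (I.state j h.castSucc ω) v *
            (if I.state j h.castSucc ω = s ∧ I.pol j ω h (I.state j h.castSucc ω) v = a then Z ω
              else 0))) ∂μ := by
          rw [lintegral_add_left (hmeas2 hG2), lintegral_add_left hmeas3, h1, h2]
          refine add_le_add le_rfl (lintegral_mono fun ω => ?_)
          dsimp only
          by_cases hs : I.state j h.castSucc ω = s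
          · rw [hs]; exact mul_le_of_le_one_right' hφ
          · simp [hs]
      _ = ∫⁻ ω, Z ω ∂μ := by
          refine lintegral_congr fun ω => ?_
          rw [← Finset.sum_add_distrib]
          have : ∀ v, M.trans h (I.state j h.castSucc ω) v *
            (if I.state j h.castSucc ω = s ∧ I.pol j ω h (I.state j h.castSucc ω) v = a then 0
              else Z ω) + M.trans h (I.state j h.castSucc ω) v *
            (if I.state j h.castSucc ω = s ∧ I.pol j ω h (I.state j h.castSucc ω) v = a then Z ω
              else 0) = M.trans h (I.state j h.castSucc ω) v * Z ω := fun v => by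
            split_ifs <;> simp
          simp only [this]
          rw [← Finset.sum_mul, M.sum_trans, one_mul]

/-- One episode of the comparison between the expected and the realized sum of `y`. -/
theorem lintegral_exp_neg_sum_le (k : ℕ) {y : Ω → Fin H → S → (A → S) → ℝ}
    (hy : ∀ h s v, Measurable[ℱ (k * H)] (fun ω => y ω h s v))
    (hy0 : ∀ ω h s v, 0 ≤ y ω h s v) (hy1 : ∀ ω h s v, y ω h s v ≤ 1 / H) (h : ℕ) :
    ∀ (hh : h < H + 1) {Z : Ω → ℝ≥0∞}, Measurable[ℱ (k * H + h)] Z →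
    ∫⁻ ω, Z ω * ENNReal.ofReal (Real.exp (-∑ t ∈ Finset.univ.filter (fun t : Fin H => h ≤ t),
        y ω t (I.state k t.castSucc ω) (I.next k t ω))) ∂μ ≤
      ∫⁻ ω, Z ω * ENNReal.ofReal
        (1 - M.cumulative (I.pol k ω) (y ω) h (I.state k ⟨h, hh⟩ ω) / 4) ∂μ := by
  induction h using backward_induction (H := H) with
  | top h hh =>
    intro hh' Z _
    have : Finset.univ.filter (fun t : Fin H => h ≤ t) = ∅ := by
      ext t; have := t.2; simp; omega
    simp [this, M.cumulative_of_le _ _ hh]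
  | step h hh ih =>
    intro hh' Z hZ
    set t : Fin H := ⟨h, hh⟩ with ht
    have hfil : Finset.univ.filter (fun t : Fin H => h ≤ t) =
        insert t (Finset.univ.filter (fun t : Fin H => h + 1 ≤ t)) := by
      ext u; simp [ht, Fin.ext_iff]; omega
    have hnot : t ∉ Finset.univ.filter (fun t : Fin H => h + 1 ≤ t) := by simp [ht]
    have hHpos : 0 < H := by omega
    have hgm : ∀ h s, Measurable[ℱ (k * H)] (fun ω => M.cumulative (I.pol k ω) (y ω) h s) :=
      M.measurable_cumulative (hI.pol_measurable k) hy
    have hg0 : ∀ ω h s, 0 ≤ M.cumulative (I.pol k ω) (y ω) h s := fun ω h s =>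
      MDP.cumulative_nonneg (hy0 ω) h s
    have hg1 : ∀ ω h s, h ≤ H → M.cumulative (I.pol k ω) (y ω) h s ≤ 1 := fun ω h s hh =>
      (MDP.cumulative_le (hy1 ω) h s hh).trans (by
        rw [one_div, inv_mul_le_iff₀ (by exact_mod_cast hHpos), mul_one]
        linarith [Nat.cast_nonneg (α := ℝ) h])
    have hy1' : ∀ ω h s v, y ω h s v ≤ 1 := fun ω h s v => (hy1 ω h s v).trans (by
        rw [div_le_one (by exact_mod_cast hHpos)]; exact_mod_cast hHpos)
    have hmono : ℱ (k * H) ≤ ℱ (k * H + (h + 1)) := ℱ.mono (by omega)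
    have hmono' : ℱ (k * H) ≤ ℱ (k * H + t) := ℱ.mono (by omega)
    have hZ' : Measurable[ℱ (k * H + (h + 1))] (fun ω => Z ω * ENNReal.ofReal (Real.exp
        (-y ω t (I.state k t.castSucc ω) (I.next k t ω)))) := by
      refine Measurable.mul (hZ.mono (ℱ.mono (by omega)) le_rfl) ?_
      refine ENNReal.measurable_ofReal.comp (Real.measurable_exp.comp (Measurable.neg ?_))
      refine measurable_comp_index (idx := I.next k t)
        (G := fun v ω => y ω t (I.state k t.castSucc ω) v) (hI.next_measurable k t) fun v => ?_
      exact measurable_comp_index (idx := I.state k t.castSucc) (G := fun s ω => y ω t s v)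
        (hI.state_measurable' (by simp [ht])) fun s => (hy t s v).mono hmono le_rfl
    have hstep := hI.lintegral_step k t
      (G := fun s v ω => Z ω * ENNReal.ofReal
        (1 - (y ω t s v + M.cumulative (I.pol k ω) (y ω) (h + 1) (v (I.pol k ω t s v))) / 4))
      (fun s v => by
        refine Measurable.mul hZ (ENNReal.measurable_ofReal.comp (Measurable.const_sub
          (Measurable.div_const (Measurable.add ((hy t s v).mono hmono' le_rfl) ?_) _) _))
        refine measurable_comp_index (idx := fun ω => v (I.pol k ω t s v))
          (G := fun s' ω => M.cumulative (I.pol k ω) (y ω) (h + 1) s') ?_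
          fun s' => (hgm _ s').mono hmono' le_rfl
        exact @measurable_of_top Ω _ S _ ⊤ _ (hI.pol_measurable_of_le (by omega))
          fun π => v (π t s v))
      (ψ := fun _ => 1) measurable_const
    have := M.reward_prob t
    simp only [mul_one, lintegral_const, measure_univ] at hstep
    calc _ = ∫⁻ ω, (Z ω * ENNReal.ofReal (Real.exp
          (-y ω t (I.state k t.castSucc ω) (I.next k t ω)))) *
          ENNReal.ofReal (Real.exp (-∑ t ∈ Finset.univ.filter (fun t : Fin H => h + 1 ≤ t),
            y ω t (I.state k t.castSucc ω) (I.next k t ω))) ∂μ := by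
          refine lintegral_congr fun ω => ?_
          rw [hfil, Finset.sum_insert hnot, neg_add, Real.exp_add,
            ENNReal.ofReal_mul (Real.exp_pos _).le, mul_assoc]
      -- The factor of the present step is known at time `h + 1` and is absorbed into the weight;
      -- this is why the induction runs over all weights `Z`.
      _ ≤ _ := ih (by omega) hZ'
      _ ≤ ∫⁻ ω, Z ω * ENNReal.ofReal (1 - (y ω t (I.state k t.castSucc ω) (I.next k t ω) +
            M.cumulative (I.pol k ω) (y ω) (h + 1)
            (I.next k t ω (I.pol k ω t (I.state k t.castSucc ω) (I.next k t ω)))) / 4) ∂μ := by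
          refine lintegral_mono fun ω => ?_
          dsimp only
          rw [mul_assoc, ← ENNReal.ofReal_mul (Real.exp_pos _).le]
          refine mul_le_mul_right (ENNReal.ofReal_le_ofReal ?_) _
          have e : I.state k ⟨h + 1, by omega⟩ ω =
            I.next k t ω (I.pol k ω t (I.state k t.castSucc ω) (I.next k t ω)) := hI.step k t ω
          rw [e]
          exact exp_neg_mul_one_sub_le (hy0 _ _ _ _) (hy1' _ _ _ _) (hg1 _ _ _ hh)
      _ = _ := by
          rw [hstep]
          refine lintegral_congr fun ω => ?_
          set s := I.state k t.castSucc ω with hs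
          have e : I.state k ⟨h, hh'⟩ ω = s := rfl
          have h2 : ∀ f : (A → S) → ℝ≥0∞, ∑ v, M.trans t s v * (Z ω * f v) =
              Z ω * ∑ v, M.trans t s v * f v := by
            intro f
            rw [Finset.mul_sum]
            exact Finset.sum_congr rfl fun v _ => by ring
          rw [h2, M.sum_trans_mul_ofReal, e, M.cumulative_of_lt _ _ t s]
          · congr 2
            rw [(M.isMean_nextMean t s).sub, MDP.nextMean_const]
            simp only [div_eq_inv_mul]
            rw [MDP.nextMean_const_mul]
          · intro v
            have h3 := hy1' ω t s v
            have h4 := hg1 ω (h + 1) (v (I.pol k ω t s v)) hh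
            linarith

/-- Comparison between the expected and the realized sums of `y` over the episodes. -/
theorem measure_cumulative_sum_ge_le {y : ℕ → Ω → Fin H → S → (A → S) → ℝ}
    (hy : ∀ k h s v, Measurable[ℱ (k * H)] (fun ω => y k ω h s v))
    (hy0 : ∀ k ω h s v, 0 ≤ y k ω h s v) (hy1 : ∀ k ω h s v, y k ω h s v ≤ 1 / H)
    (K : ℕ) (L : ℝ) :
    μ {ω | L ≤ ∑ k ∈ Finset.range K,
        (M.cumulative (I.pol k ω) (y k ω) 0 (I.state k 0 ω) / 4 -
          ∑ t : Fin H, y k ω t (I.state k t.castSucc ω) (I.next k t ω))} ≤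
      ENNReal.ofReal (Real.exp (-L)) := by
  have hgm : ∀ k h s, Measurable[ℱ (k * H)]
      (fun ω => M.cumulative (I.pol k ω) (y k ω) h s) := fun k =>
      M.measurable_cumulative (hI.pol_measurable k) (hy k)
  have hg0m : ∀ k, Measurable[ℱ (k * H)]
      (fun ω => M.cumulative (I.pol k ω) (y k ω) 0 (I.state k 0 ω)) := fun k =>
    measurable_comp_index (idx := I.state k 0)
      (G := fun s ω => M.cumulative (I.pol k ω) (y k ω) 0 s) (hI.init_measurable k) (hgm k 0)
  refine measure_sum_ge_le (ℱ := ℱ) (H := H)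
    (ξ := fun k ω => M.cumulative (I.pol k ω) (y k ω) 0 (I.state k 0 ω) / 4 -
          ∑ t : Fin H, y k ω t (I.state k t.castSucc ω) (I.next k t ω)) ?_ ?_ K L
  · intro k
    have hle : k * H ≤ (k + 1) * H := Nat.mul_le_mul_right _ (by omega)
    refine Measurable.sub ((hg0m k).mono (ℱ.mono hle) le_rfl |>.div_const _) ?_
    refine Finset.measurable_sum _ fun t _ => ?_
    have hle' : k * H + t + 1 ≤ (k + 1) * H := by have := t.2; rw [add_mul]; omega
    refine measurable_comp_index (idx := I.next k t)
        (G := fun v ω => y k ω t (I.state k t.castSucc ω) v)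
        ((hI.next_measurable k t).mono (ℱ.mono hle') le_rfl) fun v => ?_
    exact measurable_comp_index (idx := I.state k t.castSucc) (G := fun s ω => y k ω t s v)
        (hI.state_measurable' (by omega)) fun s => (hy k t s v).mono (ℱ.mono hle) le_rfl
  · intro k Z hZ
    -- The expected sum is known when the episode begins, so its exponential may be put into the
    -- weight. With x a quarter of it, the product e^x (1 - x) that remains is at most 1.
    have h1 := hI.lintegral_exp_neg_sum_le k (hy k) (hy0 k) (hy1 k) 0 (by omega)
      (Z := fun ω => Z ω * ENNReal.ofReal
        (Real.exp (M.cumulative (I.pol k ω) (y k ω) 0 (I.state k 0 ω) / 4)))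
      (hZ.mul (ENNReal.measurable_ofReal.comp
        (Real.measurable_exp.comp ((hg0m k).div_const _))))
    simp only [Nat.zero_le, Finset.filter_true] at h1
    calc _ = _ := lintegral_congr fun ω => ?_
      _ ≤ _ := h1
      _ ≤ _ := lintegral_mono fun ω => ?_
    · rw [mul_assoc, ← ENNReal.ofReal_mul (Real.exp_pos _).le, ← Real.exp_add, sub_eq_add_neg]
    · dsimp only
      rw [mul_assoc, ← ENNReal.ofReal_mul (Real.exp_pos _).le]
      refine mul_le_of_le_one_right' (ENNReal.ofReal_le_one.2 ?_)
      set x := M.cumulative (I.pol k ω) (y k ω) 0 (I.state k 0 ω) / 4 with hx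
      have e : I.state k ⟨0, by omega⟩ ω = I.state k 0 ω := rfl
      rw [e, ← hx]
      calc Real.exp x * (1 - x) ≤ Real.exp x * Real.exp (-x) := by
            refine mul_le_mul_of_nonneg_left ?_ (Real.exp_pos _).le
            linarith [Real.add_one_le_exp (-x)]
        _ = 1 := by rw [← Real.exp_add]; simp

end Interaction.InEnvironment

/-! ### Numerical inequalities behind the bonuses. -/

/-- `√(x y) ≤ (m x + y / m) / 2`. -/
theorem sqrt_mul_le_half_add {x y m : ℝ} (hx : 0 ≤ x) (hy : 0 ≤ y) (hm : 0 < m) :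
    √(x * y) ≤ (m * x + y / m) / 2 := by
  rw [Real.sqrt_le_left (by positivity)]
  have h : x * y = (m * x) * (y / m) := by field_simp
  rw [h]
  nlinarith [sq_nonneg (m * x - y / m)]

theorem sqrt_add_le {x y : ℝ} (hx : 0 ≤ x) (hy : 0 ≤ y) : √(x + y) ≤ √x + √y := by
  rw [Real.sqrt_le_left (by positivity)]
  nlinarith [Real.sq_sqrt hx, Real.sq_sqrt hy, mul_nonneg (Real.sqrt_nonneg x) (Real.sqrt_nonneg y)]

/-- The deviation involves the true variance `V`, the bonus the empirical variance `V'`, and `hvar`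
links them up to the squared deviation of the means. For small `τ` this square, itself of order Vτ,
is absorbed into `V`. The constants are those of the algorithm: (20/3)² · 3 = 400/3. -/
theorem bonus_dominates_deviation {q q' V V' τ H : ℝ} (hH : 0 ≤ H) (hτ : 0 ≤ τ) (hV : 0 ≤ V)
    (hV' : 0 ≤ V') (hq : q ≤ H) (hq' : 0 ≤ q') (hdev : q - q' ≤ 2 * √(V * τ) + 2 * (H * τ))
    (hvar : V ≤ 2 * (V' + (q' - q) ^ 2) + 2 * (H ^ 2 * τ)) :
    q ≤ q' + max (√((20 / 3) ^ 2 * τ * V')) ((20 / 3) ^ 2 * τ * (3 * H)) := by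
  rcases le_or_gt (3 / 400) τ with h1 | h1
  -- The bound is trivial from `τ = 3/400` on: there the second term of the maximum is 400/3 · Hτ ≥
  -- H ≥ q.
  · have := le_max_right (√((20 / 3) ^ 2 * τ * V')) ((20 / 3) ^ 2 * τ * (3 * H))
    nlinarith
  rcases le_or_gt q q' with h2 | h2
  · have := le_max_right (√((20 / 3) ^ 2 * τ * V')) ((20 / 3) ^ 2 * τ * (3 * H))
    nlinarith [mul_nonneg hτ hH]
  have hs : √((20 / 3) ^ 2 * τ * V') = 20 / 3 * √(V' * τ) := by
    rw [mul_assoc, Real.sqrt_mul (by positivity), Real.sqrt_sq (by norm_num), mul_comm τ]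
  have hd : (q - q') ^ 2 ≤ 8 * (V * τ) + 8 * (H * τ) ^ 2 := by
    have h3 : (q - q') ^ 2 ≤ (2 * √(V * τ) + 2 * (H * τ)) ^ 2 :=
      pow_le_pow_left₀ (by linarith) hdev 2
    have h4 := Real.sq_sqrt (mul_nonneg hV hτ)
    nlinarith [sq_nonneg (√(V * τ) - H * τ)]
  -- Solving for `V` costs 1/(1 - 16 · 3/400) = 1/0.88, and 2/0.88 < 2.3, 2.12/0.88 < 2.5.
  have h5 : V ≤ 2.3 * V' + 2.5 * (H ^ 2 * τ) := by
    have h6 : V * τ ≤ V * (3 / 400) := mul_le_mul_of_nonneg_left h1.le hV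
    have h7 : (H * τ) ^ 2 ≤ H ^ 2 * τ * (3 / 400) := by
      have : (H * τ) ^ 2 = H ^ 2 * τ * τ := by ring
      rw [this]
      exact mul_le_mul_of_nonneg_left h1.le (by positivity)
    have h8 : (q' - q) ^ 2 = (q - q') ^ 2 := by ring
    nlinarith [mul_nonneg (sq_nonneg H) hτ]
  have h9 : √(V * τ) ≤ 1.6 * √(V' * τ) + 1.6 * (H * τ) := by
    rw [Real.sqrt_le_left (by positivity)]
    have h10 := Real.sq_sqrt (mul_nonneg hV' hτ)
    have h11 := mul_le_mul_of_nonneg_right h5 hτ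
    have h12 : 0 ≤ √(V' * τ) * (H * τ) := by positivity
    nlinarith [sq_nonneg (H * τ)]
  have h13 := le_max_left (20 / 3 * √(V' * τ)) ((20 / 3) ^ 2 * τ * (3 * H))
  have h14 := le_max_right (20 / 3 * √(V' * τ)) ((20 / 3) ^ 2 * τ * (3 * H))
  have h15 := mul_nonneg hH hτ
  have h16 := Real.sqrt_nonneg (V' * τ)
  rw [hs]
  nlinarith

/-- Replacing one variance by another leaves an error of the form H times the gap `g`. The
inequality of arithmetic and geometric means turns its square root into a small multiple of `g / H`,
which the recursion tolerates, plus a term of order H²τ. -/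
theorem sqrt_variance_le {V Vp g τ H c m : ℝ} (hH : 0 < H) (hτ : 0 ≤ τ) (hVp : 0 ≤ Vp)
    (hg : 0 ≤ g) (hc : 0 ≤ c) (hm : 0 < m) {R : ℝ} (hR : 0 ≤ R) {d : ℝ} (hd : 0 ≤ d)
    (hV : V * τ ≤ c * (Vp * τ) + (g * (d * H * τ) + R ^ 2)) :
    √(V * τ) ≤ √c * √(Vp * τ) + ((g / (m * H) + m * d / 4 * (H ^ 2 * τ)) + R) := by
  calc √(V * τ) ≤ √(c * (Vp * τ) + (g * (d * H * τ) + R ^ 2)) := Real.sqrt_le_sqrt hV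
    _ ≤ √(c * (Vp * τ)) + √(g * (d * H * τ) + R ^ 2) :=
        sqrt_add_le (by positivity) (by positivity)
    _ ≤ √(c * (Vp * τ)) + (√(g * (d * H * τ)) + √(R ^ 2)) :=
        add_le_add le_rfl (sqrt_add_le (by positivity) (by positivity))
    _ ≤ _ := by
      rw [Real.sqrt_mul hc, Real.sqrt_sq hR]
      refine add_le_add le_rfl (add_le_add ?_ le_rfl)
      refine (sqrt_mul_le_half_add hg (by positivity) (m := 2 / (m * H)) (by positivity)).trans
        (le_of_eq ?_)
      field_simp; ring

/-- Here P and E mark true and empirical means; q, w and v stand for Q*, W and the policy's value.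
The empirical variance of W is traced back to the variance `Vp` of Q^π through those of Q*, and each
exchange costs a multiple of `H * g`. -/
theorem gap_le_of_deviations {U Pq Eq Pw Ew V Vp Vw Vq g v τ θ H : ℝ} (hH : 1 ≤ H) (hτ : 0 ≤ τ)
    (hτθ : τ ≤ θ) (hVp : 0 ≤ Vp) (hg : Pw - v = g) (hg0 : 0 ≤ g)
    (hwq : Pw - Pq ≤ g)
    (h1 : Eq ≤ Pq + (2 * √(V * τ) + 2 * (H * τ)))
    (h2 : Ew - Eq ≤ (1 + 1 / (4 * H)) * (Pw - Pq) + 4 * H * θ * (3 * H))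
    (h3 : V ≤ 2 * Vp + 2 * (H * g)) (h4 : Vw ≤ 2 * Vq + 2 * (3 * H * (Ew - Eq)))
    (h5 : Vq ≤ 2 * V + H ^ 2 * τ)
    (hU : U ≤ Ew + (20 / 3 * √(Vw * τ) + 400 / 3 * (H * τ))) :
    U - v ≤ (1 + 1 / H) * g + 22 * √(Vp * τ) + 1000 * (H ^ 2 * θ) := by
  have hH0 : 0 < H := by linarith
  have hθ : 0 ≤ θ := hτ.trans hτθ
  have hHτ2 : H ^ 2 * τ ≤ H ^ 2 * θ := mul_le_mul_of_nonneg_left hτθ (sq_nonneg H)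
  have hHτ : H * τ ≤ H ^ 2 * τ := mul_le_mul_of_nonneg_right (by nlinarith) hτ
  have g1 : 1 / (4 * H) * (Pw - Pq) ≤ 1 / 4 * (g / H) := by
    have : 1 / (4 * H) * (Pw - Pq) ≤ 1 / (4 * H) * g :=
      mul_le_mul_of_nonneg_left hwq (by positivity)
    refine this.trans_eq ?_
    field_simp
  have g5 : 0 ≤ g / H := by positivity
  have g6 : g / H ≤ g := div_le_self hg0 hH
  have h2' : Ew - Eq ≤ (Pw - Pq) + 1 / 4 * (g / H) + 12 * (H ^ 2 * θ) := by linarith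
  have hEwq : Ew - Eq ≤ 2 * g + 12 * (H ^ 2 * θ) := by linarith
  have e1 : √(V * τ) ≤ √2 * √(Vp * τ) + ((g / (8 * H) + 8 * 2 / 4 * (H ^ 2 * τ)) + 0) :=
    sqrt_variance_le hH0 hτ hVp hg0 (by norm_num) (by norm_num) le_rfl (by norm_num)
      ((mul_le_mul_of_nonneg_right h3 hτ).trans_eq (by ring))
  have hVw : Vw ≤ 8 * Vp + 20 * (H * g) + 74 * (H ^ 3 * θ) := by
    have a1 : H * (Ew - Eq) ≤ H * (2 * g + 12 * (H ^ 2 * θ)) :=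
      mul_le_mul_of_nonneg_left hEwq hH0.le
    have a2 : H ^ 2 * θ ≤ H ^ 3 * θ :=
      mul_le_mul_of_nonneg_right (pow_le_pow_right₀ hH (by norm_num)) hθ
    have a3 : H * (2 * g + 12 * (H ^ 2 * θ)) = 2 * (H * g) + 12 * (H ^ 3 * θ) := by ring
    linarith
  have e2 : √(Vw * τ) ≤ √8 * √(Vp * τ) +
      ((g / (20 * H) + 20 * 20 / 4 * (H ^ 2 * τ)) + 9 * (H ^ 2 * θ)) := by
    refine sqrt_variance_le hH0 hτ hVp hg0 (by norm_num) (by norm_num) (by positivity)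
      (by norm_num) ?_
    have b1 : (H ^ 3 * θ) * τ ≤ (H ^ 4 * θ) * θ := by
      refine mul_le_mul (mul_le_mul_of_nonneg_right ?_ hθ) hτθ hτ (by positivity)
      exact pow_le_pow_right₀ hH (by norm_num)
    have b2 : (9 * (H ^ 2 * θ)) ^ 2 = 81 * ((H ^ 4 * θ) * θ) := by ring
    have b3 : 0 ≤ (H ^ 4 * θ) * θ := by positivity
    have b4 := mul_le_mul_of_nonneg_right hVw hτ
    have b5 : (8 * Vp + 20 * (H * g) + 74 * (H ^ 3 * θ)) * τ =
      8 * (Vp * τ) + g * (20 * H * τ) + 74 * (H ^ 3 * θ * τ) := by ring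
    linarith
  have s2 : √2 ≤ 1.42 := by rw [Real.sqrt_le_left (by norm_num)]; norm_num
  have s8 : √8 ≤ 2.83 := by rw [Real.sqrt_le_left (by norm_num)]; norm_num
  have hsp := Real.sqrt_nonneg (Vp * τ)
  have m2 := mul_le_mul_of_nonneg_right s2 hsp
  have m8 := mul_le_mul_of_nonneg_right s8 hsp
  have g2 : g / (8 * H) = 1 / 8 * (g / H) := by field_simp
  have g3 : g / (20 * H) = 1 / 20 * (g / H) := by field_simp
  have g4 : 1 / H * g = g / H := by field_simp
  have g7 : 0 ≤ H ^ 2 * θ := by positivity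
  rw [g2] at e1
  rw [g3] at e2
  -- Budget for `g / H`: 1/4 from the level sets, 2/8 from the deviation of Q*, (20/3)/20 from the
  -- bonus, in all 5/6. The coefficient of √(Vp τ) is 2 · 1.42 + (20/3) · 2.83 < 22.
  rw [add_mul, one_mul, g4]
  linarith

/-! ### Optimism and the recursion for the gap, on accurate data. -/

namespace Data

variable {S A : Type*} [Fintype S] [DecidableEq S] [Fintype A] [DecidableEq A] {H : ℕ}

/-- The next-state vectors that hit `B` and avoid `B'`. -/
def HitsAvoids (B B' : Finset (A × S)) (v : A → S) : Prop :=
  (∃ a, (a, v a) ∈ B) ∧ ∀ a, (a, v a) ∉ B'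

instance (B B' : Finset (A × S)) : DecidablePred (HitsAvoids B B') := fun _ =>
  inferInstanceAs (Decidable (_ ∧ _))

/-- The logarithmic factor enlarged by the logarithm of the number of the sets of `HitsAvoids`. -/
noncomputable def largeLogFactor (S A : Type*) [Fintype S] [Fintype A] (H : ℕ) (δ : ℝ) (k : ℕ) :
    ℝ :=
  logFactor S A H δ k + 2 * (Fintype.card A * Fintype.card S : ℕ) * Real.log 2

theorem one_le_logFactor [Nonempty S] [Nonempty A] {δ : ℝ} (hH : 1 ≤ H) (h0 : 0 < δ) (h1 : δ < 1)
    (k : ℕ) : 1 ≤ logFactor S A H δ k := by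
  rw [logFactor, Real.le_log_iff_exp_le]
  · have hS : (1 : ℝ) ≤ Fintype.card S := by exact_mod_cast Fintype.card_pos
    have hA : (1 : ℝ) ≤ Fintype.card A := by exact_mod_cast Fintype.card_pos
    have hH' : (1 : ℝ) ≤ H := by exact_mod_cast hH
    have hk : (0 : ℝ) ≤ k := Nat.cast_nonneg k
    have h2 : (1 : ℝ) ≤ (Fintype.card S : ℝ) ^ 3 * (Fintype.card A : ℝ) ^ 2 * (H : ℝ) *
      ((k : ℝ) + 1) ^ 2 * ((k : ℝ) + 2) := by
      refine one_le_mul_of_one_le_of_one_le (one_le_mul_of_one_le_of_one_le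
        (one_le_mul_of_one_le_of_one_le (one_le_mul_of_one_le_of_one_le
          (one_le_pow₀ hS) (one_le_pow₀ hA)) hH') (one_le_pow₀ (by linarith))) (by linarith)
    rw [le_div_iff₀ h0]
    have := Real.exp_one_lt_d9
    nlinarith
  · have hS : (0 : ℝ) < Fintype.card S := by exact_mod_cast Fintype.card_pos
    have hA : (0 : ℝ) < Fintype.card A := by exact_mod_cast Fintype.card_pos
    have hH' : (0 : ℝ) < H := by exact_mod_cast hH
    positivity

theorem logFactor_le_largeLogFactor (δ : ℝ) (k : ℕ) :
    logFactor S A H δ k ≤ largeLogFactor S A H δ k := by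
  have := Real.log_nonneg (by norm_num : (1 : ℝ) ≤ 2)
  rw [largeLogFactor]
  have : 0 ≤ 2 * ((Fintype.card A * Fintype.card S : ℕ) : ℝ) * Real.log 2 := by positivity
  linarith

/-- The data of the first `k` episodes are as accurate as concentration inequalities predict. -/
structure IsAccurate [Nonempty A] (D : Data S A H) (M : MDP S A H) (δ : ℝ) (k : ℕ) : Prop where
  reward_mem : ∀ j h, (D j h).reward ∈ Set.Icc (0 : ℝ) 1
  reward : ∀ h s a, D.countSA k h s a ≠ 0 → |D.empReward k h s a - M.meanReward h s a| ≤
    √(logFactor S A H δ k / D.countSA k h s a)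
  mean : ∀ h s, D.count k h s ≠ 0 →
    |D.empMean k h s (M.bellmanLookahead h s) - M.nextMean h s (M.bellmanLookahead h s)| ≤
      2 * √(M.nextVar h s (M.bellmanLookahead h s) * (logFactor S A H δ k / D.count k h s)) +
      2 * (H * (logFactor S A H δ k / D.count k h s))
  var_upper : ∀ h s, D.count k h s ≠ 0 →
    D.empMean k h s (fun v =>
      (M.bellmanLookahead h s v - M.nextMean h s (M.bellmanLookahead h s)) ^ 2) ≤
      2 * M.nextVar h s (M.bellmanLookahead h s) +
        (H : ℝ) ^ 2 * (logFactor S A H δ k / D.count k h s)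
  var_lower : ∀ h s, D.count k h s ≠ 0 →
    M.nextVar h s (M.bellmanLookahead h s) ≤ 2 * D.empMean k h s (fun v =>
      (M.bellmanLookahead h s v - M.nextMean h s (M.bellmanLookahead h s)) ^ 2) +
        2 * ((H : ℝ) ^ 2 * (logFactor S A H δ k / D.count k h s))
  hits : ∀ h s (B B' : Finset (A × S)), D.count k h s ≠ 0 →
    D.empMean k h s (fun v => if HitsAvoids B B' v then 1 else 0) ≤
      (1 + 1 / (4 * (H : ℝ))) * M.nextMean h s (fun v => if HitsAvoids B B' v then 1 else 0) +
        4 * H * (largeLogFactor S A H δ k / D.count k h s)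

variable [Nonempty A]

/-- The optimistic lookahead values of MVP-TL. -/
noncomputable def optLookahead (D : Data S A H) (δ : ℝ) (k : ℕ) (h : Fin H) (s : S) (v : A → S) :
    ℝ :=
  D.lookaheadValue δ k h (D.optimisticValue δ k (h + 1)) s v

variable (D : Data S A H) (M : MDP S A H) (δ : ℝ) (k : ℕ)

theorem optimisticValue_of_le {h : ℕ} (hh : H ≤ h) (s : S) : D.optimisticValue δ k h s = 0 := by
  rw [optimisticValue, dif_neg (by omega)]

theorem optimisticValue_of_count_eq_zero {h : Fin H} {s : S} (hn : D.count k h s = 0) :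
    D.optimisticValue δ k h s = H := by
  rw [optimisticValue, dif_pos h.2, if_pos hn]

theorem optimisticValue_of_count_ne_zero {h : Fin H} {s : S} (hn : D.count k h s ≠ 0) :
    D.optimisticValue δ k h s = min (D.empMean k h s (D.optLookahead δ k h s) +
      D.transBonus δ k h s (D.optLookahead δ k h s)) H := by
  rw [optimisticValue, dif_pos h.2, if_neg hn]; rfl

theorem optimisticValue_le (h : ℕ) (s : S) : D.optimisticValue δ k h s ≤ H := by
  rcases lt_or_ge h H with hh | hh
  · by_cases hn : D.count k ⟨h, hh⟩ s = 0
    · exact (D.optimisticValue_of_count_eq_zero δ k hn).le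
    · exact (D.optimisticValue_of_count_ne_zero δ k hn).trans_le (min_le_right _ _)
  · rw [D.optimisticValue_of_le δ k hh]; positivity

theorem max_count {h : Fin H} {s : S} (hn : D.count k h s ≠ 0) :
    max (D.count k h s : ℝ) 1 = D.count k h s :=
  max_eq_left (by exact_mod_cast Nat.one_le_iff_ne_zero.2 hn)

theorem transBonus_eq {h : Fin H} {s : S} (hn : D.count k h s ≠ 0) (W : (A → S) → ℝ) :
    D.transBonus δ k h s W = 20 / 3 * √((D.empMean k h s (fun v => W v ^ 2) -
        D.empMean k h s W ^ 2) * (logFactor S A H δ k / D.count k h s)) +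
      400 / 3 * (H * (logFactor S A H δ k / D.count k h s)) := by
  rw [transBonus, empVar, D.max_count k hn, mul_div_assoc, mul_div_assoc]

theorem rewardBonus_nonneg (h : Fin H) (s : S) (a : A) : 0 ≤ D.rewardBonus δ k h s a :=
  le_min (Real.sqrt_nonneg _) zero_le_one

namespace IsAccurate

variable {D M δ k} (hD : D.IsAccurate M δ k)
include hD

theorem empReward_mem (h : Fin H) (s : S) (a : A) : D.empReward k h s a ∈ Set.Icc (0 : ℝ) 1 := by
  refine ⟨div_nonneg (Finset.sum_nonneg fun j _ => (hD.reward_mem j h).1) (Nat.cast_nonneg _),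
    div_le_one_of_le₀ ?_ (Nat.cast_nonneg _)⟩
  refine (Finset.sum_le_sum fun j _ => (hD.reward_mem j h).2).trans ?_
  simp [countSA]

variable (hL : 1 ≤ logFactor S A H δ k)
include hL

theorem abs_empReward_sub_le (h : Fin H) (s : S) (a : A) :
    |D.empReward k h s a - M.meanReward h s a| ≤ D.rewardBonus δ k h s a := by
  refine le_min ?_ ?_
  · by_cases hn : D.countSA k h s a = 0
    · have h1 := M.meanReward_le_one h s a
      have h2 := M.meanReward_nonneg h s a
      have h3 : D.empReward k h s a = 0 := by rw [empReward, hn]; simp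
      rw [h3, zero_sub, abs_neg, abs_of_nonneg h2, hn]
      refine h1.trans (Real.one_le_sqrt.2 ?_)
      simpa using hL
    · rw [max_eq_left (by exact_mod_cast Nat.one_le_iff_ne_zero.2 hn)]
      exact hD.reward h s a hn
  · have h1 := M.meanReward_le_one h s a
    have h2 := M.meanReward_nonneg h s a
    have h3 := hD.empReward_mem h s a
    rw [abs_le]; constructor <;> linarith [h3.1, h3.2]

theorem meanReward_le (h : Fin H) (s : S) (a : A) :
    M.meanReward h s a ≤ D.empReward k h s a + D.rewardBonus δ k h s a := by
  have := hD.abs_empReward_sub_le hL h s a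
  linarith [(abs_le.1 this).1]

theorem empReward_add_bonus_le (h : Fin H) (s : S) (a : A) :
    D.empReward k h s a + D.rewardBonus δ k h s a ≤
      M.meanReward h s a + 2 * D.rewardBonus δ k h s a := by
  have := hD.abs_empReward_sub_le hL h s a
  linarith [(abs_le.1 this).2]

theorem bellmanLookahead_le_of_succ {h : Fin H} {s : S}
    (hopt : ∀ s', M.bellman (h + 1) s' ≤ D.optimisticValue δ k (h + 1) s') (v : A → S) :
    M.bellmanLookahead h s v ≤ D.optLookahead δ k h s v :=
  Finset.sup'_mono_fun fun a _ => add_le_add (hD.meanReward_le hL h s a) (hopt _)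

/-- Optimism. -/
theorem bellman_le_optimisticValue (h : ℕ) :
    ∀ s, M.bellman h s ≤ D.optimisticValue δ k h s := by
  induction h using backward_induction (H := H) with
  | top h hh => intro s; rw [M.bellman_of_le hh, D.optimisticValue_of_le δ k hh]
  | step h hh ih =>
    intro s
    by_cases hn : D.count k ⟨h, hh⟩ s = 0
    · rw [D.optimisticValue_of_count_eq_zero (h := ⟨h, hh⟩) δ k hn]; exact M.bellman_le _ _
    rw [D.optimisticValue_of_count_ne_zero (h := ⟨h, hh⟩) δ k hn]
    refine le_min ?_ (M.bellman_le _ _)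
    have hE := D.isMean_empMean hn
    set t : Fin H := ⟨h, hh⟩
    have hQ0 := M.bellmanLookahead_nonneg t s
    have hQH := M.bellmanLookahead_le t s
    have hQW := hD.bellmanLookahead_le_of_succ hL (h := t) (s := s) ih
    set τ := logFactor S A H δ k / D.count k t s with hτdef
    have hτ : 0 ≤ τ := by positivity
    -- Although Q* ≤ H, the bound `B = 3H` is used: it makes `t * B` equal to the additive term
    -- 400/3 · Hτ of the algorithm's bonus.
    have hmono := hE.add_bonus_mono (B := 3 * (H : ℝ)) (t := (20 / 3) ^ 2 * τ) (by positivity)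
      (by positivity) hQ0 hQW (fun v => (hQH v).trans
        (by linarith [Nat.cast_nonneg (α := ℝ) H]))
    have hvar := hD.var_lower t s hn
    rw [hE.sq_sub_const] at hvar
    have hdom := bonus_dominates_deviation (q := M.bellman t s)
      (q' := D.empMean k t s (M.bellmanLookahead t s))
      (V := M.nextVar t s (M.bellmanLookahead t s))
      (V' := D.empMean k t s (fun v => M.bellmanLookahead t s v ^ 2) -
        D.empMean k t s (M.bellmanLookahead t s) ^ 2) (τ := τ) (H := H) (by positivity) hτ
      MDP.nextVar_nonneg (hE.variance_nonneg _) (M.bellman_le _ _) (hE.nonneg hQ0)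
      (by rw [M.bellman_of_lt]; linarith [(abs_le.1 (hD.mean t s hn)).1])
      (by rw [M.bellman_of_lt]; exact hvar)
    rw [D.transBonus_eq δ k hn, ← hτdef]
    -- The chain is Q* under P, Q* under E with bonus, W under E with bonus; finally the maximum of
    -- the two bonus terms is below their sum.
    refine hdom.trans (hmono.trans (add_le_add le_rfl ?_))
    have hs : ∀ x, √((20 / 3) ^ 2 * τ * x) = 20 / 3 * √(x * τ) := fun x => by
      rw [mul_assoc, Real.sqrt_mul (by positivity), Real.sqrt_sq (by norm_num), mul_comm τ]
    rw [hs]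
    have h1 := Real.sqrt_nonneg ((D.empMean k t s (fun v => D.optLookahead δ k t s v ^ 2) -
        D.empMean k t s (D.optLookahead δ k t s) ^ 2) * τ)
    have h2 : (20 / 3 : ℝ) ^ 2 * τ * (3 * H) = 400 / 3 * (H * τ) := by ring
    rw [h2]
    refine max_le ?_ ?_
    · have : 0 ≤ (H : ℝ) * τ := by positivity
      linarith
    · linarith

theorem bellmanLookahead_le_optLookahead (h : Fin H) (s : S) (v : A → S) :
    M.bellmanLookahead h s v ≤ D.optLookahead δ k h s v :=
  hD.bellmanLookahead_le_of_succ hL (hD.bellman_le_optimisticValue hL _) v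

theorem optLookahead_le (h : Fin H) (s : S) (v : A → S) :
    D.optLookahead δ k h s v ≤ 3 * H := by
  unfold optLookahead lookaheadValue
  refine Finset.sup'_le _ _ fun a _ => ?_
  have h1 := (hD.empReward_mem h s a).2
  have h2 : D.rewardBonus δ k h s a ≤ 1 := min_le_right _ _
  have h3 := D.optimisticValue_le δ k (h + 1) (v a)
  have h4 : (1 : ℝ) ≤ H := by exact_mod_cast (Nat.zero_le _).trans_lt h.2
  rw [score]
  linarith

/-- Since W depends on the data, no concentration inequality applies to it directly. Its level sets
relative to Q*, however, belong to the finite family of `HitsAvoids`, over which the accuracy of the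
data is uniform. -/
theorem empMean_gap_le {h : Fin H} {s : S} (hn : D.count k h s ≠ 0) :
    D.empMean k h s (D.optLookahead δ k h s) - D.empMean k h s (M.bellmanLookahead h s) ≤
      (1 + 1 / (4 * (H : ℝ))) * (M.nextMean h s (D.optLookahead δ k h s) -
        M.nextMean h s (M.bellmanLookahead h s)) +
      4 * H * (largeLogFactor S A H δ k / D.count k h s) * (3 * H) := by
  classical
  set q : A → S → ℝ := fun a s' => M.meanReward h s a + M.bellman (h + 1) s' with hq
  set w : A → S → ℝ := fun a s' => D.score δ k h (D.optimisticValue δ k (h + 1)) s s' a with hw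
  -- A maximum over actions exceeds `x` iff some pair `(a, v a)` has value above `x`, and is at most
  -- `x` iff no such pair exists.
  have hset : ∀ (x : ℝ) (v : A → S),
      (M.bellmanLookahead h s v ≤ x ∧ x < D.optLookahead δ k h s v) ↔
      HitsAvoids (Finset.univ.filter fun p : A × S => x < w p.1 p.2)
        (Finset.univ.filter fun p : A × S => x < q p.1 p.2) v := by
    intro x v
    simp only [HitsAvoids, Finset.mem_filter, Finset.mem_univ, true_and, not_lt,
      MDP.bellmanLookahead, optLookahead, lookaheadValue, Finset.sup'_le_iff, Finset.lt_sup'_iff,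
      forall_const]
    exact and_comm
  have key := sum_mul_sub_le_of_level_sets
    ((Finset.range k).filter (fun j => (D j h).state = s)) Finset.univ
    (fun _ => 1 / (D.count k h s : ℝ)) (fun j => M.bellmanLookahead h s (D j h).next)
    (fun j => D.optLookahead δ k h s (D j h).next)
    (fun v => (M.trans h s v).toReal) (M.bellmanLookahead h s) (D.optLookahead δ k h s)
    (a := 1 + 1 / (4 * (H : ℝ))) (b := 4 * H * (largeLogFactor S A H δ k / D.count k h s))
    (B := 3 * H) (by positivity) (fun j => M.bellmanLookahead_nonneg h s _)
    (fun j => hD.bellmanLookahead_le_optLookahead hL h s _)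
    (fun j => hD.optLookahead_le hL h s _) (fun j => M.bellmanLookahead_nonneg h s _)
    (fun j => hD.bellmanLookahead_le_optLookahead hL h s _)
    (fun j => hD.optLookahead_le hL h s _) ?_
  · rw [← Finset.mul_sum, one_div, ← div_eq_inv_mul] at key
    rw [← (D.isMean_empMean hn).sub, ← MDP.nextMean_sub]
    exact key
  · intro x
    simp only [hset]
    rw [← Finset.mul_sum, one_div, ← div_eq_inv_mul]
    exact hD.hits h s _ _ hn

variable {π : DetPolicy S A H} (hπ : D.IsGreedy δ k π)
include hπ

/-- Greediness replaces the maximum in W by the score of the action that π plays. Both values then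
continue from the same next state, and only the reward bonus, counted twice, remains. -/
theorem optLookahead_sub_le (h : Fin H) (s : S) (v : A → S) :
    D.optLookahead δ k h s v - M.policyLookahead π h s v ≤
      2 * D.rewardBonus δ k h s (π h s v) +
        (D.optimisticValue δ k (h + 1) (v (π h s v)) -
          M.cumulative π (M.policyReward π) (h + 1) (v (π h s v))) := by
  have h1 : D.optLookahead δ k h s v ≤
      D.score δ k h (D.optimisticValue δ k (h + 1)) s (v (π h s v)) (π h s v) := by
    unfold optLookahead lookaheadValue
    exact Finset.sup'_le _ _ fun a _ => hπ h s v a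
  have h2 := hD.empReward_add_bonus_le hL h s (π h s v)
  rw [score] at h1
  rw [MDP.policyLookahead]
  linarith

/-- One step of the recursion for the gap between the optimistic values and those of the policy. -/
theorem gap_le (h : Fin H) (s : S) :
    D.optimisticValue δ k h s - M.cumulative π (M.policyReward π) h s ≤
      (1 + 1 / (H : ℝ)) * M.nextMean h s (fun v => D.optLookahead δ k h s v -
        M.policyLookahead π h s v) +
      22 * √(M.nextVar h s (M.policyLookahead π h s) *
        (logFactor S A H δ k / max (D.count k h s : ℝ) 1)) +
      1000 * ((H : ℝ) ^ 2 * (largeLogFactor S A H δ k / max (D.count k h s : ℝ) 1)) := by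
  have hH : (1 : ℝ) ≤ H := by exact_mod_cast (Nat.zero_le _).trans_lt h.2
  have hLL := logFactor_le_largeLogFactor (S := S) (A := A) (H := H) δ k
  have hVQ := fun v => M.policyLookahead_le_bellmanLookahead π h s v
  have hQW := fun v => hD.bellmanLookahead_le_optLookahead hL h s v
  have hg0 : 0 ≤ M.nextMean h s (fun v => D.optLookahead δ k h s v -
        M.policyLookahead π h s v) :=
    MDP.nextMean_nonneg fun v => sub_nonneg.2 ((hVQ v).trans (hQW v))
  -- Without data the optimistic value is `H`, which the last term dominates because its denominator
  -- is then 1.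
  by_cases hn : D.count k h s = 0
  · rw [D.optimisticValue_of_count_eq_zero δ k hn, hn]
    have h1 : 0 ≤ M.cumulative π (M.policyReward π) h s :=
      MDP.cumulative_nonneg (fun _ _ _ => M.meanReward_nonneg _ _ _) _ _
    have h2 : (H : ℝ) ≤ (H : ℝ) ^ 2 * largeLogFactor S A H δ k := by nlinarith
    simp only [Nat.cast_zero, zero_le_one, max_eq_right, div_one]
    have h3 : 0 ≤ (1 + 1 / (H : ℝ)) * M.nextMean h s (fun v => D.optLookahead δ k h s v -
        M.policyLookahead π h s v) := by positivity
    have h4 := Real.sqrt_nonneg (M.nextVar h s (M.policyLookahead π h s) * logFactor S A H δ k)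
    nlinarith
  rw [D.max_count k hn]
  have hnpos : (0 : ℝ) < D.count k h s := by exact_mod_cast Nat.pos_of_ne_zero hn
  have hE := D.isMean_empMean hn
  have hP := M.isMean_nextMean h s
  refine gap_le_of_deviations (Pq := M.nextMean h s (M.bellmanLookahead h s))
    (Eq := D.empMean k h s (M.bellmanLookahead h s))
    (Pw := M.nextMean h s (D.optLookahead δ k h s))
    (Ew := D.empMean k h s (D.optLookahead δ k h s))
    (V := M.nextVar h s (M.bellmanLookahead h s))
    (Vw := D.empMean k h s (fun v => D.optLookahead δ k h s v ^ 2) -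
        D.empMean k h s (D.optLookahead δ k h s) ^ 2)
    (Vq := D.empMean k h s (fun v => M.bellmanLookahead h s v ^ 2) -
        D.empMean k h s (M.bellmanLookahead h s) ^ 2)
    hH (by positivity) (by gcongr) MDP.nextVar_nonneg ?_ hg0 ?_ ?_ (hD.empMean_gap_le hL hn)
    ?_ ?_ ?_ ?_
  · rw [M.cumulative_eq_nextMean, ← MDP.nextMean_sub]
  · rw [← MDP.nextMean_sub]
    exact MDP.nextMean_mono fun v => sub_le_sub le_rfl (hVQ v)
  · linarith [(abs_le.1 (hD.mean h s hn)).2]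
  -- As 0 ≤ Q* - Q^π ≤ H and Q* ≤ W, the squared difference is at most H (W - Q^π).
  · refine (MDP.nextVar_add_le _ (M.policyLookahead π h s)).trans (add_le_add le_rfl ?_)
    refine mul_le_mul_of_nonneg_left ?_ (by norm_num)
    rw [← MDP.nextMean_const_mul]
    refine MDP.nextMean_mono fun v => ?_
    have h1 := M.bellmanLookahead_le h s v
    have h2 := M.policyLookahead_nonneg π h s v
    rw [sq]
    refine mul_le_mul (by linarith) (sub_le_sub (hQW v) le_rfl) (sub_nonneg.2 (hVQ v))
      (by positivity)
  · refine (hE.variance_add_le _ (M.bellmanLookahead h s)).trans (add_le_add le_rfl ?_)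
    refine mul_le_mul_of_nonneg_left ?_ (by norm_num)
    rw [← hE.sub, ← hE.const_mul]
    refine hE.mono _ _ fun v => ?_
    have h1 := hD.optLookahead_le hL h s v
    have h2 := M.bellmanLookahead_nonneg h s v
    rw [sq]
    exact mul_le_mul_of_nonneg_right (by linarith) (sub_nonneg.2 (hQW v))
  · have h1 := hD.var_upper h s hn
    rw [hE.sq_sub_const] at h1
    linarith [sq_nonneg (D.empMean k h s (M.bellmanLookahead h s) -
      M.nextMean h s (M.bellmanLookahead h s))]
  · rw [D.optimisticValue_of_count_ne_zero δ k hn, ← D.transBonus_eq δ k hn]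
    exact min_le_left _ _

/-- The gap is at most a constant times the expected sum of the bonuses along the policy. -/
theorem gap_le_cumulative (s : S) :
    M.bellman 0 s - M.cumulative π (M.policyReward π) 0 s ≤
      3 * M.cumulative π (fun h s v => 4 * D.rewardBonus δ k h s (π h s v) +
        (22 * √(M.nextVar h s (M.policyLookahead π h s) *
        (logFactor S A H δ k / max (D.count k h s : ℝ) 1)) +
        1000 * ((H : ℝ) ^ 2 * (largeLogFactor S A H δ k / max (D.count k h s : ℝ) 1)))) 0 s := by
  set ρ : Fin H → S → (A → S) → ℝ := fun h s v => 4 * D.rewardBonus δ k h s (π h s v) +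
        (22 * √(M.nextVar h s (M.policyLookahead π h s) *
        (logFactor S A H δ k / max (D.count k h s : ℝ) 1)) +
        1000 * ((H : ℝ) ^ 2 * (largeLogFactor S A H δ k / max (D.count k h s : ℝ) 1))) with hρ
  have hLL := logFactor_le_largeLogFactor (S := S) (A := A) (H := H) δ k
  have hL0 : 0 ≤ largeLogFactor S A H δ k := by linarith
  have hρ0 : ∀ h s v, 0 ≤ ρ h s v := fun h s v => by
    have := D.rewardBonus_nonneg δ k h s (π h s v)
    simp only [hρ]; positivity
  -- The factor 1 + 1/H of each step is carried as a power; at `h = 0` it is at most e ≤ 3.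
  have key : ∀ h, ∀ s, D.optimisticValue δ k h s - M.cumulative π (M.policyReward π) h s ≤
      (1 + 1 / (H : ℝ)) ^ (H - h) * M.cumulative π ρ h s := by
    intro h
    induction h using backward_induction (H := H) with
    | top h hh =>
      intro s
      simp [D.optimisticValue_of_le δ k hh, M.cumulative_of_le _ _ hh]
    | step h hh ih =>
      intro s
      have hH : (1 : ℝ) ≤ H := by exact_mod_cast (Nat.zero_le _).trans_lt hh
      set t : Fin H := ⟨h, hh⟩
      have hinv : 1 / (H : ℝ) ≤ 1 := by rw [div_le_one (by positivity)]; exact hH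
      have hinv0 : 0 ≤ 1 / (H : ℝ) := by positivity
      have hpow : (1 : ℝ) ≤ (1 + 1 / (H : ℝ)) ^ (H - h) := one_le_pow₀ (by linarith)
      have hpow' : (1 + 1 / (H : ℝ)) ^ (H - h) =
          (1 + 1 / (H : ℝ)) * (1 + 1 / (H : ℝ)) ^ (H - (h + 1)) := by
        rw [← pow_succ']; congr 1; omega
      have h1 := hD.gap_le hL hπ t s
      rw [M.cumulative_of_lt π ρ t, ← MDP.nextMean_const_mul]
      refine h1.trans ?_
      rw [← MDP.nextMean_const_mul, add_assoc]
      set c := 22 * √(M.nextVar t s (M.policyLookahead π t s) *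
        (logFactor S A H δ k / max (D.count k t s : ℝ) 1)) +
        1000 * ((H : ℝ) ^ 2 * (largeLogFactor S A H δ k / max (D.count k t s : ℝ) 1)) with hc
      rw [← M.nextMean_const t s c, ← MDP.nextMean_add]
      refine MDP.nextMean_mono fun v => ?_
      have h2 := hD.optLookahead_sub_le hL hπ t s v
      have h3 := ih (v (π t s v))
      have hb := D.rewardBonus_nonneg δ k t s (π t s v)
      have h4 : ρ t s v = 4 * D.rewardBonus δ k t s (π t s v) + c := rfl
      have h5 := hρ0 t s v
      have h6 : ρ t s v ≤ (1 + 1 / (H : ℝ)) ^ (H - h) * ρ t s v :=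
        le_mul_of_one_le_left h5 hpow
      have h7 : (1 + 1 / (H : ℝ)) * (D.optLookahead δ k t s v - M.policyLookahead π t s v) ≤
          (1 + 1 / (H : ℝ)) * (2 * D.rewardBonus δ k t s (π t s v) +
          (1 + 1 / (H : ℝ)) ^ (H - (h + 1)) * M.cumulative π ρ (h + 1) (v (π t s v))) :=
        mul_le_mul_of_nonneg_left (h2.trans (add_le_add le_rfl h3)) (by positivity)
      -- This is why `ρ` contains four reward bonuses: the two of the recursion are multiplied by 1
      -- + 1/H ≤ 2.
      have h8 : 1 / (H : ℝ) * D.rewardBonus δ k t s (π t s v) ≤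
          D.rewardBonus δ k t s (π t s v) := mul_le_of_le_one_left hb hinv
      have h9 : (1 + 1 / (H : ℝ)) ^ (H - h) * M.cumulative π ρ (h + 1) (v (π t s v)) =
          (1 + 1 / (H : ℝ)) * ((1 + 1 / (H : ℝ)) ^ (H - (h + 1)) *
            M.cumulative π ρ (h + 1) (v (π t s v))) := by rw [hpow']; ring
      have e : ((t : ℕ) + 1) = h + 1 := rfl
      rw [e]
      rw [mul_add ((1 + 1 / (H : ℝ)) ^ (H - h)), h9]
      linarith
  have h1 := key 0 s
  have h2 := hD.bellman_le_optimisticValue hL 0 s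
  have h3 := MDP.cumulative_nonneg (M := M) (π := π) hρ0 0 s
  have h4 : (1 + 1 / (H : ℝ)) ^ (H - 0) ≤ 3 := by
    rcases Nat.eq_zero_or_pos H with h0 | h0
    · subst h0; norm_num
    have h5 : 1 + 1 / (H : ℝ) ≤ Real.exp (1 / H) := by
      linarith [Real.add_one_le_exp (1 / (H : ℝ))]
    calc _ ≤ Real.exp (1 / H) ^ H := pow_le_pow_left₀ (by positivity) h5 _
      _ = Real.exp 1 := by
        rw [← Real.exp_nat_mul]; congr 1; field_simp
      _ ≤ 3 := by linarith [Real.exp_one_lt_d9]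
  linarith [mul_le_mul_of_nonneg_right h4 h3]

end IsAccurate

end Data

/-! ### The data are accurate with high probability. -/

theorem sum_range_inv_mul_succ_le (n : ℕ) :
    ∑ k ∈ Finset.range n, 1 / (((k : ℝ) + 1) * ((k : ℝ) + 2)) ≤ 1 := by
  have : ∀ n : ℕ, ∑ k ∈ Finset.range n, 1 / (((k : ℝ) + 1) * ((k : ℝ) + 2)) =
      1 - 1 / ((n : ℝ) + 1) := by
    intro n
    induction n with
    | zero => simp
    | succ n ih =>
      rw [Finset.sum_range_succ, ih]; push_cast; field_simp; ring
  rw [this]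
  have : 0 ≤ 1 / ((n : ℝ) + 1) := by positivity
  linarith

theorem le_of_forall_sign {x b : ℝ} (h : ∀ e : Bool, (if e then (1 : ℝ) else -1) * x ≤ b) :
    |x| ≤ b := by
  have h1 := h true
  have h2 := h false
  simp only [if_true, Bool.false_eq_true, if_false] at h1 h2
  exact abs_le.2 ⟨by linarith, by linarith⟩

/-- The exponent parameter is l = min(√(τ/V), 1), written without division by `V`. It gives d ≤ τ/l
+ lV, and both terms are controlled by √τ times the maximum. -/
theorem le_of_bernstein_exponent {d V τ : ℝ} (hV : 0 ≤ V) (hτ : 0 < τ)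
    (h : √τ / max √V √τ * d - (√τ / max √V √τ) ^ 2 * V ≤ τ) : d ≤ 2 * √(V * τ) + 2 * τ := by
  have ht : 0 < √τ := Real.sqrt_pos.2 hτ
  have hm : 0 < max √V √τ := lt_max_of_lt_right ht
  have hm1 := le_max_left √V √τ
  have hm2 : max √V √τ ≤ √V + √τ :=
    max_le (by linarith) (by linarith [Real.sqrt_nonneg V])
  set m := max √V √τ
  have hτ' : τ = √τ * √τ := (Real.mul_self_sqrt hτ.le).symm
  have hV' : V = √V * √V := (Real.mul_self_sqrt hV).symm
  rw [Real.sqrt_mul hV]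
  have h1 : √τ / m * d ≤ √τ / m * (√τ * √V + √τ * m) := by
    have h2 : (√τ / m) ^ 2 * V ≤ √τ / m * (√τ * √V) := by
      have : √V * √V / m ≤ √V := by
        rw [div_le_iff₀ hm]; exact mul_le_mul_of_nonneg_left hm1 (Real.sqrt_nonneg _)
      calc (√τ / m) ^ 2 * V = √τ / m * (√τ * (√V * √V / m)) := by
            rw [← hV']; field_simp
        _ ≤ _ := by gcongr
    have h3 : √τ / m * (√τ * m) = τ := by
      rw [← mul_assoc, div_mul_eq_mul_div, ← hτ', div_mul_cancel₀ _ hm.ne']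
    rw [mul_add, h3]; linarith
  have h4 := le_of_mul_le_mul_left h1 (by positivity)
  have h5 := mul_le_mul_of_nonneg_left hm2 ht.le
  nlinarith

namespace Data

variable {S A : Type*} [Fintype S] [DecidableEq S] [Fintype A] [DecidableEq A] {H : ℕ}

theorem sum_next_eq (D : Data S A H) {k : ℕ} {h : Fin H} {s : S} (hn : D.count k h s ≠ 0)
    (φ : (A → S) → ℝ) :
    ∑ j ∈ (Finset.range k).filter (fun j => (D j h).state = s), φ (D j h).next =
      D.count k h s * D.empMean k h s φ := by
  rw [empMean, mul_div_cancel₀]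
  exact_mod_cast hn

theorem count_le (D : Data S A H) (k : ℕ) (h : Fin H) (s : S) : D.count k h s ≤ k :=
  (Finset.card_filter_le _ _).trans (by simp)

theorem countSA_le (D : Data S A H) (k : ℕ) (h : Fin H) (s : S) (a : A) : D.countSA k h s a ≤ k :=
  (Finset.card_filter_le _ _).trans (by simp)

theorem exp_neg_logFactor [Nonempty S] [Nonempty A] {δ : ℝ} (hH : 1 ≤ H) (h0 : 0 < δ) (k : ℕ) :
    Real.exp (-logFactor S A H δ k) = δ / (16 * (Fintype.card S : ℝ) ^ 3 *
      (Fintype.card A : ℝ) ^ 2 * (H : ℝ) * ((k : ℝ) + 1) ^ 2 * ((k : ℝ) + 2)) := by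
  have hS : (0 : ℝ) < Fintype.card S := by exact_mod_cast Fintype.card_pos
  have hA : (0 : ℝ) < Fintype.card A := by exact_mod_cast Fintype.card_pos
  have hH' : (0 : ℝ) < H := by exact_mod_cast hH
  rw [logFactor, Real.exp_neg, Real.exp_log (by positivity), inv_div]

/-- Union bound over all the episodes. -/
theorem measure_not_forall_le {Ω : Type*} {mΩ : MeasurableSpace Ω} {μ : Measure Ω}
    [Nonempty S] [Nonempty A] {δ : ℝ} (hH : 1 ≤ H) (h0 : 0 < δ) {ι : ℕ → Type*}
    [∀ k, Fintype (ι k)]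
    (hι : ∀ k, Fintype.card (ι k) ≤ 2 * H * Fintype.card S * Fintype.card A * (k + 1))
    {P : ∀ k, ι k → Ω → Prop}
    (hP : ∀ k i, μ {ω | ¬ P k i ω} ≤ ENNReal.ofReal (Real.exp (-logFactor S A H δ k))) :
    μ {ω | ¬ ∀ k i, P k i ω} ≤ ENNReal.ofReal (δ / 8) := by
  have hS : (1 : ℝ) ≤ Fintype.card S := by exact_mod_cast Fintype.card_pos
  have hA : (1 : ℝ) ≤ Fintype.card A := by exact_mod_cast Fintype.card_pos
  have hH' : (1 : ℝ) ≤ H := by exact_mod_cast hH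
  have hset : {ω | ¬ ∀ k i, P k i ω} = ⋃ k, ⋃ i, {ω | ¬ P k i ω} := by
    ext ω; simp
  have hk : ∀ k, μ (⋃ i, {ω | ¬ P k i ω}) ≤
      ENNReal.ofReal (δ / 8 * (1 / (((k : ℝ) + 1) * ((k : ℝ) + 2)))) := by
    intro k
    calc μ (⋃ i, {ω | ¬ P k i ω}) ≤ ∑ i, μ {ω | ¬ P k i ω} := measure_iUnion_fintype_le _ _
      _ ≤ ∑ _i : ι k, ENNReal.ofReal (Real.exp (-logFactor S A H δ k)) :=
          Finset.sum_le_sum fun i _ => hP k i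
      _ = ENNReal.ofReal (Fintype.card (ι k) * Real.exp (-logFactor S A H δ k)) := by
          rw [Finset.sum_const, nsmul_eq_mul, Finset.card_univ,
            ENNReal.ofReal_mul (Nat.cast_nonneg _), ENNReal.ofReal_natCast]
      _ ≤ _ := by
          refine ENNReal.ofReal_le_ofReal ?_
          have hc : (Fintype.card (ι k) : ℝ) ≤
              2 * H * Fintype.card S * Fintype.card A * (k + 1) := by exact_mod_cast hι k
          rw [exp_neg_logFactor hH h0]
          have hk0 : (0 : ℝ) ≤ k := Nat.cast_nonneg k
          -- The cubic factor in the episode number under the logarithm pays for the number of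
          -- indices, linear in `k + 1`, and leaves the telescoping series of 1/((k + 1)(k + 2)).
          calc (Fintype.card (ι k) : ℝ) * (δ / (16 * (Fintype.card S : ℝ) ^ 3 *
                (Fintype.card A : ℝ) ^ 2 * (H : ℝ) * ((k : ℝ) + 1) ^ 2 * ((k : ℝ) + 2)))
              ≤ (2 * H * Fintype.card S * Fintype.card A * (k + 1)) *
                (δ / (16 * (Fintype.card S : ℝ) ^ 3 *
                (Fintype.card A : ℝ) ^ 2 * (H : ℝ) * ((k : ℝ) + 1) ^ 2 * ((k : ℝ) + 2))) := by
                gcongr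
            _ = δ / 8 * (1 / (((k : ℝ) + 1) * ((k : ℝ) + 2))) /
                ((Fintype.card S : ℝ) ^ 2 * (Fintype.card A : ℝ)) := by
                field_simp; ring
            _ ≤ _ := div_le_self (by positivity)
                (one_le_mul_of_one_le_of_one_le (one_le_pow₀ hS) hA)
  rw [hset]
  refine (measure_iUnion_le _).trans ((ENNReal.tsum_le_tsum hk).trans ?_)
  rw [ENNReal.tsum_eq_iSup_nat]
  refine iSup_le fun n => ?_
  rw [← ENNReal.ofReal_sum_of_nonneg fun k _ => by positivity, ← Finset.mul_sum]
  refine ENNReal.ofReal_le_ofReal ?_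
  exact mul_le_of_le_one_right (by positivity) (sum_range_inv_mul_succ_le n)

end Data

theorem MDP.scaled_bellmanLookahead_mem {S A : Type*} [Fintype S]
    [Fintype A] [DecidableEq A] [Nonempty A] {H : ℕ} (hH : 1 ≤ H) (M : MDP S A H) (h : Fin H)
    (s : S) (v : A → S) : 0 ≤ M.bellmanLookahead h s v / H ∧ M.bellmanLookahead h s v / H ≤ 1 := by
  have hH' : (0 : ℝ) < H := by exact_mod_cast hH
  refine ⟨div_nonneg (M.bellmanLookahead_nonneg h s v) hH'.le, ?_⟩
  rw [div_le_one hH']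
  exact M.bellmanLookahead_le h s v

namespace Interaction.InEnvironment

variable {S A Ω : Type*} [Fintype S] [DecidableEq S] [Nonempty S] [Fintype A] [DecidableEq A]
  [Nonempty A] {H : ℕ}
  {M : MDP S A H} {mΩ : MeasurableSpace Ω} {μ : Measure Ω}
  {ℱ : Filtration ℕ mΩ} {I : Interaction S A H Ω} (hI : I.InEnvironment M μ ℱ)
  [IsProbabilityMeasure μ] {δ : ℝ} (hH : 1 ≤ H) (h0 : 0 < δ) (h1 : δ < 1)

include hI hH h0 h1

/-- Hoeffding's bound with parameter ±4√τ, where τ is the logarithmic factor divided by the number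
of visits. The best parameter depends on this random number, hence the union over all its possible
values. -/
theorem measure_reward_le : μ {ω | ¬ ∀ k h s a, (I.data ω).countSA k h s a ≠ 0 →
    |(I.data ω).empReward k h s a - M.meanReward h s a| ≤
    √(Data.logFactor S A H δ k / (I.data ω).countSA k h s a)} ≤ ENNReal.ofReal (δ / 8) := by
  set τ : ℕ → ℕ → ℝ := fun k m => Data.logFactor S A H δ k / (m + 1 : ℕ)
  -- The index `m` stands for `m + 1` visits, and `e` for the sign. With this parameter the exponent
  -- reads 4√τ d - 2τ < τ, so that d < (3/4)√τ.
  set l : ℕ → ℕ → Bool → ℝ := fun k m e => 4 * √(τ k m) * (if e then (1 : ℝ) else -1)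
  have hU := Data.measure_not_forall_le (S := S) (A := A) (μ := μ) hH h0
    (ι := fun k => Fin H × S × A × Fin k × Bool)
    (P := fun k i ω => ∑ j ∈ (Finset.range k).filter (fun j =>
        (I.data ω j i.1).state = i.2.1 ∧ (I.data ω j i.1).action = i.2.2.1),
      (l k i.2.2.2.1 i.2.2.2.2 * ((I.data ω j i.1).reward - M.meanReward i.1 i.2.1 i.2.2.1) -
        l k i.2.2.2.1 i.2.2.2.2 ^ 2 / 8) < Data.logFactor S A H δ k) ?_ ?_
  · refine le_trans (measure_mono fun ω hω => ?_) hU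
    rw [Set.mem_ofPred_eq] at hω ⊢
    intro hgood
    refine hω fun k h s a hn => ?_
    have hL := Data.one_le_logFactor (S := S) (A := A) hH h0 h1 k
    obtain ⟨m, hm⟩ := Nat.exists_eq_succ_of_ne_zero hn
    have hmk : m < k := by have := (I.data ω).countSA_le k h s a; omega
    have hnpos : (0 : ℝ) < (m + 1 : ℕ) := by positivity
    rw [hm]
    refine le_of_forall_sign fun e => ?_
    have hg := hgood k (h, s, a, ⟨m, hmk⟩, e)
    simp only [Finset.sum_sub_distrib, Finset.sum_const, ← Finset.mul_sum] at hg
    have hcard : ((Finset.range k).filter (fun j =>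
        (I.data ω j h).state = s ∧ (I.data ω j h).action = a)).card = m + 1 := hm
    have hsum : ∑ j ∈ (Finset.range k).filter (fun j =>
        (I.data ω j h).state = s ∧ (I.data ω j h).action = a), (I.data ω j h).reward =
        (m + 1 : ℕ) * (I.data ω).empReward k h s a := by
      rw [Data.empReward, hm, mul_div_cancel₀ _ hnpos.ne']
    rw [hsum, hcard, nsmul_eq_mul, nsmul_eq_mul] at hg
    have hLt : Data.logFactor S A H δ k = (m + 1 : ℕ) * τ k m := by
      simp only [τ]; rw [mul_div_cancel₀ _ hnpos.ne']
    have hτ : 0 < τ k m := by simp only [τ]; positivity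
    have he : (if e then (1 : ℝ) else -1) ^ 2 = 1 := by cases e <;> norm_num
    rw [hLt] at hg
    have hg2 : (m + 1 : ℕ) * (l k m e * ((I.data ω).empReward k h s a - M.meanReward h s a) -
        l k m e ^ 2 / 8) < (m + 1 : ℕ) * τ k m := by
      refine lt_of_eq_of_lt ?_ hg; ring
    have hg3 := lt_of_mul_lt_mul_left hg2 hnpos.le
    have hsq : l k m e ^ 2 = 16 * τ k m := by
      simp only [l]
      rw [mul_pow, mul_pow, he, Real.sq_sqrt hτ.le]; ring
    rw [hsq] at hg3
    change _ ≤ √(τ k m)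
    have ht := Real.sqrt_pos.2 hτ
    have hτ2 := Real.mul_self_sqrt hτ.le
    have hg4 : √(τ k m) * (4 * ((if e then (1 : ℝ) else -1) *
        ((I.data ω).empReward k h s a - M.meanReward h s a))) ≤ √(τ k m) * (4 * √(τ k m)) := by
      have : l k m e * ((I.data ω).empReward k h s a - M.meanReward h s a) = √(τ k m) * (4 *
        ((if e then (1 : ℝ) else -1) *
          ((I.data ω).empReward k h s a - M.meanReward h s a))) := by
        simp only [l]; ring
      rw [this] at hg3
      nlinarith
    linarith [le_of_mul_le_mul_left hg4 ht]
  · intro k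
    simp only [Fintype.card_prod, Fintype.card_fin, Fintype.card_bool]
    have : H * (Fintype.card S * (Fintype.card A * (k * 2))) =
      2 * H * Fintype.card S * Fintype.card A * k := by ring
    rw [this]
    exact Nat.mul_le_mul_left _ (by omega)
  · rintro k ⟨h, s, a, m, e⟩
    simp only [not_lt]
    exact hI.measure_reward_sum_ge_le h s a
      (φ := fun x => l k m e * (x - M.meanReward h s a) - l k m e ^ 2 / 8) (by fun_prop)
      (M.lintegral_exp_reward_le_one h s a (l k m e)) k _

/-- Bernstein's inequality for the fixed function Q*/H with values in `[0, 1]`. Again the parameter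
depends on the number of visits, over which a union is taken. -/
theorem measure_mean_le : μ {ω | ¬ ∀ k h s, (I.data ω).count k h s ≠ 0 →
    |(I.data ω).empMean k h s (M.bellmanLookahead h s) -
        M.nextMean h s (M.bellmanLookahead h s)| ≤
      2 * √(M.nextVar h s (M.bellmanLookahead h s) *
        (Data.logFactor S A H δ k / (I.data ω).count k h s)) +
      2 * (H * (Data.logFactor S A H δ k / (I.data ω).count k h s))} ≤
      ENNReal.ofReal (δ / 8) := by
  have hH' : (0 : ℝ) < H := by exact_mod_cast hH
  set f : Fin H → S → (A → S) → ℝ := fun h s v => M.bellmanLookahead h s v / H with hf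
  set V : Fin H → S → ℝ := fun h s => M.nextMean h s
    (fun v => (f h s v - M.nextMean h s (f h s)) ^ 2) with hV
  have hV0 : ∀ h s, 0 ≤ V h s := fun h s => MDP.nextMean_nonneg fun v => sq_nonneg _
  set τ : ℕ → ℕ → ℝ := fun k m => Data.logFactor S A H δ k / (m + 1 : ℕ) with hτdef
  have hτ : ∀ k m, 0 < τ k m := fun k m => by
    have hL := Data.one_le_logFactor (S := S) (A := A) hH h0 h1 k
    simp only [τ]; positivity
  set l : Fin H → S → ℕ → ℕ → Bool → ℝ := fun h s k m e =>
    √(τ k m) / max √(V h s) √(τ k m) * (if e then (1 : ℝ) else -1) with hl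
  have hl2 : ∀ h s k m e, l h s k m e ^ 2 = (√(τ k m) / max √(V h s) √(τ k m)) ^ 2 := by
    intro h s k m e
    have he : (if e then (1 : ℝ) else -1) ^ 2 = 1 := by cases e <;> norm_num
    simp only [l]; rw [mul_pow, he, mul_one]
  set φ : Fin H → S → ℕ → ℕ → Bool → (A → S) → ℝ := fun h s k m e v =>
    l h s k m e * (f h s v - M.nextMean h s (f h s)) - l h s k m e ^ 2 * V h s with hφ
  have hU := Data.measure_not_forall_le (S := S) (A := A) (μ := μ) hH h0
    (ι := fun k => Fin H × S × Fin k × Bool)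
    (P := fun k i ω => ∑ j ∈ (Finset.range k).filter (fun j => (I.data ω j i.1).state = i.2.1),
      φ i.1 i.2.1 k i.2.2.1 i.2.2.2 (I.data ω j i.1).next
      < Data.logFactor S A H δ k) ?_ ?_
  · refine le_trans (measure_mono fun ω hω => ?_) hU
    rw [Set.mem_ofPred_eq] at hω ⊢
    intro hgood
    refine hω fun k h s hn => ?_
    obtain ⟨m, hm⟩ := Nat.exists_eq_succ_of_ne_zero hn
    have hmk : m < k := by have := (I.data ω).count_le k h s; omega
    have hnpos : (0 : ℝ) < (m + 1 : ℕ) := by positivity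
    have hE := (I.data ω).isMean_empMean hn
    rw [hm]
    refine le_of_forall_sign fun e => ?_
    have hg := hgood k (h, s, ⟨m, hmk⟩, e)
    rw [Data.sum_next_eq _ hn, hm, hE.sub, hE.const, hE.const_mul, hE.sub, hE.const] at hg
    dsimp only at hg
    have hLt : Data.logFactor S A H δ k = (m + 1 : ℕ) * τ k m := by
      simp only [τ]; rw [mul_div_cancel₀ _ hnpos.ne']
    rw [hLt] at hg
    have hg3 := (lt_of_mul_lt_mul_left hg hnpos.le).le
    simp only [hl2] at hg3
    have hfm : ∀ {E : ((A → S) → ℝ) → ℝ}, IsMean E → E (f h s) =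
        E (M.bellmanLookahead h s) / H := fun {E} hE => by
      rw [div_eq_inv_mul, ← hE.const_mul]; congr 1; funext v; simp only [f]; ring
    have hfV : V h s = M.nextVar h s (M.bellmanLookahead h s) / (H : ℝ) ^ 2 := by
      simp only [V]
      rw [hfm (M.isMean_nextMean h s), MDP.nextVar, div_eq_inv_mul _ ((H : ℝ) ^ 2),
        ← MDP.nextMean_const_mul M h s (((H : ℝ) ^ 2)⁻¹)]
      congr 1; funext v; simp only [f]; field_simp
    have hb := le_of_bernstein_exponent (d := (if e then (1 : ℝ) else -1) *
      ((I.data ω).empMean k h s (f h s) - M.nextMean h s (f h s))) (hV0 h s) (hτ k m)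
      (by refine le_of_eq_of_le ?_ hg3; simp only [l]; ring)
    rw [hfm hE, hfm (M.isMean_nextMean h s), hfV] at hb
    have hs : √(M.nextVar h s (M.bellmanLookahead h s) / (H : ℝ) ^ 2 * τ k m) =
        √(M.nextVar h s (M.bellmanLookahead h s) * τ k m) / H := by
      rw [div_mul_eq_mul_div, Real.sqrt_div' _ (by positivity), Real.sqrt_sq hH'.le]
    rw [hs] at hb
    have hb2 := mul_le_mul_of_nonneg_left hb hH'.le
    change _ ≤ 2 * √(_ * τ k m) + 2 * (H * τ k m)
    refine le_of_eq_of_le ?_ (hb2.trans_eq ?_)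
    · field_simp
    · field_simp
  · intro k
    simp only [Fintype.card_prod, Fintype.card_fin, Fintype.card_bool]
    calc H * (Fintype.card S * (k * 2)) = 2 * H * Fintype.card S * 1 * k := by ring
      _ ≤ _ := Nat.mul_le_mul (Nat.mul_le_mul_left _ Fintype.card_pos) (by omega)
  · rintro k ⟨h, s, m, e⟩
    simp only [not_lt]
    refine hI.measure_next_sum_ge_le h s
      (φ := φ h s k m e) ?_ k _
    refine (M.isMean_nextMean h s).exp_bernstein
      (fun v => (M.scaled_bellmanLookahead_mem hH h s v).1)
      (fun v => (M.scaled_bellmanLookahead_mem hH h s v).2) ?_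
    rw [← Real.sqrt_one, ← Real.sqrt_sq_eq_abs]
    refine Real.sqrt_le_sqrt ?_
    rw [hl2]
    refine pow_le_one₀ (by positivity) (div_le_one_of_le₀ (le_max_right _ _) (by positivity))

/-- The squared deviation of Q* from its true mean, divided by H², is a fixed function into `[0,
1]`; the two relative bounds apply to it. Their parameters are constants, so no union over visit
counts is needed. -/
theorem measure_var_le : μ {ω | ¬ ∀ k h s, (I.data ω).count k h s ≠ 0 →
    (I.data ω).empMean k h s (fun v =>
      (M.bellmanLookahead h s v - M.nextMean h s (M.bellmanLookahead h s)) ^ 2) ≤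
      2 * M.nextVar h s (M.bellmanLookahead h s) +
        (H : ℝ) ^ 2 * (Data.logFactor S A H δ k / (I.data ω).count k h s) ∧
    M.nextVar h s (M.bellmanLookahead h s) ≤ 2 * (I.data ω).empMean k h s (fun v =>
      (M.bellmanLookahead h s v - M.nextMean h s (M.bellmanLookahead h s)) ^ 2) +
        2 * ((H : ℝ) ^ 2 * (Data.logFactor S A H δ k / (I.data ω).count k h s))} ≤
      ENNReal.ofReal (δ / 8) := by
  have hH' : (0 : ℝ) < H := by exact_mod_cast hH
  set g : Fin H → S → (A → S) → ℝ := fun h s v =>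
    (M.bellmanLookahead h s v - M.nextMean h s (M.bellmanLookahead h s)) ^ 2 / (H : ℝ) ^ 2 with hg
  have hg0 : ∀ h s v, 0 ≤ g h s v := fun h s v => by simp only [g]; positivity
  have hg1 : ∀ h s v, g h s v ≤ 1 := fun h s v => by
    simp only [g]
    rw [div_le_one (by positivity), sq_le_sq, abs_of_pos hH', abs_le]
    have e1 := M.bellmanLookahead_nonneg h s v
    have e2 := M.bellmanLookahead_le h s v
    have e3 := (M.isMean_nextMean h s).nonneg (M.bellmanLookahead_nonneg h s)
    have e4 := (M.isMean_nextMean h s).le_const (M.bellmanLookahead_le h s)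
    constructor <;> linarith
  set φ : Fin H → S → Bool → (A → S) → ℝ := fun h s e v =>
    if e then 1 * g h s v - (1 + 1 ^ 2) * M.nextMean h s (g h s)
      else M.nextMean h s (g h s) / 2 - g h s v with hφ
  have hU := Data.measure_not_forall_le (S := S) (A := A) (μ := μ) hH h0
    (ι := fun _ => Fin H × S × Bool)
    (P := fun k i ω => ∑ j ∈ (Finset.range k).filter (fun j => (I.data ω j i.1).state = i.2.1),
      φ i.1 i.2.1 i.2.2 (I.data ω j i.1).next < Data.logFactor S A H δ k) ?_ ?_
  · refine le_trans (measure_mono fun ω hω => ?_) hU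
    rw [Set.mem_ofPred_eq] at hω ⊢
    intro hgood
    refine hω fun k h s hn => ?_
    have hnpos : (0 : ℝ) < (I.data ω).count k h s := by exact_mod_cast Nat.pos_of_ne_zero hn
    have hE := (I.data ω).isMean_empMean hn
    have hgm : ∀ {E : ((A → S) → ℝ) → ℝ}, IsMean E → E (g h s) = E (fun v =>
        (M.bellmanLookahead h s v - M.nextMean h s (M.bellmanLookahead h s)) ^ 2) / (H : ℝ) ^ 2 :=
      fun {E} hE => by
      rw [div_eq_inv_mul, ← hE.const_mul]; congr 1; funext v; simp only [g]; ring
    have hLt : Data.logFactor S A H δ k = (I.data ω).count k h s *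
        (Data.logFactor S A H δ k / (I.data ω).count k h s) := by
      rw [mul_div_cancel₀ _ hnpos.ne']
    set τ := Data.logFactor S A H δ k / (I.data ω).count k h s
    have ht := hgood k (h, s, true)
    have hf := hgood k (h, s, false)
    rw [Data.sum_next_eq _ hn, hLt] at ht hf
    have ht2 := (lt_of_mul_lt_mul_left ht hnpos.le).le
    have hf2 := (lt_of_mul_lt_mul_left hf hnpos.le).le
    simp only [φ, if_true, Bool.false_eq_true, if_false] at ht2 hf2
    rw [hE.sub, hE.const_mul, hE.const, hgm hE, hgm (M.isMean_nextMean h s)] at ht2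
    rw [hE.sub, hE.const, hgm hE, hgm (M.isMean_nextMean h s)] at hf2
    have hH2 : (0 : ℝ) < (H : ℝ) ^ 2 := by positivity
    rw [MDP.nextVar]
    set x := (I.data ω).empMean k h s (fun v =>
        (M.bellmanLookahead h s v - M.nextMean h s (M.bellmanLookahead h s)) ^ 2)
    set z := M.nextMean h s (fun v =>
        (M.bellmanLookahead h s v - M.nextMean h s (M.bellmanLookahead h s)) ^ 2)
    have ht3 := mul_le_mul_of_nonneg_left ht2 hH2.le
    have hf3 := mul_le_mul_of_nonneg_left hf2 hH2.le
    have ex : (H : ℝ) ^ 2 * (x / (H : ℝ) ^ 2) = x := by field_simp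
    have ez : (H : ℝ) ^ 2 * (z / (H : ℝ) ^ 2) = z := by field_simp
    constructor <;> nlinarith
  · intro k
    simp only [Fintype.card_prod, Fintype.card_fin, Fintype.card_bool]
    calc H * (Fintype.card S * 2) = 2 * H * Fintype.card S * 1 * 1 := by ring
      _ ≤ _ := Nat.mul_le_mul (Nat.mul_le_mul_left _ Fintype.card_pos) (by omega)
  · rintro k ⟨h, s, e⟩
    simp only [not_lt]
    refine hI.measure_next_sum_ge_le h s (φ := φ h s e) ?_ k _
    cases e
    · simp only [φ, Bool.false_eq_true, if_false]
      exact (M.isMean_nextMean h s).exp_relative_lower (hg0 h s) (hg1 h s)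
    · simp only [φ, if_true]
      exact (M.isMean_nextMean h s).exp_relative_upper (hg0 h s) (hg1 h s) zero_le_one le_rfl

/-- The relative upper bound with `l = 1/(4H)`; dividing the exponent by `l` produces the factor 4H
in the error. The union over the pairs `B, B'` takes place inside a single index of the general
union bound. -/
theorem measure_hits_le : μ {ω | ¬ ∀ k h s (B B' : Finset (A × S)),
    (I.data ω).count k h s ≠ 0 →
    (I.data ω).empMean k h s (fun v => if Data.HitsAvoids B B' v then 1 else 0) ≤
      (1 + 1 / (4 * (H : ℝ))) *
        M.nextMean h s (fun v => if Data.HitsAvoids B B' v then 1 else 0) +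
        4 * H * (Data.largeLogFactor S A H δ k / (I.data ω).count k h s)} ≤
      ENNReal.ofReal (δ / 8) := by
  have hH' : (1 : ℝ) ≤ H := by exact_mod_cast hH
  set f : Finset (A × S) × Finset (A × S) → (A → S) → ℝ := fun B v =>
    if Data.HitsAvoids B.1 B.2 v then 1 else 0 with hf
  set l : ℝ := 1 / (4 * (H : ℝ)) with hl
  have hl0 : 0 < l := by positivity
  have hl1 : l ≤ 1 := by rw [hl, div_le_one (by positivity)]; linarith
  set φ : Fin H → S → Finset (A × S) × Finset (A × S) → (A → S) → ℝ := fun h s B v =>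
    l * f B v - (l + l ^ 2) * M.nextMean h s (f B) with hφ
  have hU := Data.measure_not_forall_le (S := S) (A := A) (μ := μ) hH h0
    (ι := fun _ => Fin H × S)
    (P := fun k i ω => ∀ B, ∑ j ∈ (Finset.range k).filter
        (fun j => (I.data ω j i.1).state = i.2),
      φ i.1 i.2 B (I.data ω j i.1).next < Data.largeLogFactor S A H δ k) ?_ ?_
  · refine le_trans (measure_mono fun ω hω => ?_) hU
    rw [Set.mem_ofPred_eq] at hω ⊢
    intro hgood
    refine hω fun k h s B B' hn => ?_
    have hnpos : (0 : ℝ) < (I.data ω).count k h s := by exact_mod_cast Nat.pos_of_ne_zero hn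
    have hE := (I.data ω).isMean_empMean hn
    have hLt : Data.largeLogFactor S A H δ k = (I.data ω).count k h s *
        (Data.largeLogFactor S A H δ k / (I.data ω).count k h s) := by
      rw [mul_div_cancel₀ _ hnpos.ne']
    set τ := Data.largeLogFactor S A H δ k / (I.data ω).count k h s
    have ht := hgood k (h, s) (B, B')
    rw [Data.sum_next_eq _ hn, hLt] at ht
    have ht2 := (lt_of_mul_lt_mul_left ht hnpos.le).le
    simp only [φ] at ht2
    rw [hE.sub, hE.const_mul, hE.const] at ht2
    have ht3 := mul_le_mul_of_nonneg_left ht2 (by positivity : 0 ≤ 4 * (H : ℝ))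
    have e1 : 4 * (H : ℝ) * l = 1 := by rw [hl]; field_simp
    change (I.data ω).empMean k h s (f (B, B')) ≤
      (1 + l) * M.nextMean h s (f (B, B')) + 4 * H * τ
    have e2 : 4 * (H : ℝ) * (l * (I.data ω).empMean k h s (f (B, B')) -
        (l + l ^ 2) * M.nextMean h s (f (B, B'))) = (4 * H * l) *
        ((I.data ω).empMean k h s (f (B, B')) - (1 + l) * M.nextMean h s (f (B, B'))) := by ring
    rw [e2, e1] at ht3
    linarith
  · intro k
    simp only [Fintype.card_prod, Fintype.card_fin]
    calc H * Fintype.card S = 1 * H * Fintype.card S * 1 * 1 := by ring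
      _ ≤ _ := by
        gcongr
        · omega
        · exact Fintype.card_pos
        · omega
  · rintro k ⟨h, s⟩
    have hset : {ω | ¬ ∀ B, ∑ j ∈ (Finset.range k).filter (fun j => (I.data ω j h).state = s),
        φ h s B (I.data ω j h).next < Data.largeLogFactor S A H δ k} =
        ⋃ B, {ω | Data.largeLogFactor S A H δ k ≤
          ∑ j ∈ (Finset.range k).filter (fun j => (I.data ω j h).state = s),
        φ h s B (I.data ω j h).next} := by
      ext ω; simp
    dsimp only
    rw [hset]
    have htail := fun B => hI.measure_next_sum_ge_le h s (φ := φ h s B)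
      ((M.isMean_nextMean h s).exp_relative_upper
        (fun v => by simp only [f]; split_ifs <;> norm_num)
        (fun v => by simp only [f]; split_ifs <;> norm_num) hl0.le hl1) k
        (Data.largeLogFactor S A H δ k)
    refine (measure_iUnion_fintype_le _ _).trans ((Finset.sum_le_sum fun B _ => htail B).trans ?_)
    rw [Finset.sum_const, nsmul_eq_mul, ← ENNReal.ofReal_natCast,
      ← ENNReal.ofReal_mul (Nat.cast_nonneg _)]
    refine ENNReal.ofReal_le_ofReal (le_of_eq ?_)
    -- The number of pairs of subsets is (2^(SA))², exactly what the additional term of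
    -- `largeLogFactor` compensates.
    rw [Data.largeLogFactor, neg_add, Real.exp_add, Finset.card_univ, Fintype.card_prod,
      Fintype.card_finset, Fintype.card_prod]
    have e3 : Real.exp (-(2 * ((Fintype.card A * Fintype.card S : ℕ) : ℝ) * Real.log 2)) =
        (((2 : ℝ) ^ (Fintype.card A * Fintype.card S)) ^ 2)⁻¹ := by
      rw [Real.exp_neg, ← pow_mul, mul_right_comm, mul_comm, ← mul_assoc,
        show ((Fintype.card A * Fintype.card S : ℕ) : ℝ) * 2 * Real.log 2 =
          ((Fintype.card A * Fintype.card S * 2 : ℕ) : ℝ) * Real.log 2 by push_cast; ring,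
        Real.exp_nat_mul, Real.exp_log (by norm_num)]
    rw [e3]
    push_cast
    field_simp

end Interaction.InEnvironment

/-! ### Expected inverse visit counts along the played policies. -/

namespace Data

variable {S A : Type*} [Fintype S] [DecidableEq S] [Fintype A] [DecidableEq A] {H : ℕ}

/-- Inverse number of visits of a state. -/
noncomputable def invCount (D : Data S A H) (k : ℕ) (h : Fin H) (s : S) : ℝ :=
  1 / max (D.count k h s : ℝ) 1

/-- Inverse number of visits of a state-action pair. -/
noncomputable def invCountSA (D : Data S A H) (k : ℕ) (h : Fin H) (s : S) (a : A) : ℝ :=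
  1 / max (D.countSA k h s a : ℝ) 1

theorem invCount_nonneg (D : Data S A H) (k : ℕ) (h : Fin H) (s : S) : 0 ≤ D.invCount k h s := by
  unfold invCount; positivity

theorem invCountSA_nonneg (D : Data S A H) (k : ℕ) (h : Fin H) (s : S) (a : A) :
    0 ≤ D.invCountSA k h s a := by
  unfold invCountSA; positivity

theorem invCount_le_one (D : Data S A H) (k : ℕ) (h : Fin H) (s : S) : D.invCount k h s ≤ 1 :=
  div_le_one_of_le₀ (le_max_right _ _) (by positivity)

theorem invCountSA_le_one (D : Data S A H) (k : ℕ) (h : Fin H) (s : S) (a : A) :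
    D.invCountSA k h s a ≤ 1 :=
  div_le_one_of_le₀ (le_max_right _ _) (by positivity)

theorem sum_invCount_le (D : Data S A H) {K : ℕ} (hK : 1 ≤ K) :
    ∑ k ∈ Finset.range K, ∑ h, D.invCount k h (D k h).state ≤
      H * (Fintype.card S * (2 + Real.log K)) := by
  rw [Finset.sum_comm]
  refine (Finset.sum_le_sum fun h _ =>
    sum_inv_visits_le (fun k => (D k h).state) hK).trans_eq ?_
  simp

theorem sum_invCountSA_le (D : Data S A H) {K : ℕ} (hK : 1 ≤ K) :
    ∑ k ∈ Finset.range K, ∑ h, D.invCountSA k h (D k h).state (D k h).action ≤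
      H * (Fintype.card S * Fintype.card A * (2 + Real.log K)) := by
  rw [Finset.sum_comm]
  refine (Finset.sum_le_sum fun h _ => le_of_eq_of_le ?_
    (sum_inv_visits_le (fun k => ((D k h).state, (D k h).action)) hK)).trans_eq ?_
  · simp only [Prod.mk.injEq, invCountSA, countSA]
  · simp

end Data

namespace Interaction.InEnvironment

variable {S A Ω : Type*} [Fintype S] [DecidableEq S] [Nonempty S] [Fintype A] [DecidableEq A]
  [Nonempty A] {H : ℕ}
  {M : MDP S A H} {mΩ : MeasurableSpace Ω} {μ : Measure Ω}
  {ℱ : Filtration ℕ mΩ} {I : Interaction S A H Ω} (hI : I.InEnvironment M μ ℱ)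

include hI

theorem measurable_card_filter {p : Record S A → Prop} [DecidablePred p] {k : ℕ} {h : Fin H}
    (hp : ∀ j, MeasurableSet[ℱ ((j + 1) * H)] {ω | p (I.data ω j h)}) :
    Measurable[ℱ (k * H)]
      (fun ω => (((Finset.range k).filter (fun j => p (I.data ω j h))).card : ℝ)) := by
  have e : (fun ω => (((Finset.range k).filter (fun j => p (I.data ω j h))).card : ℝ)) =
      fun ω => ∑ j ∈ Finset.range k, if p (I.data ω j h) then (1 : ℝ) else 0 := by
    funext ω; simp
  rw [e]
  refine Finset.measurable_sum _ fun j hj => Measurable.ite ?_ measurable_const measurable_const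
  exact ℱ.mono (Nat.mul_le_mul_right _ (Finset.mem_range.1 hj)) _ (hp j)

theorem measurable_invCount (k : ℕ) (h : Fin H) (s : S) :
    Measurable[ℱ (k * H)] (fun ω => (I.data ω).invCount k h s) := by
  have hm := hI.measurable_card_filter (p := fun r => r.state = s) (k := k) (h := h) fun j =>
    hI.state_measurable' (k := j) (h := h) (n := (j + 1) * H)
      (by have := h.2; rw [add_mul]; omega) (t := {s}) trivial
  exact (hm.max measurable_const).const_div 1

theorem measurable_invCountSA (k : ℕ) (h : Fin H) (s : S) (a : A) :
    Measurable[ℱ (k * H)] (fun ω => (I.data ω).invCountSA k h s a) := by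
  have hle : ∀ j, j * H + h + 1 ≤ (j + 1) * H := fun j => by
    have := h.2; rw [add_mul]; omega
  have hm := hI.measurable_card_filter (p := fun r => r.state = s ∧ r.action = a)
    (k := k) (h := h) fun j => MeasurableSet.inter
      (hI.state_measurable' (k := j) (h := h) (n := (j + 1) * H)
        (by have := hle j; omega) (t := {s}) trivial)
      (hI.action_measurable (k := j) (h := h) (hle j) (t := {a}) trivial)
  exact (hm.max measurable_const).const_div 1

variable [IsProbabilityMeasure μ] {δ : ℝ} (hH : 1 ≤ H) (h0 : 0 < δ)

include hH h0

/-- The regret bound involves expectations under the true dynamics, whereas visits are counted along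
realized trajectories. A constant factor 4 and one logarithm, multiplied by H, bridge the two; the
realized sums are harmonic. -/
theorem measure_visits_le : μ {ω | ¬ ∀ k : ℕ,
    ∑ j ∈ Finset.range (k + 1), M.cumulative (I.pol j ω)
      (fun h s _ => (I.data ω).invCount j h s) 0 (I.state j 0 ω) ≤
      4 * H * (Fintype.card S * (2 + Real.log (k + 1 : ℕ)) + Data.logFactor S A H δ k) ∧
    ∑ j ∈ Finset.range (k + 1), M.cumulative (I.pol j ω)
      (fun h s v => (I.data ω).invCountSA j h s (I.pol j ω h s v)) 0 (I.state j 0 ω) ≤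
      4 * H * (Fintype.card S * Fintype.card A * (2 + Real.log (k + 1 : ℕ)) +
        Data.logFactor S A H δ k)} ≤ ENNReal.ofReal (δ / 8) := by
  have hH' : (0 : ℝ) < H := by exact_mod_cast hH
  -- Inverse counts are at most 1; the division by `H` keeps the sum over an episode at most 1, as
  -- the supermartingale requires. The Boolean selects pairs or states.
  set y : Bool → ℕ → Ω → Fin H → S → (A → S) → ℝ := fun e j ω h s v => (1 / (H : ℝ)) *
    (if e then (I.data ω).invCountSA j h s (I.pol j ω h s v) else (I.data ω).invCount j h s)
    with hy
  have hU := Data.measure_not_forall_le (S := S) (A := A) (μ := μ) hH h0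
    (ι := fun _ => Bool)
    (P := fun k e ω => ∑ j ∈ Finset.range (k + 1),
        (M.cumulative (I.pol j ω) (y e j ω) 0 (I.state j 0 ω) / 4 -
          ∑ t : Fin H, y e j ω t (I.state j t.castSucc ω) (I.next j t ω)) <
      Data.logFactor S A H δ k) ?_ ?_
  · refine le_trans (measure_mono fun ω hω => ?_) hU
    rw [Set.mem_ofPred_eq] at hω ⊢
    intro hgood
    refine hω fun k => ?_
    have ht := hgood k true
    have hf := hgood k false
    have hs1 := (I.data ω).sum_invCount_le (K := k + 1) (by omega)
    have hs2 := (I.data ω).sum_invCountSA_le (K := k + 1) (by omega)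
    simp only [y, if_true, Bool.false_eq_true, if_false, MDP.cumulative_const_mul,
      Finset.sum_sub_distrib, ← Finset.mul_sum, ← Finset.sum_div] at ht hf
    change _ - 1 / (H : ℝ) * (∑ k ∈ Finset.range (k + 1),
      ∑ h, (I.data ω).invCount k h (I.data ω k h).state) < _ at hf
    change _ - 1 / (H : ℝ) * (∑ k ∈ Finset.range (k + 1),
      ∑ h, (I.data ω).invCountSA k h (I.data ω k h).state (I.data ω k h).action) < _ at ht
    have e1 : ∀ x z L : ℝ, 1 / (H : ℝ) * x / 4 - 1 / (H : ℝ) * z < L → x < 4 * (z + H * L) := by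
      intro x z L hx
      have h2 := mul_lt_mul_of_pos_left hx hH'
      have h3 : (H : ℝ) * (1 / (H : ℝ) * x / 4 - 1 / (H : ℝ) * z) = x / 4 - z := by field_simp
      rw [h3] at h2
      linarith
    have ht2 := e1 _ _ _ ht
    have hf2 := e1 _ _ _ hf
    constructor <;> linarith
  · intro k
    rw [Fintype.card_bool]
    calc 2 = 2 * 1 * 1 * 1 * 1 := rfl
      _ ≤ _ := by
        gcongr
        · exact Fintype.card_pos
        · exact Fintype.card_pos
        · omega
  · intro k e
    simp only [not_lt]
    refine hI.measure_cumulative_sum_ge_le (y := y e) ?_ ?_ ?_ (k + 1) _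
    · intro j h s v
      refine Measurable.const_mul ?_ _
      cases e
      · simp only [Bool.false_eq_true, if_false]
        exact hI.measurable_invCount j h s
      · simp only [if_true]
        refine measurable_comp_index (idx := fun ω => I.pol j ω h s v)
          (G := fun a ω => (I.data ω).invCountSA j h s a) ?_
          fun a => hI.measurable_invCountSA j h s a
        exact @measurable_of_top Ω _ A _ ⊤ _ (hI.pol_measurable j) fun π => π h s v
    · intro j ω h s v
      simp only [y]
      have := (I.data ω).invCount_nonneg j h s
      have := (I.data ω).invCountSA_nonneg j h s (I.pol j ω h s v)
      split_ifs <;> positivity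
    · intro j ω h s v
      simp only [y]
      refine mul_le_of_le_one_right (by positivity) ?_
      split_ifs
      · exact (I.data ω).invCountSA_le_one _ _ _ _
      · exact (I.data ω).invCount_le_one _ _ _

end Interaction.InEnvironment

namespace Data

variable {S A : Type*} [Fintype S] [DecidableEq S] [Nonempty S] [Fintype A] [DecidableEq A]
  [Nonempty A] {H : ℕ}

theorem logFactor_mono {δ : ℝ} (hH : 1 ≤ H) (h0 : 0 < δ) {j k : ℕ} (hjk : j ≤ k) :
    logFactor S A H δ j ≤ logFactor S A H δ k := by
  have hS : (0 : ℝ) < Fintype.card S := by exact_mod_cast Fintype.card_pos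
  have hA : (0 : ℝ) < Fintype.card A := by exact_mod_cast Fintype.card_pos
  have hH' : (0 : ℝ) < H := by exact_mod_cast hH
  have : (j : ℝ) ≤ k := by exact_mod_cast hjk
  unfold logFactor
  refine Real.log_le_log (by positivity) ?_
  gcongr

theorem log_succ_le_logFactor {δ : ℝ} (hH : 1 ≤ H) (h0 : 0 < δ) (h1 : δ < 1) (k : ℕ) :
    Real.log (k + 1 : ℕ) ≤ logFactor S A H δ k := by
  have hS : (1 : ℝ) ≤ Fintype.card S := by exact_mod_cast Fintype.card_pos
  have hA : (1 : ℝ) ≤ Fintype.card A := by exact_mod_cast Fintype.card_pos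
  have hH' : (1 : ℝ) ≤ H := by exact_mod_cast hH
  have hk : (0 : ℝ) ≤ k := Nat.cast_nonneg k
  unfold logFactor
  refine Real.log_le_log (by positivity) ?_
  rw [le_div_iff₀ h0]
  have h2 : 1 ≤ 16 * (Fintype.card S : ℝ) ^ 3 * (Fintype.card A : ℝ) ^ 2 * (H : ℝ) :=
    one_le_mul_of_one_le_of_one_le (one_le_mul_of_one_le_of_one_le
      (one_le_mul_of_one_le_of_one_le (by norm_num) (one_le_pow₀ hS)) (one_le_pow₀ hA)) hH'
  calc ((k + 1 : ℕ) : ℝ) * δ ≤ (k + 1) * 1 := by push_cast; gcongr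
    _ ≤ (k + 1) * ((k + 1) * (k + 2)) := by
      refine mul_le_mul_of_nonneg_left ?_ (by positivity); nlinarith
    _ = 1 * (k + 1) ^ 2 * (k + 2) := by ring
    _ ≤ _ := by gcongr

theorem largeLogFactor_le {δ : ℝ} {k : ℕ} (hL : 1 ≤ logFactor S A H δ k) :
    largeLogFactor S A H δ k ≤ 3 * (Fintype.card S * Fintype.card A) * logFactor S A H δ k := by
  have hS : (1 : ℝ) ≤ Fintype.card S := by exact_mod_cast Fintype.card_pos
  have hA : (1 : ℝ) ≤ Fintype.card A := by exact_mod_cast Fintype.card_pos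
  have hSA : (1 : ℝ) ≤ Fintype.card S * Fintype.card A := one_le_mul_of_one_le_of_one_le hS hA
  have h2 : Real.log 2 ≤ 1 := by linarith [Real.log_two_lt_d9]
  rw [largeLogFactor]
  push_cast
  set L := logFactor S A H δ k
  set x : ℝ := Fintype.card S * Fintype.card A
  have e : (Fintype.card A : ℝ) * Fintype.card S = x := mul_comm _ _
  rw [e]
  have h3 : L ≤ x * L := le_mul_of_one_le_left (by linarith) hSA
  have h4 : x * Real.log 2 ≤ x * L := mul_le_mul_of_nonneg_left (h2.trans hL) (by linarith)
  linarith

/-- The argument of the logarithm is at most 2⁵z³ with z = SAHK/δ. The constant is absorbed because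
z ≥ 2, which is where SAHK ≥ 2 enters: otherwise log(1/δ) may be arbitrarily small. -/
theorem logFactor_le_mul_log {δ : ℝ} (hH : 1 ≤ H) (h0 : 0 < δ) (h1 : δ < 1) (k : ℕ)
    (h2 : 2 ≤ Fintype.card S * Fintype.card A * H * (k + 1)) :
    logFactor S A H δ k ≤
      8 * Real.log ((Fintype.card S : ℝ) * Fintype.card A * H * (k + 1 : ℕ) / δ) := by
  have hS : (1 : ℝ) ≤ Fintype.card S := by exact_mod_cast Fintype.card_pos
  have hA : (1 : ℝ) ≤ Fintype.card A := by exact_mod_cast Fintype.card_pos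
  have hH' : (1 : ℝ) ≤ H := by exact_mod_cast hH
  have hk : (0 : ℝ) ≤ k := Nat.cast_nonneg k
  have h2' : (2 : ℝ) ≤ (Fintype.card S : ℝ) * Fintype.card A * H * (k + 1 : ℕ) := by
    exact_mod_cast h2
  set z : ℝ := (Fintype.card S : ℝ) * Fintype.card A * H * (k + 1 : ℕ) / δ with hz
  have hz2 : 2 ≤ z := by rw [hz, le_div_iff₀ h0]; nlinarith
  have hlog : Real.log 2 ≤ Real.log z := Real.log_le_log (by norm_num) hz2
  have h3 : logFactor S A H δ k ≤ Real.log (2 ^ 5 * z ^ 3) := by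
    unfold logFactor
    refine Real.log_le_log (by positivity) ?_
    have e : (2 : ℝ) ^ 5 * z ^ 3 = 32 * ((Fintype.card S : ℝ) ^ 3 * (Fintype.card A : ℝ) ^ 3 *
      (H : ℝ) ^ 3 * (k + 1) ^ 3) / δ ^ 3 := by rw [hz]; push_cast; field_simp; norm_num
    rw [e]
    refine div_le_div₀ (by positivity) ?_ (by positivity)
      (pow_le_of_le_one h0.le h1.le (by norm_num))
    have e2 : (k : ℝ) + 2 ≤ 2 * (k + 1) := by linarith
    have e3 : (Fintype.card A : ℝ) ^ 2 ≤ (Fintype.card A : ℝ) ^ 3 :=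
      pow_le_pow_right₀ hA (by norm_num)
    have e4 : (H : ℝ) ≤ (H : ℝ) ^ 3 := le_self_pow₀ hH' (by norm_num)
    calc _ ≤ 16 * (Fintype.card S : ℝ) ^ 3 * (Fintype.card A : ℝ) ^ 3 * (H : ℝ) ^ 3 *
          ((k : ℝ) + 1) ^ 2 * (2 * (k + 1)) := by gcongr
      _ = _ := by ring
  rw [Real.log_mul (by positivity) (by positivity), Real.log_pow, Real.log_pow] at h3
  push_cast at h3
  linarith

end Data

/-! ### The regret bound. -/

/-- The letters a, b, c, d are the square roots of S, H, K, A, which makes every exponent integral.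
The weights α and β balance the variance or constant part against the visit part of each bonus; the
term with ℓ becomes the lower-order remainder. -/
theorem regret_arithmetic {a b c d L X₁ X₂ ℓ α β : ℝ} (ha : 0 < a) (hb : 0 < b) (hc : 0 < c)
    (hd : 0 < d) (hL : 0 < L) (hα : α = L * a / (b * c)) (hβ : β = L * a * d / c)
    (hX₁ : X₁ ≤ 16 * b ^ 2 * a ^ 2 * L) (hX₂ : X₂ ≤ 16 * b ^ 2 * (a ^ 2 * d ^ 2) * L)
    (hℓ0 : 0 ≤ ℓ) (hℓ : ℓ ≤ 3 * (a ^ 2 * d ^ 2) * L) :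
    3 * (c ^ 2 * (2 * β * b ^ 2) + 2 * L / β * X₂ + (c ^ 2 * (11 * α * (2 * (b ^ 2) ^ 2)) +
        (11 * L / α + 1000 * (b ^ 2) ^ 2 * ℓ) * X₁)) ≤
      600 * (b ^ 2 * a * c * (b + d) * L) + 144000 * (b ^ 6 * a ^ 4 * d ^ 2 * L ^ 2) := by
  have hα0 : 0 < α := by rw [hα]; positivity
  have hβ0 : 0 < β := by rw [hβ]; positivity
  have h1 : 2 * L / β * X₂ ≤ 32 * (b ^ 2 * a * c * d * L) := by
    calc 2 * L / β * X₂ ≤ 2 * L / β * (16 * b ^ 2 * (a ^ 2 * d ^ 2) * L) := by gcongr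
      _ = _ := by rw [hβ]; field_simp; ring
  have h2 : (11 * L / α + 1000 * (b ^ 2) ^ 2 * ℓ) * X₁ ≤
      176 * (b ^ 2 * a * c * b * L) + 48000 * (b ^ 6 * a ^ 4 * d ^ 2 * L ^ 2) := by
    calc (11 * L / α + 1000 * (b ^ 2) ^ 2 * ℓ) * X₁ ≤
        (11 * L / α + 1000 * (b ^ 2) ^ 2 * (3 * (a ^ 2 * d ^ 2) * L)) *
          (16 * b ^ 2 * a ^ 2 * L) :=
          (mul_le_mul_of_nonneg_left hX₁ (by positivity)).trans
            (mul_le_mul_of_nonneg_right (by gcongr) (by positivity))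
      _ = _ := by rw [hα]; field_simp; ring
  have h3 : c ^ 2 * (2 * β * b ^ 2) = 2 * (b ^ 2 * a * c * d * L) := by
    rw [hβ]; field_simp
  have h4 : c ^ 2 * (11 * α * (2 * (b ^ 2) ^ 2)) = 22 * (b ^ 2 * a * c * b * L) := by
    rw [hα]; field_simp; norm_num
  rw [h3, h4]
  have p1 : 0 < b ^ 2 * a * c * d * L := by positivity
  have p2 : 0 < b ^ 2 * a * c * b * L := by positivity
  have e : b ^ 2 * a * c * (b + d) * L = b ^ 2 * a * c * b * L + b ^ 2 * a * c * d * L := by ring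
  rw [e]
  linarith

variable {S A : Type*} [Fintype S] [DecidableEq S] [Nonempty S] [Fintype A] [DecidableEq A]
  [Nonempty A] {H : ℕ}

/-- The expected sum of the bonuses of one episode, after an application of the inequality of
arithmetic and geometric means with weights `α` and `β`. -/
theorem Data.IsAccurate.gap_le_visits {D : Data S A H} {M : MDP S A H} {δ : ℝ} {j k : ℕ}
    (hD : D.IsAccurate M δ j) (hH : 1 ≤ H) (h0 : 0 < δ) (h1 : δ < 1) (hjk : j ≤ k)
    {π : DetPolicy S A H} (hπ : D.IsGreedy δ j π) {α β : ℝ} (hα : 0 < α) (hβ : 0 < β) (s : S) :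
    M.bellman 0 s - M.cumulative π (M.policyReward π) 0 s ≤
      3 * ((2 * β * H + 2 * Data.logFactor S A H δ k / β *
        M.cumulative π (fun h s v => D.invCountSA j h s (π h s v)) 0 s) +
        (11 * α * (2 * (H : ℝ) ^ 2) + (11 * Data.logFactor S A H δ k / α +
          1000 * (H : ℝ) ^ 2 * Data.largeLogFactor S A H δ k) *
          M.cumulative π (fun h s _ => D.invCount j h s) 0 s)) := by
  have hL := Data.one_le_logFactor (S := S) (A := A) hH h0 h1 j
  have hLk := Data.logFactor_mono (S := S) (A := A) hH h0 hjk
  have hℓ : Data.largeLogFactor S A H δ j ≤ Data.largeLogFactor S A H δ k := by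
    unfold Data.largeLogFactor; linarith
  set L := Data.logFactor S A H δ k
  set ℓ := Data.largeLogFactor S A H δ k
  have hL0 : 0 ≤ L := by linarith
  refine (hD.gap_le_cumulative hL hπ s).trans (mul_le_mul_of_nonneg_left ?_ (by norm_num))
  have hvar := M.cumulative_nextVar_le π s
  have hconst := MDP.cumulative_le (M := M) (π := π) (ρ := fun _ _ _ => 2 * β) (c := 2 * β)
    (fun _ _ _ => le_rfl) 0 s (Nat.zero_le _)
  rw [Nat.cast_zero, sub_zero] at hconst
  calc _ ≤ M.cumulative π (fun h s v =>
        (2 * β + 2 * L / β * D.invCountSA j h s (π h s v)) +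
        (11 * α * M.nextVar h s (M.policyLookahead π h s) +
          (11 * L / α + 1000 * (H : ℝ) ^ 2 * ℓ) * D.invCount j h s)) 0 s := ?_
    _ ≤ _ := ?_
  · refine MDP.cumulative_mono (fun h s v => add_le_add ?_ ?_) 0 s
    · have e1 : D.rewardBonus δ j h s (π h s v) ≤ √(1 * (L * D.invCountSA j h s (π h s v))) := by
        refine (min_le_left _ _).trans (Real.sqrt_le_sqrt ?_)
        rw [Data.invCountSA, one_mul, mul_one_div]
        gcongr
      have e2 := sqrt_mul_le_half_add (x := 1) (y := L * D.invCountSA j h s (π h s v))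
        zero_le_one (mul_nonneg hL0 (D.invCountSA_nonneg _ _ _ _)) hβ
      have e3 : 2 * L / β * D.invCountSA j h s (π h s v) =
        2 * (L * D.invCountSA j h s (π h s v) / β) := by ring
      rw [e3]
      linarith
    · have e1 : √(M.nextVar h s (M.policyLookahead π h s) *
          (Data.logFactor S A H δ j / max (D.count j h s : ℝ) 1)) ≤
          √(M.nextVar h s (M.policyLookahead π h s) * (L * D.invCount j h s)) := by
        refine Real.sqrt_le_sqrt (mul_le_mul_of_nonneg_left ?_ MDP.nextVar_nonneg)
        rw [Data.invCount, mul_one_div]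
        gcongr
      have e2 := sqrt_mul_le_half_add (x := M.nextVar h s (M.policyLookahead π h s))
        (y := L * D.invCount j h s) MDP.nextVar_nonneg
        (mul_nonneg hL0 (D.invCount_nonneg _ _ _)) hα
      have e3 : (H : ℝ) ^ 2 * (Data.largeLogFactor S A H δ j / max (D.count j h s : ℝ) 1) ≤
          (H : ℝ) ^ 2 * ℓ * D.invCount j h s := by
        rw [Data.invCount, mul_one_div, mul_div_assoc]
        gcongr
      have e4 : (11 * L / α + 1000 * (H : ℝ) ^ 2 * ℓ) * D.invCount j h s =
        11 * (L * D.invCount j h s / α) + 1000 * ((H : ℝ) ^ 2 * ℓ * D.invCount j h s) := by ring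
      rw [e4]
      linarith
  · rw [MDP.cumulative_add, MDP.cumulative_add, MDP.cumulative_add,
      MDP.cumulative_const_mul (2 * L / β) (fun h s v => D.invCountSA j h s (π h s v)),
      MDP.cumulative_const_mul (11 * α) (fun h s _ => M.nextVar h s (M.policyLookahead π h s)),
      MDP.cumulative_const_mul _ (fun h s _ => D.invCount j h s)]
    gcongr

theorem subsingleton_policy [Subsingleton A] : Subsingleton (Policy S A H) := by
  have : Subsingleton (PMF A) := ⟨fun p q => by
    have key : ∀ (p : PMF A) (a : A), p a = 1 := fun p a => by
      rw [← p.tsum_coe, tsum_fintype, Fintype.sum_subsingleton _ a]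
    exact PMF.ext fun a => (key p a).trans (key q a).symm⟩
  infer_instance

namespace Interaction

variable {Ω : Type*} {M : MDP S A H} {I : Interaction S A H Ω} {δ : ℝ}

/-- With a single action all policies coincide, so there is nothing to lose. -/
theorem regret_eq_zero [Subsingleton A] (K : ℕ) (ω : Ω) : I.regret M K ω ≤ 0 := by
  have := subsingleton_policy (S := S) (A := A) (H := H)
  refine Finset.sum_nonpos fun k _ => sub_nonpos.2 ?_
  have : Nonempty (Policy S A H) := ⟨(I.pol k ω).toPolicy⟩
  exact ciSup_le fun π => (congrArg (fun π => M.value π 0 (I.state k 0 ω))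
    (Subsingleton.elim π (I.pol k ω).toPolicy)).le

/-- The weights depend on the horizon `k + 1` of the summation and are the same for all its
episodes, so that the visit counts may be summed first and bounded afterwards. -/
theorem regret_le (hH : 1 ≤ H) (h0 : 0 < δ) (h1 : δ < 1) (hrun : I.RunsMVPTL δ) {ω : Ω}
    (hacc : ∀ k, (I.data ω).IsAccurate M δ k) (k : ℕ)
    (hvis : ∑ j ∈ Finset.range (k + 1), M.cumulative (I.pol j ω)
      (fun h s _ => (I.data ω).invCount j h s) 0 (I.state j 0 ω) ≤
      4 * H * (Fintype.card S * (2 + Real.log (k + 1 : ℕ)) + Data.logFactor S A H δ k))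
    (hvisSA : ∑ j ∈ Finset.range (k + 1), M.cumulative (I.pol j ω)
      (fun h s v => (I.data ω).invCountSA j h s (I.pol j ω h s v)) 0 (I.state j 0 ω) ≤
      4 * H * (Fintype.card S * Fintype.card A * (2 + Real.log (k + 1 : ℕ)) +
        Data.logFactor S A H δ k)) :
    I.regret M (k + 1) ω ≤
      600 * (√((H : ℝ) ^ 2 * Fintype.card S * (k + 1 : ℕ)) * (√H + √(Fintype.card A)) *
        Data.logFactor S A H δ k) +
      144000 * ((H : ℝ) ^ 3 * (Fintype.card S : ℝ) ^ 2 * Fintype.card A *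
        Data.logFactor S A H δ k ^ 2) := by
  have hS : (1 : ℝ) ≤ Fintype.card S := by exact_mod_cast Fintype.card_pos
  have hA : (1 : ℝ) ≤ Fintype.card A := by exact_mod_cast Fintype.card_pos
  have hH' : (1 : ℝ) ≤ H := by exact_mod_cast hH
  have hK' : (1 : ℝ) ≤ (k + 1 : ℕ) := by exact_mod_cast (by omega)
  have hL := Data.one_le_logFactor (S := S) (A := A) hH h0 h1 k
  have hlog := Data.log_succ_le_logFactor (S := S) (A := A) hH h0 h1 k
  have hℓ := Data.largeLogFactor_le hL
  have hℓ0 : 0 ≤ Data.largeLogFactor S A H δ k :=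
    (zero_le_one.trans hL).trans (Data.logFactor_le_largeLogFactor δ k)
  set L := Data.logFactor S A H δ k
  set ℓ := Data.largeLogFactor S A H δ k
  have sqS : √(Fintype.card S : ℝ) ^ 2 = Fintype.card S := Real.sq_sqrt (by positivity)
  have sqA : √(Fintype.card A : ℝ) ^ 2 = Fintype.card A := Real.sq_sqrt (by positivity)
  have sqH : √(H : ℝ) ^ 2 = H := Real.sq_sqrt (by positivity)
  have sqK : √((k + 1 : ℕ) : ℝ) ^ 2 = (k + 1 : ℕ) := Real.sq_sqrt (by positivity)
  have pS : 0 < √(Fintype.card S : ℝ) := Real.sqrt_pos.2 (by positivity)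
  have pA : 0 < √(Fintype.card A : ℝ) := Real.sqrt_pos.2 (by positivity)
  have pH : 0 < √(H : ℝ) := Real.sqrt_pos.2 (by positivity)
  have pK : 0 < √((k + 1 : ℕ) : ℝ) := Real.sqrt_pos.2 (by positivity)
  set a := √(Fintype.card S : ℝ)
  set d := √(Fintype.card A : ℝ)
  set b := √(H : ℝ)
  set c := √((k + 1 : ℕ) : ℝ)
  have hroot : √((H : ℝ) ^ 2 * Fintype.card S * (k + 1 : ℕ)) = b ^ 2 * a * c := by
    rw [← sqS, ← sqK, ← sqH, ← mul_pow, ← mul_pow, Real.sqrt_sq (by positivity)]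
  set α := L * a / (b * c) with hα
  set β := L * a * d / c with hβ
  have hα0 : 0 < α := by positivity
  have hβ0 : 0 < β := by positivity
  set X₁ := ∑ j ∈ Finset.range (k + 1), M.cumulative (I.pol j ω)
      (fun h s _ => (I.data ω).invCount j h s) 0 (I.state j 0 ω)
  set X₂ := ∑ j ∈ Finset.range (k + 1), M.cumulative (I.pol j ω)
      (fun h s v => (I.data ω).invCountSA j h s (I.pol j ω h s v)) 0 (I.state j 0 ω)
  have hX₁ : X₁ ≤ 16 * b ^ 2 * a ^ 2 * L := by
    rw [sqH, sqS]
    refine hvis.trans ?_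
    have : Fintype.card S * (2 + Real.log (k + 1 : ℕ)) + L ≤ 4 * (Fintype.card S * L) := by
      nlinarith
    nlinarith
  have hX₂ : X₂ ≤ 16 * b ^ 2 * (a ^ 2 * d ^ 2) * L := by
    rw [sqH, sqS, sqA]
    refine hvisSA.trans ?_
    have hSA : (1 : ℝ) ≤ Fintype.card S * Fintype.card A := one_le_mul_of_one_le_of_one_le hS hA
    have : Fintype.card S * Fintype.card A * (2 + Real.log (k + 1 : ℕ)) + L ≤
      4 * (Fintype.card S * Fintype.card A * L) := by nlinarith
    nlinarith
  have hmain := regret_arithmetic pS pH pK pA (by linarith) hα hβ hX₁ hX₂ hℓ0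
    (by rw [sqS, sqA]; exact hℓ)
  have hsum : I.regret M (k + 1) ω ≤
      3 * (c ^ 2 * (2 * β * b ^ 2) + 2 * L / β * X₂ + (c ^ 2 * (11 * α * (2 * (b ^ 2) ^ 2)) +
        (11 * L / α + 1000 * (b ^ 2) ^ 2 * ℓ) * X₁)) := by
    rw [sqH, sqK]
    refine (Finset.sum_le_sum fun j hj => ?_ : I.regret M (k + 1) ω ≤
      ∑ j ∈ Finset.range (k + 1), 3 * ((2 * β * H + 2 * L / β *
        M.cumulative (I.pol j ω) (fun h s v => (I.data ω).invCountSA j h s (I.pol j ω h s v)) 0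
          (I.state j 0 ω)) + (11 * α * (2 * (H : ℝ) ^ 2) + (11 * L / α + 1000 * (H : ℝ) ^ 2 * ℓ) *
          M.cumulative (I.pol j ω) (fun h s _ => (I.data ω).invCount j h s) 0
            (I.state j 0 ω)))).trans_eq ?_
    · rw [M.value_toPolicy]
      exact (sub_le_sub_right (M.optimalValue_le_bellman _ _) _).trans
        ((hacc j).gap_le_visits hH h0 h1 (by have := Finset.mem_range.1 hj; omega) (hrun ω j)
          hα0 hβ0 _)
    · rw [← Finset.mul_sum, Finset.sum_add_distrib, Finset.sum_add_distrib,
        Finset.sum_add_distrib, Finset.sum_const, Finset.sum_const, ← Finset.mul_sum,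
        ← Finset.mul_sum, Finset.card_range, nsmul_eq_mul, nsmul_eq_mul]
  refine hsum.trans (hmain.trans (le_of_eq ?_))
  rw [hroot]
  have e1 : (H : ℝ) ^ 3 = b ^ 6 := by rw [← sqH]; ring
  have e2 : (Fintype.card S : ℝ) ^ 2 = a ^ 4 := by rw [← sqS]; ring
  rw [e1, e2, ← sqA]

theorem regret_le_of_visits (hH : 1 ≤ H) (h0 : 0 < δ) (h1 : δ < 1) (hrun : I.RunsMVPTL δ) {ω : Ω}
    (hacc : ∀ k, (I.data ω).IsAccurate M δ k) (k : ℕ)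
    (hvis : ∑ j ∈ Finset.range (k + 1), M.cumulative (I.pol j ω)
      (fun h s _ => (I.data ω).invCount j h s) 0 (I.state j 0 ω) ≤
      4 * H * (Fintype.card S * (2 + Real.log (k + 1 : ℕ)) + Data.logFactor S A H δ k))
    (hvisSA : ∑ j ∈ Finset.range (k + 1), M.cumulative (I.pol j ω)
      (fun h s v => (I.data ω).invCountSA j h s (I.pol j ω h s v)) 0 (I.state j 0 ω) ≤
      4 * H * (Fintype.card S * Fintype.card A * (2 + Real.log (k + 1 : ℕ)) +
        Data.logFactor S A H δ k)) :
    I.regret M (k + 1) ω ≤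
      10 ^ 7 * (√((H : ℝ) ^ 2 * Fintype.card S * (k + 1 : ℕ)) * (√H + √(Fintype.card A)) *
        Real.log ((Fintype.card S : ℝ) * Fintype.card A * H * (k + 1 : ℕ) / δ) +
      (H : ℝ) ^ 3 * (Fintype.card S : ℝ) ^ 4 * (Fintype.card A : ℝ) ^ 3 *
        Real.log ((Fintype.card S : ℝ) * Fintype.card A * H * (k + 1 : ℕ) / δ) ^ 2) := by
  have hS : (1 : ℝ) ≤ Fintype.card S := by exact_mod_cast Fintype.card_pos
  have hA : (1 : ℝ) ≤ Fintype.card A := by exact_mod_cast Fintype.card_pos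
  have hH' : (1 : ℝ) ≤ H := by exact_mod_cast hH
  have hK' : (1 : ℝ) ≤ (k + 1 : ℕ) := by exact_mod_cast (by omega)
  have hx : 0 ≤ Real.log ((Fintype.card S : ℝ) * Fintype.card A * H * (k + 1 : ℕ) / δ) := by
    refine Real.log_nonneg ?_
    rw [le_div_iff₀ h0, one_mul]
    exact h1.le.trans (one_le_mul_of_one_le_of_one_le (one_le_mul_of_one_le_of_one_le
      (one_le_mul_of_one_le_of_one_le hS hA) hH') hK')
  -- If SAHK = 1, the logarithm of the statement need not dominate the logarithmic factor, but then
  -- `A` has one element and the regret is at most 0.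
  by_cases h2 : 2 ≤ Fintype.card S * Fintype.card A * H * (k + 1)
  · have hL := Data.one_le_logFactor (S := S) (A := A) hH h0 h1 k
    have hL8 := Data.logFactor_le_mul_log (S := S) (A := A) hH h0 h1 k h2
    have hreg := regret_le hH h0 h1 hrun hacc k hvis hvisSA
    set L := Data.logFactor S A H δ k
    set x := Real.log ((Fintype.card S : ℝ) * Fintype.card A * H * (k + 1 : ℕ) / δ)
    set P := √((H : ℝ) ^ 2 * Fintype.card S * (k + 1 : ℕ)) * (√H + √(Fintype.card A))
    have hP : 0 ≤ P := by positivity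
    have e1 : P * L ≤ 8 * (P * x) := by nlinarith
    have e2 : L ^ 2 ≤ 64 * x ^ 2 := by nlinarith
    -- The remainder obtained is of order S² A and is only here enlarged to S⁴ A³. The constants 8 ·
    -- 600 and 64 · 144000 both lie below 10⁷.
    have e3 : (H : ℝ) ^ 3 * (Fintype.card S : ℝ) ^ 2 * Fintype.card A * L ^ 2 ≤
        (H : ℝ) ^ 3 * (Fintype.card S : ℝ) ^ 4 * (Fintype.card A : ℝ) ^ 3 * (64 * x ^ 2) := by
      gcongr
      · norm_num
      · exact le_self_pow₀ hA (by norm_num)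
    have e4 : 0 ≤ P * x := by positivity
    have e5 : 0 ≤ (H : ℝ) ^ 3 * (Fintype.card S : ℝ) ^ 4 * (Fintype.card A : ℝ) ^ 3 * x ^ 2 := by
      positivity
    linarith
  · have hA1 : Fintype.card A = 1 := by
      refine le_antisymm ?_ Fintype.card_pos
      have h3 : Fintype.card A * 1 ≤ Fintype.card A * (Fintype.card S * H * (k + 1)) :=
        Nat.mul_le_mul_left _ (Nat.mul_pos (Nat.mul_pos Fintype.card_pos hH) (by omega))
      have h4 : Fintype.card A * (Fintype.card S * H * (k + 1)) =
        Fintype.card S * Fintype.card A * H * (k + 1) := by ring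
      omega
    have : Subsingleton A := Fintype.card_le_one_iff_subsingleton.1 hA1.le
    exact (regret_eq_zero (k + 1) ω).trans (by positivity)

end Interaction

end LookaheadRL

theorem mainTheorem2 :
    ∃ C : ℝ, 0 < C ∧
      ∀ (S A Ω : Type*) [Fintype S] [DecidableEq S] [Nonempty S]
        [Fintype A] [DecidableEq A] [Nonempty A]
        (H : ℕ) (_ : 1 ≤ H) (M : LookaheadRL.MDP S A H)
        [MeasurableSpace Ω] (μ : Measure Ω) [IsProbabilityMeasure μ]
        (ℱ : Filtration ℕ ‹MeasurableSpace Ω›)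
        (I : LookaheadRL.Interaction S A H Ω)
        (δ : ℝ) (_ : 0 < δ) (_ : δ < 1),
        I.InEnvironment M μ ℱ → I.RunsMVPTL δ →
        ENNReal.ofReal (1 - δ) ≤ μ {ω | ∀ K : ℕ, 1 ≤ K →
          I.regret M K ω ≤
            C * (Real.sqrt ((H : ℝ) ^ 2 * Fintype.card S * K) *
                  (Real.sqrt H + Real.sqrt (Fintype.card A)) *
                  Real.log ((Fintype.card S : ℝ) * Fintype.card A * H * K / δ) +
                (H : ℝ) ^ 3 * (Fintype.card S : ℝ) ^ 4 * (Fintype.card A : ℝ) ^ 3 *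
                  Real.log ((Fintype.card S : ℝ) * Fintype.card A * H * K / δ) ^ 2)} := by
  refine ⟨10 ^ 7, by positivity, ?_⟩
  intro S A Ω _ _ _ _ _ _ H hH M _ μ _ ℱ I δ h0 h1 hI hrun
  have b1 := hI.measure_reward_le hH h0 h1
  have b2 := hI.measure_mean_le hH h0 h1
  have b3 := hI.measure_var_le hH h0 h1
  have b4 := hI.measure_hits_le hH h0 h1
  have b5 := hI.measure_visits_le hH h0
  have b0 : μ {ω | ¬ ∀ k h, I.reward k h ω ∈ Set.Icc (0 : ℝ) 1} = 0 := hI.ae_reward_mem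
  set B0 := {ω | ¬ ∀ k h, I.reward k h ω ∈ Set.Icc (0 : ℝ) 1} with hB0
  generalize hB1 : {ω | ¬ _} = B1 at b1
  generalize hB2 : {ω | ¬ _} = B2 at b2
  generalize hB3 : {ω | ¬ _} = B3 at b3
  generalize hB4 : {ω | ¬ _} = B4 at b4
  generalize hB5 : {ω | ¬ _} = B5 at b5
  set G := {ω | ∀ K : ℕ, 1 ≤ K → I.regret M K ω ≤
            10 ^ 7 * (Real.sqrt ((H : ℝ) ^ 2 * Fintype.card S * K) *
                  (Real.sqrt H + Real.sqrt (Fintype.card A)) *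
                  Real.log ((Fintype.card S : ℝ) * Fintype.card A * H * K / δ) +
                (H : ℝ) ^ 3 * (Fintype.card S : ℝ) ^ 4 * (Fintype.card A : ℝ) ^ 3 *
                  Real.log ((Fintype.card S : ℝ) * Fintype.card A * H * K / δ) ^ 2)} with hG
  -- The good event is bounded below through a covering of the whole space: subadditivity requires
  -- no measurability of any of these sets.
  have hcover : Set.univ ⊆ G ∪ (B0 ∪ (B1 ∪ (B2 ∪ (B3 ∪ (B4 ∪ B5))))) := by
    intro ω _
    by_contra hω
    simp only [Set.mem_union, not_or] at hω
    obtain ⟨hg, w0, w1, w2, w3, w4, w5⟩ := hω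
    rw [hB0, Set.mem_ofPred_eq, not_not] at w0
    rw [← hB1, Set.mem_ofPred_eq, not_not] at w1
    rw [← hB2, Set.mem_ofPred_eq, not_not] at w2
    rw [← hB3, Set.mem_ofPred_eq, not_not] at w3
    rw [← hB4, Set.mem_ofPred_eq, not_not] at w4
    rw [← hB5, Set.mem_ofPred_eq, not_not] at w5
    refine hg ?_
    rw [hG, Set.mem_ofPred_eq]
    intro K hK
    obtain ⟨k, rfl⟩ := Nat.exists_eq_add_of_le' hK
    exact LookaheadRL.Interaction.regret_le_of_visits hH h0 h1 hrun
      (fun k => ⟨w0, w1 k, w2 k, fun h s hn => (w3 k h s hn).1, fun h s hn => (w3 k h s hn).2,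
        w4 k⟩) k (w5 k).1 (w5 k).2
  have hbad : μ (B0 ∪ (B1 ∪ (B2 ∪ (B3 ∪ (B4 ∪ B5))))) ≤ ENNReal.ofReal δ := by
    calc _ ≤ μ B0 + (μ B1 + (μ B2 + (μ B3 + (μ B4 + μ B5)))) := by
          refine (measure_union_le _ _).trans (add_le_add le_rfl ?_)
          refine (measure_union_le _ _).trans (add_le_add le_rfl ?_)
          refine (measure_union_le _ _).trans (add_le_add le_rfl ?_)
          exact (measure_union_le _ _).trans (add_le_add le_rfl (measure_union_le _ _))
      _ ≤ 0 + (ENNReal.ofReal (δ / 8) + (ENNReal.ofReal (δ / 8) + (ENNReal.ofReal (δ / 8) +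
          (ENNReal.ofReal (δ / 8) + ENNReal.ofReal (δ / 8))))) := by
          gcongr
          exact b0.le
      -- Five events of probability at most δ/8 each; the rewards leave `[0, 1]` with probability
      -- zero.
      _ = ENNReal.ofReal (5 * (δ / 8)) := by
          have hδ : 0 ≤ δ / 8 := by positivity
          rw [zero_add, ← ENNReal.ofReal_add hδ hδ, ← ENNReal.ofReal_add hδ (by positivity),
            ← ENNReal.ofReal_add hδ (by positivity), ← ENNReal.ofReal_add hδ (by positivity)]
          congr 1; ring
      _ ≤ _ := ENNReal.ofReal_le_ofReal (by linarith)
  rw [ENNReal.ofReal_sub _ h0.le, ENNReal.ofReal_one, tsub_le_iff_right]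
  calc (1 : ENNReal) = μ Set.univ := measure_univ.symm
    _ ≤ _ := measure_mono hcover
    _ ≤ _ := measure_union_le _ _
    _ ≤ _ := add_le_add le_rfl hbad
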